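/- Let $k$ be an algebraically closed field of characteristic $0$. A genus $2$ curve over $k$ is a curve $Y^2=f(X)$ with $f\in k[X]$ squarefree of degree $5$ or $6$; its automorphism group is the group of $k$-automorphisms of its function field. Let $J_2,J_4,J_6,J_{10}$ be the Igusa invariants of the binary sextic defined by $f$; that is, for $f=c\prod_{i=1}^{6}(X-r_i)$ and $(ij)=r_i-r_j$, $$J_2=c^2\sum_{15}(12)^2(34)^2(56)^2,\qquad J_4=c^4\sum_{10}(12)^2(23)^2(31)^2(45)^2(56)^2(64)^2,$$ $$J_6=c^6\sum_{60}(12)^2(23)^2(31)^2(45)^2(56)^2(64)^2(14)^2(25)^2(36)^2,\qquad J_{10}=c^{10}\prod_{i<j}(ij)^2,$$ and for $f$ of degree $5$ they are given by the same polynomials in the coefficients $a_0,\dots,a_6$ of $f$ with $a_6=0$. When $J_2\neq 0$ put $$i_1=144\frac{J_4}{J_2^2},\qquad i_2=-1728\frac{J_2J_4-3J_6}{J_2^3},\qquad i_3=486\frac{J_{10}}{J_2^5}.$$ Write $x,y,z$ for $i_1,i_2,i_3$. The level-$2$ Shaska surface is the surface $\mathfrak S_2=0$ in affine $3$-space, where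 $$\begin{aligned}\mathfrak S_2(x,y,z)=\;&-27x^6-9459597312000\,z^2x^2+20639121408000\,z^2y+111451255603200\,z^2x-240734712102912\,z^2\\ &-55240704\,zx^4-18\,y^2x^4-8294400\,zy^2x^2-47278080\,zyx^3-264180754022400000\,z^3\\ &-2866544640000\,z^2yx+2x^6y-4x^3y^3+9x^7+331776\,zx^5+107495424\,zyx^2-27y^4+9xy^4\\ &-52254720\,zy^2x+2y^5+161243136\,zy^2+161243136\,zx^3-12441600\,zy^3+54x^3y^2 .\end{aligned}$$ Let $\mathcal T_2$ be its singular locus, the set of points of $k^3$ where $\mathfrak S_2$ and its three partial derivatives vanish. Let $C_1$, $C_2$ and $C_3$ be the sets of points $(x,y,z)$ of $\mathcal T_2$ at which, respectively, $$C_1:\quad 100y^2-1458y+540xy-243x^2+80x^3=0,$$ $$C_2:\quad 3888x-1188x^2+5x^3+432y-360xy-25y^2=0,$$ $$C_3:\quad \begin{cases}50x^4-7515x^3-825yx^2+20412x^2-23490xy-4050y^2+52488y=0,\\ 125y^2-1620y+1125xy-5832x+1890x^2+25x^3=0.\end{cases}$$ Put $P=\left(\tfrac{81}{20},-\tfrac{729}{200},\tfrac{729}{25600000}\right)$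 and $Q=\left(-\tfrac{36}{5},\tfrac{1512}{25},\tfrac{243}{200000}\right)$. Let $D_4$ and $D_6$ be the dihedral groups of order $8$ and $12$. **Theorem.** 1. $\mathcal T_2=C_1\cup C_2$. The irreducible components of $\mathcal T_2$ are exactly $C_1$ and $C_2$; these are two distinct irreducible curves. The projection $(x,y,z)\mapsto(x,y)$ maps $C_1$ and $C_2$ bijectively onto the plane curves given by the respective displayed equations. 2. $C_1$ is the locus of genus $2$ curves with automorphism group $D_4$, and $C_2$ is the locus of genus $2$ curves with automorphism group $D_6$. Precisely: the set of points $(i_1,i_2,i_3)$ of genus $2$ curves over $k$ with $J_2\ne0$ and automorphism group isomorphic to $D_4$ (resp. $D_6$) is the set of points of $C_1$ (resp. $C_2$) with $z\neq0$ other than $P$ and $Q$, and its Zariski closure is $C_1$ (resp. $C_2$). 3. The third piece contributes no further component: $C_3=\{(0,0,0),P,Q\}=C_1\cap C_2$. Moreover, the point $\left(0,\tfrac{729}{50},\tfrac{729}{12800000}\right)$ lies on $C_1$ and is the point of a genus $2$ curve with automorphism group $D_4$. -/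

import Mathlib

open MvPolynomial

noncomputable section

namespace Genus2

/-! ### Genus 2 curves, their automorphism groups and their absolute invariants -/

/-- The affine equation `Y ^ 2 = f(X)` defines a curve of genus 2 (in characteristic `≠ 2`):
`f` is squarefree of degree 5 or 6. -/
def IsGenusTwo {k : Type*} [Field k] (f : Polynomial k) : Prop :=
  Squarefree f ∧ (f.natDegree = 5 ∨ f.natDegree = 6)

/-- The function field `k(X)[Y] / (Y ^ 2 - f(X))` of the curve `Y ^ 2 = f(X)`. -/
abbrev FunctionField {k : Type*} [Field k] (f : Polynomial k) : Type _ :=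
  AdjoinRoot ((Polynomial.X : Polynomial (RatFunc k)) ^ 2 -
    Polynomial.C (algebraMap (Polynomial k) (RatFunc k) f))

/-- The automorphism group (over `k`) of the smooth projective curve with affine equation
`Y ^ 2 = f(X)`, that is, the group of `k`-automorphisms of its function field. -/
abbrev CurveAut {k : Type*} [Field k] (f : Polynomial k) : Type _ :=
  FunctionField f ≃ₐ[k] FunctionField f

/-- The Igusa invariant `J₂` of the sextic `a₆ X⁶ + ⋯ + a₀`. -/
def sexticJ2 {R : Type*} [CommRing R] (a : ℕ → R) : R :=
  6 * a 3 ^ 2 - 16 * a 2 * a 4 + 40 * a 1 * a 5 - 240 * a 0 * a 6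

/-- The Igusa invariant `J₄` of the sextic `a₆ X⁶ + ⋯ + a₀`. If the sextic is
`c ∏ (X - rᵢ)`, this is `c ^ 4` times the sum, over the 10 partitions of the roots into two
triples, of `(12)²(23)²(31)²(45)²(56)²(64)²`, where `(ij) = rᵢ - rⱼ`. -/
def sexticJ4 {R : Type*} [CommRing R] (a : ℕ → R) : R :=
  4 * a 2 ^ 2 * a 4 ^ 2 - 12 * a 2 ^ 2 * a 3 * a 5 + 48 * a 2 ^ 3 * a 6
    - 12 * a 1 * a 3 * a 4 ^ 2 + 36 * a 1 * a 3 ^ 2 * a 5 + 4 * a 1 * a 2 * a 4 * a 5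
    - 180 * a 1 * a 2 * a 3 * a 6 - 80 * a 1 ^ 2 * a 5 ^ 2 + 300 * a 1 ^ 2 * a 4 * a 6
    + 48 * a 0 * a 4 ^ 3 - 180 * a 0 * a 3 * a 4 * a 5 + 324 * a 0 * a 3 ^ 2 * a 6
    + 300 * a 0 * a 2 * a 5 ^ 2 - 504 * a 0 * a 2 * a 4 * a 6 - 540 * a 0 * a 1 * a 5 * a 6
    + 1620 * a 0 ^ 2 * a 6 ^ 2

/-- The Igusa invariant `J₆` of the sextic `a₆ X⁶ + ⋯ + a₀`. If the sextic is
`c ∏ (X - rᵢ)`, this is `c ^ 6` times the sum, over the 60 ways of splitting the roots into two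
triples matched with each other, of `(12)²(23)²(31)²(45)²(56)²(64)²(14)²(25)²(36)²`. -/
def sexticJ6 {R : Type*} [CommRing R] (a : ℕ → R) : R :=
  8 * a 2 ^ 2 * a 3 ^ 2 * a 4 ^ 2 - 24 * a 2 ^ 2 * a 3 ^ 3 * a 5 - 24 * a 2 ^ 3 * a 4 ^ 3
    + 76 * a 2 ^ 3 * a 3 * a 4 * a 5 + 60 * a 2 ^ 3 * a 3 ^ 2 * a 6 - 36 * a 2 ^ 4 * a 5 ^ 2
    - 160 * a 2 ^ 4 * a 4 * a 6 - 24 * a 1 * a 3 ^ 3 * a 4 ^ 2 + 72 * a 1 * a 3 ^ 4 * a 5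
    + 76 * a 1 * a 2 * a 3 * a 4 ^ 3 - 238 * a 1 * a 2 * a 3 ^ 2 * a 4 * a 5
    - 198 * a 1 * a 2 * a 3 ^ 3 * a 6 + 28 * a 1 * a 2 ^ 2 * a 4 ^ 2 * a 5
    + 26 * a 1 * a 2 ^ 2 * a 3 * a 5 ^ 2 + 492 * a 1 * a 2 ^ 2 * a 3 * a 4 * a 6
    + 616 * a 1 * a 2 ^ 3 * a 5 * a 6 - 36 * a 1 ^ 2 * a 4 ^ 4
    + 26 * a 1 ^ 2 * a 3 * a 4 ^ 2 * a 5 + 176 * a 1 ^ 2 * a 3 ^ 2 * a 5 ^ 2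
    + 330 * a 1 ^ 2 * a 3 ^ 2 * a 4 * a 6 + 64 * a 1 ^ 2 * a 2 * a 4 * a 5 ^ 2
    - 640 * a 1 ^ 2 * a 2 * a 4 ^ 2 * a 6 - 1860 * a 1 ^ 2 * a 2 * a 3 * a 5 * a 6
    - 900 * a 1 ^ 2 * a 2 ^ 2 * a 6 ^ 2 - 320 * a 1 ^ 3 * a 5 ^ 3
    + 1600 * a 1 ^ 3 * a 4 * a 5 * a 6 + 2250 * a 1 ^ 3 * a 3 * a 6 ^ 2
    + 60 * a 0 * a 3 ^ 2 * a 4 ^ 3 - 198 * a 0 * a 3 ^ 3 * a 4 * a 5 + 162 * a 0 * a 3 ^ 4 * a 6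
    - 160 * a 0 * a 2 * a 4 ^ 4 + 492 * a 0 * a 2 * a 3 * a 4 ^ 2 * a 5
    + 330 * a 0 * a 2 * a 3 ^ 2 * a 5 ^ 2 - 468 * a 0 * a 2 * a 3 ^ 2 * a 4 * a 6
    - 640 * a 0 * a 2 ^ 2 * a 4 * a 5 ^ 2 + 424 * a 0 * a 2 ^ 2 * a 4 ^ 2 * a 6
    - 876 * a 0 * a 2 ^ 2 * a 3 * a 5 * a 6 - 96 * a 0 * a 2 ^ 3 * a 6 ^ 2
    + 616 * a 0 * a 1 * a 4 ^ 3 * a 5 - 1860 * a 0 * a 1 * a 3 * a 4 * a 5 ^ 2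
    - 876 * a 0 * a 1 * a 3 * a 4 ^ 2 * a 6 + 1818 * a 0 * a 1 * a 3 ^ 2 * a 5 * a 6
    + 1600 * a 0 * a 1 * a 2 * a 5 ^ 3 + 3472 * a 0 * a 1 * a 2 * a 4 * a 5 * a 6
    + 3060 * a 0 * a 1 * a 2 * a 3 * a 6 ^ 2 - 2240 * a 0 * a 1 ^ 2 * a 5 ^ 2 * a 6
    - 18600 * a 0 * a 1 ^ 2 * a 4 * a 6 ^ 2 - 900 * a 0 ^ 2 * a 4 ^ 2 * a 5 ^ 2
    - 96 * a 0 ^ 2 * a 4 ^ 3 * a 6 + 2250 * a 0 ^ 2 * a 3 * a 5 ^ 3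
    + 3060 * a 0 ^ 2 * a 3 * a 4 * a 5 * a 6 - 10044 * a 0 ^ 2 * a 3 ^ 2 * a 6 ^ 2
    - 18600 * a 0 ^ 2 * a 2 * a 5 ^ 2 * a 6 + 20664 * a 0 ^ 2 * a 2 * a 4 * a 6 ^ 2
    + 59940 * a 0 ^ 2 * a 1 * a 5 * a 6 ^ 2 - 119880 * a 0 ^ 3 * a 6 ^ 3

/-- `J₂` of the curve `Y ^ 2 = f(X)`. -/
def J2 {k : Type*} [Field k] (f : Polynomial k) : k := sexticJ2 f.coeff

/-- `J₄` of the curve `Y ^ 2 = f(X)`. -/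
def J4 {k : Type*} [Field k] (f : Polynomial k) : k := sexticJ4 f.coeff

/-- `J₆` of the curve `Y ^ 2 = f(X)`. -/
def J6 {k : Type*} [Field k] (f : Polynomial k) : k := sexticJ6 f.coeff

/-- `J₁₀` of the curve `Y ^ 2 = f(X)`: the discriminant of the binary sextic form
`Z⁶ f(X / Z)`. If `f` has degree 5, then `Z` divides this form, and the discriminant of the form
is the square of the leading coefficient of `f` times the discriminant of `f`. -/
def J10 {k : Type*} [Field k] (f : Polynomial k) : k :=
  if f.natDegree = 6 then f.discr else f.coeff 5 ^ 2 * f.discr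

/-- The absolute invariants `(i₁, i₂, i₃)` of the curve `Y ^ 2 = f(X)`; meaningful only if
`J₂ ≠ 0`. -/
def absInv {k : Type*} [Field k] (f : Polynomial k) : Fin 3 → k :=
  ![144 * J4 f / J2 f ^ 2,
    -1728 * (J2 f * J4 f - 3 * J6 f) / J2 f ^ 3,
    486 * J10 f / J2 f ^ 5]

/-- The points `(i₁, i₂, i₃)` of the genus 2 curves over `k` with `J₂ ≠ 0` whose automorphism
group is isomorphic to `G`. -/
def autLocus (k : Type*) [Field k] (G : Type*) [Group G] : Set (Fin 3 → k) :=
  {p | ∃ f : Polynomial k, IsGenusTwo f ∧ J2 f ≠ 0 ∧ Nonempty (CurveAut f ≃* G) ∧ absInv f = p}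

/-! ### The surface -/

/-- The left-hand side of the equation of the Shaska surface of level 2. -/
def shaska {R : Type*} [CommRing R] (x y z : R) : R :=
  -27 * x ^ 6 - 9459597312000 * z ^ 2 * x ^ 2 + 20639121408000 * z ^ 2 * y
    + 111451255603200 * z ^ 2 * x - 240734712102912 * z ^ 2
    - 55240704 * z * x ^ 4 - 18 * y ^ 2 * x ^ 4 - 8294400 * z * y ^ 2 * x ^ 2
    - 47278080 * z * y * x ^ 3 - 264180754022400000 * z ^ 3
    - 2866544640000 * z ^ 2 * y * x + 2 * x ^ 6 * y - 4 * x ^ 3 * y ^ 3 + 9 * x ^ 7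
    + 331776 * z * x ^ 5 + 107495424 * z * y * x ^ 2 - 27 * y ^ 4 + 9 * x * y ^ 4
    - 52254720 * z * y ^ 2 * x + 2 * y ^ 5 + 161243136 * z * y ^ 2 + 161243136 * z * x ^ 3
    - 12441600 * z * y ^ 3 + 54 * x ^ 3 * y ^ 2

/-- The polynomial `𝔖₂` in the coordinates `x = i₁`, `y = i₂`, `z = i₃`. -/
def S2 (k : Type*) [Field k] : MvPolynomial (Fin 3) k := shaska (X 0) (X 1) (X 2)

/-- The singular locus of the surface `𝔖₂ = 0`: the points of the surface at which all partial
derivatives of `𝔖₂` vanish. -/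
def singularLocus (k : Type*) [Field k] : Set (Fin 3 → k) :=
  {p | eval p (S2 k) = 0 ∧ ∀ i, eval p (pderiv i (S2 k)) = 0}

/-- The irreducible components of an algebraic set `V` in affine 3-space: the zero sets of the
minimal primes of its vanishing ideal. -/
def components {k : Type*} [Field k] (V : Set (Fin 3 → k)) : Set (Set (Fin 3 → k)) :=
  zeroLocus k '' (vanishingIdeal k V).minimalPrimes

/-- The Zariski closure of a subset of affine 3-space. -/
def zariskiClosure {k : Type*} [Field k] (V : Set (Fin 3 → k)) : Set (Fin 3 → k) :=
  zeroLocus k (vanishingIdeal k V)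

/-- The dimension of an algebraic set: the Krull dimension of its coordinate ring. -/
def algDim {k : Type*} [Field k] (V : Set (Fin 3 → k)) : WithBot ℕ∞ :=
  ringKrullDim (MvPolynomial (Fin 3) k ⧸ vanishingIdeal k V)

/-- The equation in `x, y` of the first curve. -/
def eqC1 {R : Type*} [CommRing R] (x y : R) : R :=
  100 * y ^ 2 - 1458 * y + 540 * x * y - 243 * x ^ 2 + 80 * x ^ 3

/-- The equation in `x, y` of the second curve. -/
def eqC2 {R : Type*} [CommRing R] (x y : R) : R :=
  3888 * x - 1188 * x ^ 2 + 5 * x ^ 3 + 432 * y - 360 * x * y - 25 * y ^ 2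

/-- The first equation in `x, y` of the third piece. -/
def eqC3a {R : Type*} [CommRing R] (x y : R) : R :=
  50 * x ^ 4 - 7515 * x ^ 3 - 825 * y * x ^ 2 + 20412 * x ^ 2 - 23490 * x * y - 4050 * y ^ 2
    + 52488 * y

/-- The second equation in `x, y` of the third piece. -/
def eqC3b {R : Type*} [CommRing R] (x y : R) : R :=
  125 * y ^ 2 - 1620 * y + 1125 * x * y - 5832 * x + 1890 * x ^ 2 + 25 * x ^ 3

/-- `C₁`: the points of the singular locus at which the first equation holds. -/
def C1 (k : Type*) [Field k] : Set (Fin 3 → k) :=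
  {p | p ∈ singularLocus k ∧ eqC1 (p 0) (p 1) = 0}

/-- `C₂`: the points of the singular locus at which the second equation holds. -/
def C2 (k : Type*) [Field k] : Set (Fin 3 → k) :=
  {p | p ∈ singularLocus k ∧ eqC2 (p 0) (p 1) = 0}

/-- `C₃`: the points of the singular locus at which the third system holds. -/
def C3 (k : Type*) [Field k] : Set (Fin 3 → k) :=
  {p | p ∈ singularLocus k ∧ eqC3a (p 0) (p 1) = 0 ∧ eqC3b (p 0) (p 1) = 0}

/-- The point of the curve `Y ^ 2 = X ^ 6 - 1`. -/
def pointP (k : Type*) [Field k] : Fin 3 → k := ![81 / 20, -729 / 200, 729 / 25600000]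

/-- The point of the curve `Y ^ 2 = X ^ 5 - X`. -/
def pointQ (k : Type*) [Field k] : Fin 3 → k := ![-36 / 5, 1512 / 25, 243 / 200000]

end Genus2

end

/-! Write S for the polynomial `shaska`. The proof has a geometric half and a modular half, which
meet in two explicit rational parametrizations.

Geometry. S is a cubic in z, so 3S - z S_z and the three partial derivatives are at most quadratic
in z. A common zero forces the 3 × 3 determinants of their coefficients to vanish, and two of these
determinants are `eqC1 * eqC2 ^ 2` times a small factor; hence the singular locus lies over the two
plane curves (`eqC1_or_eqC2`). Each plane curve is parametrized by polynomials in v. Over such a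
curve S becomes A (z - z₀)² (z - w), so exactly one z above each point is singular. Thus C₁ and C₂
are the images of `paramC1` and `paramC2`. Their vanishing ideals are kernels of maps to k[v], hence
prime, and the coordinate rings have dimension one because k[v] is integral over them. Intersections
reduce to factoring polynomials in v.

Moduli. An automorphism σ of the function field preserves k(X): otherwise the minimal polynomial of
σ(X) over k(X) would have, after clearing denominators, a discriminant e² f of degree at most 4,
while deg f ≥ 5 (`exists_apply_coordX_eq`). So σ acts on X by a Möbius transformation and on Y by Y
↦ e Y / (γX + δ)³, and it corresponds to a self-equivalence of the binary sextic (`exists_moebius`,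
`exists_moebius_coordY`). Conversely, such equivalences induce isomorphisms
(`exists_functionField_algEquiv`), and they preserve the absolute invariants; for J₁₀ this is seen
on the factorization into six linear forms.

In a D₄ curve an element of order 4 squares to the hyperelliptic involution, and diagonalizing it
gives the normal form X⁵ + sX³ + X. In a D₆ curve an element of order 3 gives X⁶ + bX³ + 1. With v =
1 / J₂ the invariants of these families are `paramC1 v` and `paramC2 v`.

It remains to find the parameters whose group is exactly D₄ or D₆. A quadratic covariant of the
sextic is a multiple of XZ, by s(9s² - 100) and 9b(b² + 50) respectively. When it is nonzero, every
automorphism preserves {0, ∞}, and the group can be listed. When it vanishes, an explicit extra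
automorphism has an order or a power impossible in the dihedral group. These exceptional values give
the points P and Q, and the degenerate values s² = 4, b² = 4 give z = 0. -/

noncomputable section

namespace Genus2

/-! ### The singular locus and its two parametrized curves -/

section Geometry

/-- The partial derivative of `shaska` with respect to `x`. -/
def shaskaX {R : Type*} [CommRing R] (x y z : R) : R :=
  -162 * x ^ 5 - 18919194624000 * z ^ 2 * x + 111451255603200 * z ^ 2
    - 220962816 * z * x ^ 3 - 72 * y ^ 2 * x ^ 3 - 16588800 * z * y ^ 2 * x
    - 141834240 * z * y * x ^ 2 - 2866544640000 * z ^ 2 * y + 12 * x ^ 5 * y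
    - 12 * x ^ 2 * y ^ 3 + 63 * x ^ 6 + 1658880 * z * x ^ 4 + 214990848 * z * y * x
    + 9 * y ^ 4 - 52254720 * z * y ^ 2 + 483729408 * z * x ^ 2 + 162 * x ^ 2 * y ^ 2

/-- The partial derivative of `shaska` with respect to `y`. -/
def shaskaY {R : Type*} [CommRing R] (x y z : R) : R :=
  20639121408000 * z ^ 2 - 36 * y * x ^ 4 - 16588800 * z * y * x ^ 2
    - 47278080 * z * x ^ 3 - 2866544640000 * z ^ 2 * x + 2 * x ^ 6
    - 12 * x ^ 3 * y ^ 2 + 107495424 * z * x ^ 2 - 108 * y ^ 3 + 36 * x * y ^ 3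
    - 104509440 * z * y * x + 10 * y ^ 4 + 322486272 * z * y - 37324800 * z * y ^ 2
    + 108 * x ^ 3 * y

/-- The partial derivative of `shaska` with respect to `z`. -/
def shaskaZ {R : Type*} [CommRing R] (x y z : R) : R :=
  -18919194624000 * z * x ^ 2 + 41278242816000 * z * y + 222902511206400 * z * x
    - 481469424205824 * z - 55240704 * x ^ 4 - 8294400 * y ^ 2 * x ^ 2
    - 47278080 * y * x ^ 3 - 792542262067200000 * z ^ 2 - 5733089280000 * z * y * x
    + 331776 * x ^ 5 + 107495424 * y * x ^ 2 - 52254720 * y ^ 2 * x + 161243136 * y ^ 2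
    + 161243136 * x ^ 3 - 12441600 * y ^ 3

variable {k : Type*} [Field k]

lemma eval_S2 (p : Fin 3 → k) : eval p (S2 k) = shaska (p 0) (p 1) (p 2) := by
  simp [S2, shaska]

lemma pderiv_ofNat (i : Fin 3) (n : ℕ) [n.AtLeastTwo] :
    pderiv i (ofNat(n) : MvPolynomial (Fin 3) k) = 0 :=
  (pderiv i).map_natCast n

lemma eval_pderiv_zero_S2 (p : Fin 3 → k) :
    eval p (pderiv 0 (S2 k)) = shaskaX (p 0) (p 1) (p 2) := by
  simp [S2, shaska, shaskaX, Derivation.leibniz, Derivation.leibniz_pow, pderiv_X, pderiv_ofNat]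
  ring

lemma eval_pderiv_one_S2 (p : Fin 3 → k) :
    eval p (pderiv 1 (S2 k)) = shaskaY (p 0) (p 1) (p 2) := by
  simp [S2, shaska, shaskaY, Derivation.leibniz, Derivation.leibniz_pow, pderiv_X, pderiv_ofNat]
  ring

lemma eval_pderiv_two_S2 (p : Fin 3 → k) :
    eval p (pderiv 2 (S2 k)) = shaskaZ (p 0) (p 1) (p 2) := by
  simp [S2, shaska, shaskaZ, Derivation.leibniz, Derivation.leibniz_pow, pderiv_X, pderiv_ofNat]
  ring


lemma mem_singularLocus {p : Fin 3 → k} : p ∈ singularLocus k ↔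
    shaska (p 0) (p 1) (p 2) = 0 ∧ shaskaX (p 0) (p 1) (p 2) = 0 ∧
      shaskaY (p 0) (p 1) (p 2) = 0 ∧ shaskaZ (p 0) (p 1) (p 2) = 0 := by
  simp [singularLocus, Fin.forall_fin_succ, eval_S2, eval_pderiv_zero_S2, eval_pderiv_one_S2,
    eval_pderiv_two_S2]

/-- The vector (z², z, 1) is a nonzero element of the kernel of the coefficient matrix. This
eliminates z from three quadratics without computing a resultant. -/
lemma det_eq_zero_of_common_root {R : Type*} [CommRing R] {z a₁ b₁ c₁ a₂ b₂ c₂ a₃ b₃ c₃ : R}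
    (h₁ : a₁ * z ^ 2 + b₁ * z + c₁ = 0) (h₂ : a₂ * z ^ 2 + b₂ * z + c₂ = 0)
    (h₃ : a₃ * z ^ 2 + b₃ * z + c₃ = 0) :
    a₁ * (b₂ * c₃ - b₃ * c₂) - b₁ * (a₂ * c₃ - a₃ * c₂) + c₁ * (a₂ * b₃ - a₃ * b₂) = 0 := by
  linear_combination (a₂ * b₃ - a₃ * b₂) * h₁ + (a₃ * b₁ - a₁ * b₃) * h₂
    + (a₁ * b₂ - a₂ * b₁) * h₃

/-- Elimination of z. Two determinants equal `eqC1 * eqC2 ^ 2` times x and times a combination of y,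
x², x. If neither curve equation holds, the first gives x = 0 and the second then gives y = 0; but
the origin lies on the first curve. -/
lemma eqC1_or_eqC2 [CharZero k] {x y z : k} (h : shaska x y z = 0) (hx : shaskaX x y z = 0)
    (hy : shaskaY x y z = 0) (hz : shaskaZ x y z = 0) : eqC1 x y = 0 ∨ eqC2 x y = 0 := by
  have hZ : (-792542262067200000) * z ^ 2 + (-18919194624000 * x ^ 2 - 5733089280000 * x ^ 1 * y
      ^ 1 + 222902511206400 * x ^ 1 + 41278242816000 * y ^ 1 - 481469424205824) * z + (331776 *
      x ^ 5 - 55240704 * x ^ 4 - 47278080 * x ^ 3 * y ^ 1 + 161243136 * x ^ 3 - 8294400 * x ^ 2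
      * y ^ 2 + 107495424 * x ^ 2 * y ^ 1 - 52254720 * x ^ 1 * y ^ 2 - 12441600 * y ^ 3 +
      161243136 * y ^ 2) = 0 := by
    linear_combination (norm := (unfold shaskaZ; ring)) hz
  -- The combination 3S - z S_z cancels the z³ term, so it is again quadratic in z.
  have hR : (-9459597312000 * x ^ 2 - 2866544640000 * x ^ 1 * y ^ 1 + 111451255603200 * x ^ 1 +
      20639121408000 * y ^ 1 - 240734712102912) * z ^ 2 + (663552 * x ^ 5 - 110481408 * x ^ 4 -
      94556160 * x ^ 3 * y ^ 1 + 322486272 * x ^ 3 - 16588800 * x ^ 2 * y ^ 2 + 214990848 * x ^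
      2 * y ^ 1 - 104509440 * x ^ 1 * y ^ 2 - 24883200 * y ^ 3 + 322486272 * y ^ 2) * z + (27 *
      x ^ 7 + 6 * x ^ 6 * y ^ 1 - 81 * x ^ 6 - 54 * x ^ 4 * y ^ 2 - 12 * x ^ 3 * y ^ 3 + 162 * x
      ^ 3 * y ^ 2 + 27 * x ^ 1 * y ^ 4 + 6 * y ^ 5 - 81 * y ^ 4) = 0 := by
    linear_combination (norm := (unfold shaska shaskaZ; ring)) 3 * h - z * hz
  have hX : (-18919194624000 * x ^ 1 - 2866544640000 * y ^ 1 + 111451255603200) * z ^ 2 +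
      (1658880 * x ^ 4 - 220962816 * x ^ 3 - 141834240 * x ^ 2 * y ^ 1 + 483729408 * x ^ 2 -
      16588800 * x ^ 1 * y ^ 2 + 214990848 * x ^ 1 * y ^ 1 - 52254720 * y ^ 2) * z + (63 * x ^ 6
      + 12 * x ^ 5 * y ^ 1 - 162 * x ^ 5 - 72 * x ^ 3 * y ^ 2 - 12 * x ^ 2 * y ^ 3 + 162 * x ^ 2
      * y ^ 2 + 9 * y ^ 4) = 0 := by
    linear_combination (norm := (unfold shaskaX; ring)) hx
  have hY : (-2866544640000 * x ^ 1 + 20639121408000) * z ^ 2 + (-47278080 * x ^ 3 - 16588800 *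
      x ^ 2 * y ^ 1 + 107495424 * x ^ 2 - 104509440 * x ^ 1 * y ^ 1 - 37324800 * y ^ 2 +
      322486272 * y ^ 1) * z + (2 * x ^ 6 - 36 * x ^ 4 * y ^ 1 - 12 * x ^ 3 * y ^ 2 + 108 * x ^
      3 * y ^ 1 + 36 * x ^ 1 * y ^ 3 + 10 * y ^ 4 - 108 * y ^ 3) = 0 := by
    linear_combination (norm := (unfold shaskaY; ring)) hy
  by_contra! hne
  have hx0 : x = 0 := by
    have h1 : 525893003079214694400 * eqC1 x y * eqC2 x y ^ 2 * x = 0 := by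
      linear_combination (norm := (unfold eqC1 eqC2; ring))
        -det_eq_zero_of_common_root hZ hX hY
    simpa [hne.1, hne.2] using h1
  have hy0 : y = 0 := by
    have h1 : eqC1 x y * eqC2 x y ^ 2 * (315535801847528816640 * y
        - 210357201231685877760 * x ^ 2 + 1135928886651103739904 * x) = 0 := by
      linear_combination (norm := (unfold eqC1 eqC2; ring)) det_eq_zero_of_common_root hZ hR hY
    simpa [hx0] using (mul_eq_zero.1 h1).resolve_left (mul_ne_zero hne.1 (pow_ne_zero 2 hne.2))
  exact hne.1 (by simp [eqC1, hx0, hy0])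
  
/-- The parametrization of the curve `C₁`. -/
def paramC1 {R : Type*} [CommRing R] (v : R) : Fin 3 → R :=
  ![-46080 * v ^ 2 + 864 * v, 8847360 * v ^ 3 - 124416 * v ^ 2, 216 * v ^ 3 * (1 - 64 * v) ^ 2]

/-- The parametrization of the curve `C₂`. -/
def paramC2 {k : Type*} [Field k] (v : k) : Fin 3 → k :=
  ![2099520 * v ^ 2 + 7776 * v, -1360488960 * v ^ 3 - 22674816 * v ^ 2 - 69984 * v,
    6561 / 4 * v ^ 2 * (1 + 216 * v) ^ 3]

lemma singularLocus_eq [CharZero k] : singularLocus k = C1 k ∪ C2 k := by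
  ext p
  refine ⟨fun hp => ?_, fun hp => hp.elim And.left And.left⟩
  obtain ⟨h, hx, hy, hz⟩ := mem_singularLocus.1 hp
  exact (eqC1_or_eqC2 h hx hy hz).imp (⟨hp, ·⟩) (⟨hp, ·⟩)

lemma paramC1_mem (v : k) : paramC1 v ∈ C1 k := by
  refine ⟨mem_singularLocus.2 ⟨?_, ?_, ?_, ?_⟩, ?_⟩ <;>
    simp only [paramC1, shaska, shaskaX, shaskaY, shaskaZ, eqC1, Matrix.cons_val] <;> ring

lemma paramC2_mem [CharZero k] (v : k) : paramC2 v ∈ C2 k := by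
  refine ⟨mem_singularLocus.2 ⟨?_, ?_, ?_, ?_⟩, ?_⟩ <;>
    simp only [paramC2, shaska, shaskaX, shaskaY, shaskaZ, eqC2, Matrix.cons_val] <;> ring

lemma exists_eq_quadratic [IsAlgClosed k] [CharZero k] {a : k} (ha : a ≠ 0) (b c : k) :
    ∃ v, c = a * v ^ 2 + b * v := by
  obtain ⟨d, hd⟩ := IsAlgClosed.exists_pow_nat_eq (b ^ 2 + 4 * a * c) two_pos
  refine ⟨(d - b) / (2 * a), ?_⟩
  field_simp
  linear_combination -hd

/-- The second hypothesis is the derivative of the cubic A (z - z₀)² (z - w). A common zero of the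
cubic and its derivative is a multiple root, hence z₀, also when w = z₀. -/
lemma eq_of_double_root {A z z₀ w : k} (hA : A ≠ 0) (h : A * (z - z₀) ^ 2 * (z - w) = 0)
    (h' : A * (z - z₀) * (3 * z - z₀ - 2 * w) = 0) : z = z₀ := by
  by_contra hne
  have hz : z - z₀ ≠ 0 := sub_ne_zero.2 hne
  have hw : z - w = 0 := by simpa [hA, hz] using h
  have h2 : 3 * z - z₀ - 2 * w = 0 := by simpa [hA, hz] using h'
  exact hz (by linear_combination h2 - 2 * hw)

/-- For given x the equation x = x(v) has the two roots v and 3/160 - v, and `eqC1` is a quadratic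
in y with leading coefficient 100 whose roots are the values of the second coordinate at these two
parameters. -/
lemma exists_paramC1 [IsAlgClosed k] [CharZero k] {x y : k} (h : eqC1 x y = 0) :
    ∃ v : k, x = paramC1 v 0 ∧ y = paramC1 v 1 := by
  obtain ⟨v, hv⟩ := exists_eq_quadratic (show (-46080 : k) ≠ 0 by norm_num) 864 x
  have h2 : 100 * (y - paramC1 v 1) * (y - paramC1 (3 / 160 - v) 1) = 0 := by
    rw [← h, hv]
    simp only [paramC1, eqC1, Matrix.cons_val]
    ring
  rcases mul_eq_zero.1 h2 with h3 | h3
  · exact ⟨v, hv, sub_eq_zero.1 ((mul_eq_zero.1 h3).resolve_left (by norm_num))⟩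
  · refine ⟨3 / 160 - v, ?_, sub_eq_zero.1 h3⟩
    rw [hv]
    simp only [paramC1, Matrix.cons_val]
    ring

/-- As for the first curve; the two parameters over a given x are now v and -1/270 - v. -/
lemma exists_paramC2 [IsAlgClosed k] [CharZero k] {x y : k} (h : eqC2 x y = 0) :
    ∃ v : k, x = paramC2 v 0 ∧ y = paramC2 v 1 := by
  obtain ⟨v, hv⟩ := exists_eq_quadratic (show (2099520 : k) ≠ 0 by norm_num) 7776 x
  have h2 : -25 * (y - paramC2 v 1) * (y - paramC2 (-1 / 270 - v) 1) = 0 := by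
    rw [← h, hv]
    simp only [paramC2, eqC2, Matrix.cons_val]
    ring
  rcases mul_eq_zero.1 h2 with h3 | h3
  · exact ⟨v, hv, sub_eq_zero.1 ((mul_eq_zero.1 h3).resolve_left (by norm_num))⟩
  · refine ⟨-1 / 270 - v, ?_, sub_eq_zero.1 h3⟩
    rw [hv]
    simp only [paramC2, Matrix.cons_val]
    ring

/-- Over the plane curve the cubic z ↦ S has the parametrized coordinate as a double root; w is the
remaining root and A the coefficient of z³. -/
lemma paramC1_two_unique [CharZero k] {v z : k}
    (h : shaska (paramC1 v 0) (paramC1 v 1) z = 0)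
    (hz : shaskaZ (paramC1 v 0) (paramC1 v 1) z = 0) : z = paramC1 v 2 := by
  refine eq_of_double_root (A := -264180754022400000)
    (w := 2654208 * v ^ 5 - 165888 * v ^ 4 + 21384 / 5 * v ^ 3 - 5589 / 100 * v ^ 2
      + 729 / 2000 * v - 729 / 800000) (by norm_num) ?_ ?_
  · rw [← h]
    simp only [paramC1, shaska, Matrix.cons_val]
    ring
  · rw [← hz]
    simp only [paramC1, shaskaZ, Matrix.cons_val]
    ring

lemma paramC2_two_unique [CharZero k] {v z : k}
    (h : shaska (paramC2 v 0) (paramC2 v 1) z = 0)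
    (hz : shaskaZ (paramC2 v 0) (paramC2 v 1) z = 0) : z = paramC2 v 2 := by
  refine eq_of_double_root (A := -264180754022400000)
    (w := -2066242608 * v ^ 5 + 14348907 * v ^ 4 + 531441 / 5 * v ^ 3 - 85293 / 200 * v ^ 2
      - 2187 / 1000 * v - 729 / 800000) (by norm_num) ?_ ?_
  · rw [← h]
    simp only [paramC2, shaska, Matrix.cons_val]
    ring
  · rw [← hz]
    simp only [paramC2, shaskaZ, Matrix.cons_val]
    ring

lemma C1_eq_range [IsAlgClosed k] [CharZero k] : C1 k = Set.range paramC1 := by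
  ext p
  refine ⟨fun ⟨hp, he⟩ => ?_, ?_⟩
  · obtain ⟨h, -, -, hz⟩ := mem_singularLocus.1 hp
    obtain ⟨v, h0, h1⟩ := exists_paramC1 he
    rw [h0, h1] at h hz
    have h2 := paramC1_two_unique h hz
    refine ⟨v, funext fun i => ?_⟩
    fin_cases i
    exacts [h0.symm, h1.symm, h2.symm]
  · rintro ⟨v, rfl⟩
    exact paramC1_mem v

lemma C2_eq_range [IsAlgClosed k] [CharZero k] : C2 k = Set.range paramC2 := by
  ext p
  refine ⟨fun ⟨hp, he⟩ => ?_, ?_⟩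
  · obtain ⟨h, -, -, hz⟩ := mem_singularLocus.1 hp
    obtain ⟨v, h0, h1⟩ := exists_paramC2 he
    rw [h0, h1] at h hz
    have h2 := paramC2_two_unique h hz
    refine ⟨v, funext fun i => ?_⟩
    fin_cases i
    exacts [h0.symm, h1.symm, h2.symm]
  · rintro ⟨v, rfl⟩
    exact paramC2_mem v

lemma bijOn_C1 [IsAlgClosed k] [CharZero k] :
    Set.BijOn (fun p : Fin 3 → k => (p 0, p 1)) (C1 k) {q : k × k | eqC1 q.1 q.2 = 0} := by
  refine ⟨fun p hp => hp.2, fun p hp q hq hpq => ?_, fun q hq => ?_⟩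
  · obtain ⟨v, rfl⟩ := (C1_eq_range (k := k)).subset hp
    have h0 : paramC1 v 0 = q 0 := congrArg Prod.fst hpq
    have h1 : paramC1 v 1 = q 1 := congrArg Prod.snd hpq
    obtain ⟨h, -, -, hz⟩ := mem_singularLocus.1 hq.1
    have h2 := paramC1_two_unique (v := v) (z := q 2) (by rw [h0, h1]; exact h)
      (by rw [h0, h1]; exact hz)
    funext i
    fin_cases i
    exacts [h0, h1, h2.symm]
  · obtain ⟨v, h0, h1⟩ := exists_paramC1 hq
    exact ⟨paramC1 v, paramC1_mem v, Prod.ext h0.symm h1.symm⟩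

lemma bijOn_C2 [IsAlgClosed k] [CharZero k] :
    Set.BijOn (fun p : Fin 3 → k => (p 0, p 1)) (C2 k) {q : k × k | eqC2 q.1 q.2 = 0} := by
  refine ⟨fun p hp => hp.2, fun p hp q hq hpq => ?_, fun q hq => ?_⟩
  · obtain ⟨v, rfl⟩ := (C2_eq_range (k := k)).subset hp
    have h0 : paramC2 v 0 = q 0 := congrArg Prod.fst hpq
    have h1 : paramC2 v 1 = q 1 := congrArg Prod.snd hpq
    obtain ⟨h, -, -, hz⟩ := mem_singularLocus.1 hq.1
    have h2 := paramC2_two_unique (v := v) (z := q 2) (by rw [h0, h1]; exact h)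
      (by rw [h0, h1]; exact hz)
    funext i
    fin_cases i
    exacts [h0, h1, h2.symm]
  · obtain ⟨v, h0, h1⟩ := exists_paramC2 hq
    exact ⟨paramC2 v, paramC2_mem v, Prod.ext h0.symm h1.symm⟩

lemma paramC1_zero : paramC1 (0 : k) = ![0, 0, 0] := by simp [paramC1]

lemma paramC2_zero : paramC2 (0 : k) = ![0, 0, 0] := by simp [paramC2]

lemma paramC1_eq_pointP [CharZero k] : paramC1 (3 / 320 : k) = pointP k := by
  funext i
  fin_cases i <;> simp [paramC1, pointP] <;> norm_num

lemma paramC1_eq_pointQ [CharZero k] : paramC1 (1 / 40 : k) = pointQ k := by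
  funext i
  fin_cases i <;> simp [paramC1, pointQ] <;> norm_num

lemma paramC2_eq_pointP [CharZero k] : paramC2 (-1 / 240 : k) = pointP k := by
  funext i
  fin_cases i <;> simp [paramC2, pointP] <;> norm_num

lemma paramC2_eq_pointQ [CharZero k] : paramC2 (-1 / 540 : k) = pointQ k := by
  funext i
  fin_cases i <;> simp [paramC2, pointQ] <;> norm_num

lemma specialPoints_subset [IsAlgClosed k] [CharZero k] :
    {![0, 0, 0], pointP k, pointQ k} ⊆ C1 k ∩ C2 k := by
  rintro p (rfl | rfl | rfl)
  · exact ⟨paramC1_zero (k := k) ▸ paramC1_mem 0, paramC2_zero (k := k) ▸ paramC2_mem 0⟩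
  · exact ⟨paramC1_eq_pointP (k := k) ▸ paramC1_mem _, paramC2_eq_pointP (k := k) ▸ paramC2_mem _⟩
  · exact ⟨paramC1_eq_pointQ (k := k) ▸ paramC1_mem _, paramC2_eq_pointQ (k := k) ▸ paramC2_mem _⟩

/-- Pulling `eqC2` back along `paramC1` gives a constant times v (v - 3/320)² (v - 1/40)³. The three
roots are the parameters of the origin, P and Q. -/
lemma C1_inter_C2 [IsAlgClosed k] [CharZero k] :
    C1 k ∩ C2 k = {![0, 0, 0], pointP k, pointQ k} := by
  refine subset_antisymm ?_ specialPoints_subset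
  rintro p ⟨hp, hp2⟩
  obtain ⟨v, rfl⟩ := (C1_eq_range (k := k)).subset hp
  have h : v * (v - 3 / 320) ^ 2 * (v - 1 / 40) ^ 3 = 0 := by
    have h2 := hp2.2
    simp only [paramC1, eqC2, Matrix.cons_val] at h2
    linear_combination (-1 / 2446118092800000) * h2
  simp only [mul_eq_zero, pow_eq_zero_iff, ne_eq, OfNat.ofNat_ne_zero, not_false_eq_true,
    sub_eq_zero] at h
  rcases h with (rfl | rfl) | rfl
  exacts [.inl paramC1_zero, .inr (.inl paramC1_eq_pointP), .inr (.inr paramC1_eq_pointQ)]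

/-- Since the singular locus is C₁ ∪ C₂, it suffices to pull the two equations back along each
parametrization. The second one has a fourth root on each curve, 1/80 and -1/180. -/
lemma C3_eq [IsAlgClosed k] [CharZero k] : C3 k = {![0, 0, 0], pointP k, pointQ k} := by
  refine subset_antisymm ?_ ?_
  · rintro p ⟨hp, ha, hb⟩
    rw [singularLocus_eq, C1_eq_range, C2_eq_range] at hp
    rcases hp with ⟨v, rfl⟩ | ⟨v, rfl⟩
    · simp only [paramC1, eqC3a, eqC3b, Matrix.cons_val] at ha hb
      have h : v * (v - 3 / 320) ^ 2 * (v - 1 / 40) ^ 2 * (v - 1 / 80) = 0 := by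
        linear_combination (1 / 7338354278400000) * hb
      simp only [mul_eq_zero, pow_eq_zero_iff, ne_eq, OfNat.ofNat_ne_zero, not_false_eq_true,
        sub_eq_zero] at h
      rcases h with ((rfl | rfl) | rfl) | rfl
      · exact .inl paramC1_zero
      · exact .inr (.inl paramC1_eq_pointP)
      · exact .inr (.inr paramC1_eq_pointQ)
      -- The root v = 1/80 is spurious: the first equation fails there.
      · norm_num at ha
    · simp only [paramC2, eqC3a, eqC3b, Matrix.cons_val] at ha hb
      have h : v * (v + 1 / 240) * (v + 1 / 540) ^ 3 * (v + 1 / 180) = 0 := by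
        linear_combination (1 / 462732552570470400000) * hb
      simp only [mul_eq_zero, pow_eq_zero_iff, ne_eq, OfNat.ofNat_ne_zero, not_false_eq_true,
        add_eq_zero_iff_eq_neg] at h
      rcases h with ((rfl | h) | h) | rfl
      · exact .inl paramC2_zero
      · rw [show v = -1 / 240 by rw [h]; ring]
        exact .inr (.inl paramC2_eq_pointP)
      · rw [show v = -1 / 540 by rw [h]; ring]
        exact .inr (.inr paramC2_eq_pointQ)
      -- Likewise for v = -1/180.
      · norm_num at ha
  · rintro p (rfl | rfl | rfl)
    · exact ⟨(specialPoints_subset (.inl rfl)).1.1, by simp [eqC3a], by simp [eqC3b]⟩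
    · refine ⟨(specialPoints_subset (.inr (.inl rfl))).1.1, ?_, ?_⟩ <;>
        simp only [pointP, eqC3a, eqC3b, Matrix.cons_val] <;> norm_num
    · refine ⟨(specialPoints_subset (.inr (.inr rfl))).1.1, ?_, ?_⟩ <;>
        simp only [pointQ, eqC3a, eqC3b, Matrix.cons_val] <;> norm_num

end Geometry

/-! ### Vanishing ideals, components and dimension of parametrized curves -/

section Zariski

variable {k : Type*} [Field k]

/-- The point with parameter `v` of a polynomial curve in affine 3-space. -/
def curvePoint (γ : Fin 3 → Polynomial k) (v : k) : Fin 3 → k := fun i => (γ i).eval v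

lemma aeval_curvePoint (γ : Fin 3 → Polynomial k) (v : k) (p : MvPolynomial (Fin 3) k) :
    aeval (curvePoint γ v) p = (aeval γ p).eval v := by
  have h : aeval (curvePoint γ v) = (Polynomial.aeval v).comp (aeval γ) := by
    ext i
    simp [curvePoint]
  rw [h, AlgHom.comp_apply, Polynomial.coe_aeval_eq_eval]

/-- The pullback to k[t] of a polynomial vanishing on the image has infinitely many roots, so it is
zero. The ideal is therefore prime and does not depend on T: removing finitely many parameters does
not change the Zariski closure. -/
lemma vanishingIdeal_image_curvePoint (γ : Fin 3 → Polynomial k) {T : Set k} (hT : T.Infinite) :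
    vanishingIdeal k (curvePoint γ '' T) = RingHom.ker (aeval (R := k) γ) := by
  ext p
  simp only [mem_vanishingIdeal_iff, Set.forall_mem_image, RingHom.mem_ker, aeval_curvePoint]
  refine ⟨fun h => Polynomial.eq_zero_of_infinite_isRoot _ (hT.mono fun v hv => h hv),
    fun h v _ => by simp [h]⟩

lemma zeroLocus_vanishingIdeal_of_eq {V : Set (Fin 3 → k)} (F : Set (MvPolynomial (Fin 3) k))
    (hV : V = {p | ∀ f ∈ F, eval p f = 0}) : zeroLocus k (vanishingIdeal k V) = V := by
  refine subset_antisymm (fun p hp => ?_) (zeroLocus_vanishingIdeal_le V)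
  rw [hV]
  intro f hf
  exact hp f fun x hx => (hV ▸ hx : x ∈ {p | ∀ f ∈ F, eval p f = 0}) f hf

/-- A nonzero prime of A is the contraction of a nonzero prime of B, which is maximal because B is a
principal ideal domain; contraction along an integral extension keeps it maximal. A is not a field
because B is not. -/
lemma ringKrullDim_eq_one_of_isIntegral {A B : Type*} [CommRing A] [IsDomain A] [CommRing B]
    [IsDomain B] [IsPrincipalIdealRing B] [Algebra A B] [Algebra.IsIntegral A B]
    (hinj : Function.Injective (algebraMap A B)) (hB : ¬ IsField B) : ringKrullDim A = 1 := by
  have hA : ¬ IsField A := fun h => hB (isField_of_isIntegral_of_isField' h)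
  refine eq_of_le_of_not_lt ?_ fun h' ↦ hA ?_
  · rw [← Nat.cast_one, ← Ring.krullDimLE_iff, Ring.krullDimLE_one_iff_of_noZeroDivisors]
    intro P hP0 hP
    obtain ⟨Q, hQ, rfl⟩ := Ideal.exists_ideal_over_prime_of_isIntegral_of_isDomain (S := B) P
      (by rw [(RingHom.injective_iff_ker_eq_bot _).1 hinj]; exact bot_le)
    have hQ0 : Q ≠ ⊥ := by
      rintro rfl
      exact hP0 (by rw [← RingHom.ker_eq_comap_bot, (RingHom.injective_iff_ker_eq_bot _).1 hinj])
    have := IsPrime.to_maximal_ideal hQ0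
    exact Ideal.isMaximal_comap_of_isIntegral_of_isMaximal Q
  · have h'' : ringKrullDim A ≤ 0 := Order.le_of_lt_succ h'
    rw [← Nat.cast_zero, ← Ring.krullDimLE_iff] at h''
    exact Ring.KrullDimLE.isField_of_isDomain

/-- The coordinate ring embeds in k[t], and k[t] is integral over it as soon as one coordinate is a
nonconstant polynomial. -/
lemma ringKrullDim_quotient_ker_aeval (γ : Fin 3 → Polynomial k) {i : Fin 3}
    (hi : 0 < (γ i).natDegree) :
    ringKrullDim (MvPolynomial (Fin 3) k ⧸ RingHom.ker (aeval (R := k) γ)) = 1 := by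
  have : (RingHom.ker (aeval (R := k) γ)).IsPrime := RingHom.ker_isPrime _
  let φ := Ideal.kerLiftAlg (aeval (R := k) γ)
  let _ : Algebra (MvPolynomial (Fin 3) k ⧸ RingHom.ker (aeval (R := k) γ)) (Polynomial k) :=
    φ.toRingHom.toAlgebra
  have hX : φ.toRingHom.IsIntegralElem Polynomial.X := by
    set c := (γ i).leadingCoeff
    have hc : c ≠ 0 := Polynomial.leadingCoeff_ne_zero.2 (by rintro h; simp [h] at hi)
    let ψ : k →+* _ := algebraMap k (MvPolynomial (Fin 3) k ⧸ RingHom.ker (aeval (R := k) γ))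
    -- The equation γᵢ(T) - xᵢ = 0, divided by the leading coefficient of γᵢ, is monic with root t.
    refine ⟨(Polynomial.C c⁻¹ * γ i).map ψ -
      Polynomial.C (ψ c⁻¹ * Ideal.Quotient.mk _ (X i)), ?_, ?_⟩
    · refine Polynomial.Monic.sub_of_left ?_ ?_
      · refine Polynomial.Monic.map _ ?_
        rw [Polynomial.Monic, Polynomial.leadingCoeff_mul, Polynomial.leadingCoeff_C]
        exact inv_mul_cancel₀ hc
      · refine Polynomial.degree_C_le.trans_lt ?_
        rw [Polynomial.degree_map_eq_of_injective ψ.injective,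
          Polynomial.degree_C_mul (inv_ne_zero hc)]
        exact Polynomial.natDegree_pos_iff_degree_pos.1 hi
    · have h1 : φ.toRingHom.comp ψ = Polynomial.C := by
        ext a
        exact congrArg (Polynomial.coeff · _) (φ.commutes a)
      have h2 : φ.toRingHom (Ideal.Quotient.mk _ (X i)) = γ i := by
        change aeval (R := k) γ (X i) = _
        simp
      rw [Polynomial.eval₂_sub, Polynomial.eval₂_map, Polynomial.eval₂_C, h1, map_mul, h2,
        ← RingHom.comp_apply, h1, Polynomial.eval₂_mul, Polynomial.eval₂_C,
        Polynomial.eval₂_C_X, sub_self]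
  have hint : Algebra.IsIntegral (MvPolynomial (Fin 3) k ⧸ RingHom.ker (aeval (R := k) γ))
      (Polynomial k) := by
    refine ⟨fun p => ?_⟩
    have h : ∀ a : k, IsIntegral (MvPolynomial (Fin 3) k ⧸ RingHom.ker (aeval (R := k) γ))
        (Polynomial.C a) := fun a => by
      have := isIntegral_algebraMap (R := MvPolynomial (Fin 3) k ⧸ RingHom.ker (aeval (R := k) γ))
        (A := Polynomial k) (x := algebraMap k _ a)
      rwa [show algebraMap _ (Polynomial k) (algebraMap k _ a) = Polynomial.C a
        from φ.commutes a] at this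
    induction p using Polynomial.induction_on' with
    | add p q hp hq => exact hp.add hq
    | monomial n a =>
      rw [← Polynomial.C_mul_X_pow_eq_monomial]
      exact (h a).mul (IsIntegral.pow hX n)
  exact ringKrullDim_eq_one_of_isIntegral (B := Polynomial k)
    (RingHom.kerLift_injective (aeval (R := k) γ).toRingHom) (Polynomial.not_isField k)

lemma components_union {V W : Set (Fin 3 → k)} (hV : (vanishingIdeal k V).IsPrime)
    (hW : (vanishingIdeal k W).IsPrime) (hV' : zeroLocus k (vanishingIdeal k V) = V)
    (hW' : zeroLocus k (vanishingIdeal k W) = W) (hVW : ¬ V ⊆ W) (hWV : ¬ W ⊆ V) :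
    components (V ∪ W) = {V, W} := by
  have hinf : vanishingIdeal k (V ∪ W) = vanishingIdeal k V ⊓ vanishingIdeal k W := by
    ext p
    simp [or_imp, forall_and]
  have hnVW : ¬ vanishingIdeal k V ≤ vanishingIdeal k W := fun h =>
    hWV (by rw [← hV', ← hW']; exact zeroLocus_anti_mono h)
  have hnWV : ¬ vanishingIdeal k W ≤ vanishingIdeal k V := fun h =>
    hVW (by rw [← hV', ← hW']; exact zeroLocus_anti_mono h)
  have hmin : (vanishingIdeal k (V ∪ W)).minimalPrimes =
      {vanishingIdeal k V, vanishingIdeal k W} := by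
    rw [hinf]
    ext P
    constructor
    · rintro ⟨⟨hP, hle⟩, hmin⟩
      rcases hP.inf_le.1 hle with h | h
      · exact .inl (le_antisymm (hmin ⟨hV, inf_le_left⟩ h) h)
      · exact .inr (le_antisymm (hmin ⟨hW, inf_le_right⟩ h) h)
    · rintro (rfl | rfl)
      · refine ⟨⟨hV, inf_le_left⟩, fun Q ⟨hQ, hle⟩ hQV => ?_⟩
        exact (hQ.inf_le.1 hle).elim id fun h => absurd (h.trans hQV) hnWV
      · refine ⟨⟨hW, inf_le_right⟩, fun Q ⟨hQ, hle⟩ hQW => ?_⟩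
        exact (hQ.inf_le.1 hle).elim (fun h => absurd (h.trans hQW) hnVW) id
  rw [components, hmin, Set.image_pair, hV', hW']

/-- The polynomials parametrizing `C₁`. -/
def curveC1 (k : Type*) [Field k] : Fin 3 → Polynomial k := paramC1 Polynomial.X

/-- The polynomials parametrizing `C₂`. -/
def curveC2 (k : Type*) [Field k] : Fin 3 → Polynomial k :=
  ![2099520 * Polynomial.X ^ 2 + 7776 * Polynomial.X,
    -1360488960 * Polynomial.X ^ 3 - 22674816 * Polynomial.X ^ 2 - 69984 * Polynomial.X,
    Polynomial.C (6561 / 4) * Polynomial.X ^ 2 * (1 + 216 * Polynomial.X) ^ 3]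

lemma curvePoint_curveC1 (v : k) : curvePoint (curveC1 k) v = paramC1 v := by
  funext i
  fin_cases i <;> simp [curvePoint, curveC1, paramC1]

lemma curvePoint_curveC2 (v : k) : curvePoint (curveC2 k) v = paramC2 v := by
  funext i
  fin_cases i <;> simp [curvePoint, curveC2, paramC2]

lemma natDegree_curveC1_pos [CharZero k] : 0 < (curveC1 k 0).natDegree := by
  have : curveC1 k 0 = Polynomial.C (-46080) * Polynomial.X ^ 2 + Polynomial.C 864 * Polynomial.X
      + Polynomial.C 0 := by simp [curveC1, paramC1, map_ofNat (Polynomial.C (R := k))]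
  rw [this, Polynomial.natDegree_quadratic (by norm_num)]
  exact two_pos

lemma natDegree_curveC2_pos [CharZero k] : 0 < (curveC2 k 0).natDegree := by
  have : curveC2 k 0 = Polynomial.C 2099520 * Polynomial.X ^ 2 + Polynomial.C 7776 * Polynomial.X
      + Polynomial.C 0 := by simp [curveC2, map_ofNat (Polynomial.C (R := k))]
  rw [this, Polynomial.natDegree_quadratic (by norm_num)]
  exact two_pos

lemma zeroLocus_vanishingIdeal_C1 : zeroLocus k (vanishingIdeal k (C1 k)) = C1 k := by
  refine zeroLocus_vanishingIdeal_of_eq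
    (insert (S2 k) (insert (eqC1 (X 0) (X 1)) (Set.range fun i => pderiv i (S2 k)))) ?_
  ext p
  simp [C1, singularLocus, eqC1]
  tauto

lemma zeroLocus_vanishingIdeal_C2 : zeroLocus k (vanishingIdeal k (C2 k)) = C2 k := by
  refine zeroLocus_vanishingIdeal_of_eq
    (insert (S2 k) (insert (eqC2 (X 0) (X 1)) (Set.range fun i => pderiv i (S2 k)))) ?_
  ext p
  simp [C2, singularLocus, eqC2]
  tauto

lemma vanishingIdeal_image_paramC1 {T : Set k} (hT : T.Infinite) :
    vanishingIdeal k (paramC1 '' T) = RingHom.ker (aeval (R := k) (curveC1 k)) := by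
  rw [← vanishingIdeal_image_curvePoint _ hT]
  congr! 2 with v
  exact (curvePoint_curveC1 v).symm

lemma vanishingIdeal_image_paramC2 {T : Set k} (hT : T.Infinite) :
    vanishingIdeal k (paramC2 '' T) = RingHom.ker (aeval (R := k) (curveC2 k)) := by
  rw [← vanishingIdeal_image_curvePoint _ hT]
  congr! 2 with v
  exact (curvePoint_curveC2 v).symm

variable [CharZero k]

lemma not_C1_subset_C2 : ¬ C1 k ⊆ C2 k := fun h => by
  have := (h (paramC1_mem (1 : k))).2
  norm_num [paramC1, eqC2] at this

lemma not_C2_subset_C1 : ¬ C2 k ⊆ C1 k := fun h => by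
  have := (h (paramC2_mem (1 : k))).2
  norm_num [paramC2, eqC1] at this

variable [IsAlgClosed k]

lemma vanishingIdeal_C1 : vanishingIdeal k (C1 k) = RingHom.ker (aeval (R := k) (curveC1 k)) := by
  rw [C1_eq_range, ← Set.image_univ, vanishingIdeal_image_paramC1 Set.infinite_univ]

lemma vanishingIdeal_C2 : vanishingIdeal k (C2 k) = RingHom.ker (aeval (R := k) (curveC2 k)) := by
  rw [C2_eq_range, ← Set.image_univ, vanishingIdeal_image_paramC2 Set.infinite_univ]

lemma zariskiClosure_image_paramC1 {T : Set k} (hT : T.Infinite) :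
    zariskiClosure (paramC1 '' T) = C1 k := by
  rw [zariskiClosure, vanishingIdeal_image_paramC1 hT, ← vanishingIdeal_C1,
    zeroLocus_vanishingIdeal_C1]

lemma zariskiClosure_image_paramC2 {T : Set k} (hT : T.Infinite) :
    zariskiClosure (paramC2 '' T) = C2 k := by
  rw [zariskiClosure, vanishingIdeal_image_paramC2 hT, ← vanishingIdeal_C2,
    zeroLocus_vanishingIdeal_C2]

lemma algDim_C1 : algDim (C1 k) = 1 := by
  rw [algDim, vanishingIdeal_C1]
  exact ringKrullDim_quotient_ker_aeval _ natDegree_curveC1_pos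

lemma algDim_C2 : algDim (C2 k) = 1 := by
  rw [algDim, vanishingIdeal_C2]
  exact ringKrullDim_quotient_ker_aeval _ natDegree_curveC2_pos

lemma components_singularLocus : components (singularLocus k) = {C1 k, C2 k} := by
  rw [singularLocus_eq]
  refine components_union ?_ ?_ zeroLocus_vanishingIdeal_C1 zeroLocus_vanishingIdeal_C2
    not_C1_subset_C2 not_C2_subset_C1
  · rw [vanishingIdeal_C1]
    exact RingHom.ker_isPrime _
  · rw [vanishingIdeal_C2]
    exact RingHom.ker_isPrime _

end Zariski

/-! ### The function field of Y² = f(X) -/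

section FunctionFieldBasics

open Polynomial (natDegree aeval)

variable {k : Type*} [Field k]

/-- The square of the reduced denominator of c divides f, so squarefreeness makes the denominator a
unit. This turns degree counts over k(X) into degree counts for polynomials. -/
lemma exists_polynomial_of_sq_mul {f g : Polynomial k} (hf : Squarefree f) {c : RatFunc k}
    (h : c ^ 2 * algebraMap (Polynomial k) (RatFunc k) f = algebraMap _ _ g) :
    ∃ e : Polynomial k, c = algebraMap _ _ e ∧ e ^ 2 * f = g := by
  have hd : algebraMap (Polynomial k) (RatFunc k) c.denom ≠ 0 := by
    simpa using c.denom_ne_zero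
  have h1 : c.num ^ 2 * f = g * c.denom ^ 2 := by
    apply RatFunc.algebraMap_injective k
    rw [← c.num_div_denom] at h
    field_simp at h
    simpa [mul_comm, mul_assoc, mul_left_comm] using h
  have h2 : c.denom * c.denom ∣ f := by
    rw [← sq]
    exact (c.isCoprime_num_denom.symm.pow (m := 2) (n := 2)).dvd_of_dvd_mul_left
      ⟨g, by rw [h1, mul_comm]⟩
  obtain ⟨u, hu⟩ := hf _ h2
  have hc : c = algebraMap _ _ (c.num * ((u⁻¹ : (Polynomial k)ˣ) : Polynomial k)) := by
    conv_lhs => rw [← c.num_div_denom]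
    rw [div_eq_iff hd, ← map_mul, ← hu, mul_assoc, Units.inv_mul, mul_one]
  refine ⟨_, hc, RatFunc.algebraMap_injective k ?_⟩
  rw [map_mul, map_pow, ← hc, h]

lemma not_isSquare_of_isGenusTwo {f : Polynomial k} (hf : IsGenusTwo f) (c : RatFunc k) :
    c ^ 2 ≠ algebraMap (Polynomial k) (RatFunc k) f := by
  intro h
  have hf0 : f ≠ 0 := hf.1.ne_zero
  have hc : algebraMap (Polynomial k) (RatFunc k) f ≠ 0 := by simpa using hf0
  have hc0 : c ≠ 0 := by rintro rfl; exact hc (by rw [← h]; simp)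
  -- If f = c², then c⁻¹ squared times f is 1, so f divides 1 in k[X].
  obtain ⟨e, -, he⟩ := exists_polynomial_of_sq_mul hf.1 (c := c⁻¹) (g := 1) (by
    rw [← h]; field_simp; simp)
  have hu : IsUnit f := IsUnit.of_mul_eq_one (e ^ 2) (by rw [mul_comm, he])
  have := Polynomial.natDegree_eq_zero_of_isUnit hu
  rcases hf.2 with h' | h' <;> omega

/-- The polynomial `Y ^ 2 - f(X)` over `k(X)`. -/
abbrev curvePoly (f : Polynomial k) : Polynomial (RatFunc k) :=
  Polynomial.X ^ 2 - Polynomial.C (algebraMap (Polynomial k) (RatFunc k) f)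

instance irreducible_curvePoly {f : Polynomial k} [hf : Fact (IsGenusTwo f)] :
    Fact (Irreducible (curvePoly f)) := by
  refine ⟨(X_pow_sub_C_irreducible_iff_of_prime Nat.prime_two).2 fun c hc => ?_⟩
  exact not_isSquare_of_isGenusTwo hf.out c hc

variable (f : Polynomial k)

/-- The function `X` on the curve `Y ^ 2 = f(X)`. -/
def coordX : FunctionField f := algebraMap (RatFunc k) (FunctionField f) RatFunc.X

/-- The function `Y` on the curve `Y ^ 2 = f(X)`. -/
def coordY : FunctionField f := AdjoinRoot.root _

lemma aeval_coordX (p : Polynomial k) : aeval (coordX f) p =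
    algebraMap (RatFunc k) (FunctionField f) (algebraMap (Polynomial k) (RatFunc k) p) := by
  rw [coordX, Polynomial.aeval_algebraMap_apply, ← RatFunc.algebraMap_X,
    Polynomial.aeval_algebraMap_apply, Polynomial.aeval_X_left_apply]

lemma coordY_sq : coordY f ^ 2 = aeval (coordX f) f := by
  have h := AdjoinRoot.eval₂_root (curvePoly f)
  rw [Polynomial.eval₂_sub, Polynomial.eval₂_pow, Polynomial.eval₂_X, Polynomial.eval₂_C,
    sub_eq_zero] at h
  rw [aeval_coordX]
  exact h

lemma exists_eq_add_mul_coordY (z : FunctionField f) : ∃ a b : RatFunc k,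
    z = algebraMap _ _ a + algebraMap _ _ b * coordY f := by
  obtain ⟨p, rfl⟩ := AdjoinRoot.mk_surjective z
  have hm : (curvePoly f).Monic :=
    Polynomial.monic_X_pow_sub_C _ two_ne_zero
  obtain ⟨b, a, hab⟩ := Polynomial.exists_eq_X_add_C_of_natDegree_le_one
    (p := p %ₘ (curvePoly f)) (by
      have := Polynomial.natDegree_modByMonic_lt p hm (by
        intro h
        have := congrArg natDegree h
        rw [Polynomial.natDegree_X_pow_sub_C] at this
        simp at this)
      rw [Polynomial.natDegree_X_pow_sub_C] at this
      omega)
  refine ⟨a, b, ?_⟩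
  have h : AdjoinRoot.mk (curvePoly f) p = AdjoinRoot.mk _ (Polynomial.C b * Polynomial.X + Polynomial.C a) := by
    rw [← hab, AdjoinRoot.mk_eq_mk]
    exact ⟨_, sub_eq_iff_eq_add.2 ((add_comm _ _).trans (Polynomial.modByMonic_add_div p _)).symm⟩
  rw [h, map_add, map_mul, add_comm]
  rfl

variable {f}

section Lift

variable {L : Type*} [Field L] [Algebra k L]

/-- The homomorphism from the function field of `Y ^ 2 = f(X)` given by a point of the curve
with transcendental first coordinate. -/
def liftPoint (U V : L) (hU : Transcendental k U) (h : V ^ 2 = aeval U f) :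
    FunctionField f →ₐ[k] L :=
  AdjoinRoot.liftAlgHom _
    (RatFunc.liftAlgHom (aeval U) (nonZeroDivisors_le_comap_nonZeroDivisors_of_injective _
      (transcendental_iff_injective.1 hU))) V (by
    rw [Polynomial.eval₂_sub, Polynomial.eval₂_pow, Polynomial.eval₂_X, Polynomial.eval₂_C, h,
      sub_eq_zero]
    have := RatFunc.liftAlgHom_apply_div (aeval U)
      (nonZeroDivisors_le_comap_nonZeroDivisors_of_injective _
      (transcendental_iff_injective.1 hU)) f 1
    rw [map_one, map_one, div_one, div_one] at this
    exact this.symm)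

lemma liftPoint_coordY (U V : L) (hU : Transcendental k U) (h : V ^ 2 = aeval U f) :
    liftPoint U V hU h (coordY f) = V := by
  rw [liftPoint, coordY, AdjoinRoot.liftAlgHom_root]

lemma liftPoint_coordX (U V : L) (hU : Transcendental k U) (h : V ^ 2 = aeval U f) :
    liftPoint U V hU h (coordX f) = U := by
  have := RatFunc.liftAlgHom_apply_div (aeval U)
      (nonZeroDivisors_le_comap_nonZeroDivisors_of_injective _
      (transcendental_iff_injective.1 hU)) Polynomial.X 1
  rw [map_one, map_one, div_one, div_one, Polynomial.aeval_X, RatFunc.algebraMap_X] at this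
  exact (AdjoinRoot.liftAlgHom_of _ _ _ _ _).trans this

/-- Agreement on X gives agreement on k[X], and it extends to k(X) by cancelling the image of a
denominator, which is nonzero by injectivity. -/
lemma functionField_algHom_ext {φ ψ : FunctionField f →ₐ[k] L}
    (hX : φ (coordX f) = ψ (coordX f)) (hY : φ (coordY f) = ψ (coordY f)) : φ = ψ := by
  refine AdjoinRoot.algHom_ext' ?_ hY
  have hp : ∀ p : Polynomial k, φ (aeval (coordX f) p) = ψ (aeval (coordX f) p) := fun p => by
    rw [← Polynomial.aeval_algHom_apply, ← Polynomial.aeval_algHom_apply, hX]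
  ext a
  change φ (algebraMap (RatFunc k) (FunctionField f) a) = ψ (algebraMap _ _ a)
  have hd : algebraMap (RatFunc k) (FunctionField f)
      (algebraMap (Polynomial k) (RatFunc k) a.denom) *
      algebraMap (RatFunc k) (FunctionField f) a =
      algebraMap (RatFunc k) (FunctionField f) (algebraMap (Polynomial k) (RatFunc k) a.num) := by
    rw [← map_mul]
    congr 1
    have h0 : algebraMap (Polynomial k) (RatFunc k) a.denom ≠ 0 := by
      simpa using a.denom_ne_zero
    nth_rw 2 [← a.num_div_denom]
    rw [mul_div_cancel₀ _ h0]
  rw [← aeval_coordX, ← aeval_coordX] at hd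
  have h1 := congrArg φ hd
  have h2 := congrArg ψ hd
  rw [map_mul, hp, hp, ← h2, map_mul] at h1
  refine mul_left_cancel₀ (fun h0 => ?_) h1
  have h3 : Function.Injective (ψ.comp (AdjoinRoot.ofAlgHom k _)) := RingHom.injective _
  have h4 : ψ.comp (AdjoinRoot.ofAlgHom k _) (algebraMap (Polynomial k) _ a.denom) = 0 := by
    rw [aeval_coordX] at h0
    exact h0
  have h5 := (map_eq_zero_iff _ h3).1 h4
  exact a.denom_ne_zero (by simpa using h5)

end Lift

variable [hf : Fact (IsGenusTwo f)]

lemma transcendental_coordX : Transcendental k (coordX f) := by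
  rw [transcendental_iff]
  intro p hp
  rw [aeval_coordX, map_eq_zero] at hp
  simpa using hp

lemma coordY_ne_zero : coordY f ≠ 0 := by
  intro h
  have h2 := coordY_sq f
  rw [h, zero_pow two_ne_zero] at h2
  exact hf.out.1.ne_zero (transcendental_iff.1 transcendental_coordX f h2.symm)

lemma coordY_ne_algebraMap (c : RatFunc k) :
    coordY f ≠ algebraMap (RatFunc k) (FunctionField f) c := by
  intro h
  have h2 := coordY_sq f
  rw [h, aeval_coordX, ← map_pow] at h2
  exact not_isSquare_of_isGenusTwo hf.out c ((algebraMap (RatFunc k) (FunctionField f)).injective h2)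

lemma eq_zero_of_add_mul_coordY {a b : RatFunc k}
    (h : algebraMap (RatFunc k) (FunctionField f) a + algebraMap _ _ b * coordY f = 0) :
    a = 0 ∧ b = 0 := by
  have hb : b = 0 := by
    by_contra hb
    have hb' : algebraMap (RatFunc k) (FunctionField f) b ≠ 0 := (map_ne_zero _).2 hb
    refine coordY_ne_algebraMap (f := f) (-a / b) ?_
    rw [map_div₀, map_neg, eq_div_iff hb']
    linear_combination h
  refine ⟨?_, hb⟩
  rwa [hb, map_zero, zero_mul, add_zero, map_eq_zero] at h

lemma transcendental_apply_coordX (φ : FunctionField f ≃ₐ[k] FunctionField f) :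
    Transcendental k (φ (coordX f)) := by
  intro h
  exact transcendental_coordX (f := f) ((isAlgebraic_algHom_iff φ.toAlgHom φ.injective).1 h)

end FunctionFieldBasics

/-! ### Automorphisms preserve the rational subfield k(X) -/

section Moebius

open Polynomial (natDegree aeval)

variable {k : Type*} [Field k]

lemma coeff_coeff_swap (p : Polynomial (Polynomial k)) (m n : ℕ) :
    ((Polynomial.Bivariate.swap p).coeff n).coeff m = (p.coeff m).coeff n := by
  induction p using Polynomial.induction_on' with
  | add p q hp hq => simp [hp, hq]
  | monomial i q =>
    induction q using Polynomial.induction_on' with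
    | add p q hp hq => simp [hp, hq]
    | monomial j a =>
      rw [Polynomial.Bivariate.swap_monomial_monomial]
      simp only [Polynomial.coeff_monomial]
      split_ifs <;> simp_all [Polynomial.coeff_monomial]

lemma natDegree_coeff_le_natDegree_swap (p : Polynomial (Polynomial k)) (m : ℕ) :
    (p.coeff m).natDegree ≤ (Polynomial.Bivariate.swap p).natDegree := by
  rw [Polynomial.natDegree_le_iff_coeff_eq_zero]
  intro N hN
  rw [← coeff_coeff_swap, Polynomial.coeff_eq_zero_of_natDegree_lt hN, Polynomial.coeff_zero]

lemma exists_isPrimitive_map_eq {M : Polynomial (RatFunc k)} (hM : M ≠ 0) :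
    ∃ (G : Polynomial (Polynomial k)) (c : RatFunc k), G.IsPrimitive ∧ c ≠ 0 ∧
      G.map (algebraMap (Polynomial k) (RatFunc k)) = Polynomial.C c * M := by
  classical
  let _ : NormalizedGCDMonoid (Polynomial k) := Classical.choice inferInstance
  obtain ⟨b, hb, h⟩ := IsLocalization.integerNormalization_spec (nonZeroDivisors (Polynomial k)) M
  set G := IsLocalization.integerNormalization (nonZeroDivisors (Polynomial k)) M
  have hb0 : algebraMap (Polynomial k) (RatFunc k) b ≠ 0 := by
    simpa using nonZeroDivisors.ne_zero hb
  have hbM : b • M = Polynomial.C (algebraMap (Polynomial k) (RatFunc k) b) * M := by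
    rw [← Polynomial.smul_eq_C_mul, algebraMap_smul]
  have hG : G ≠ 0 := by
    intro h0
    rw [h0, Polynomial.map_zero, hbM] at h
    exact mul_ne_zero (Polynomial.C_ne_zero.2 hb0) hM h.symm
  have hc : algebraMap (Polynomial k) (RatFunc k) G.content ≠ 0 := by
    simpa [Polynomial.content_eq_zero_iff] using hG
  refine ⟨G.primPart, (algebraMap (Polynomial k) (RatFunc k) G.content)⁻¹ *
    algebraMap (Polynomial k) (RatFunc k) b, G.isPrimitive_primPart,
    mul_ne_zero (inv_ne_zero hc) hb0, ?_⟩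
  rw [Polynomial.C_mul, mul_assoc, ← hbM, ← h]
  nth_rw 3 [G.eq_C_content_mul_primPart]
  rw [Polynomial.map_mul, Polynomial.map_C, ← mul_assoc, ← Polynomial.C_mul, inv_mul_cancel₀ hc,
    Polynomial.C_1, one_mul]

lemma aeval_map_swap_C {f : Polynomial k} (U : FunctionField f) (p : Polynomial k) :
    aeval U ((Polynomial.Bivariate.swap (Polynomial.C p)).map
      (algebraMap (Polynomial k) (RatFunc k))) = aeval U p := by
  rw [Polynomial.Bivariate.swap_C, Polynomial.map_map,
    show (algebraMap (Polynomial k) (RatFunc k)).comp Polynomial.C = algebraMap k (RatFunc k) from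
      (IsScalarTower.algebraMap_eq k (Polynomial k) (RatFunc k)).symm,
    Polynomial.aeval_map_algebraMap]

lemma aeval_map_swap_X {f : Polynomial k} (U : FunctionField f) :
    aeval U ((Polynomial.Bivariate.swap (Polynomial.X : Polynomial (Polynomial k))).map
      (algebraMap (Polynomial k) (RatFunc k))) = coordX f := by
  rw [Polynomial.Bivariate.swap_Y, Polynomial.map_C, Polynomial.aeval_C, RatFunc.algebraMap_X]
  rfl

variable {f : Polynomial k} [hf : Fact (IsGenusTwo f)]

/-- A relation of degree 2 in the first coordinate between `X` and a second element `U`. -/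
lemma natDegree_coeff_le_of_relation {U : FunctionField f} {M : Polynomial (RatFunc k)}
    (hM : M = minpoly (RatFunc k) U) (hM0 : M ≠ 0) {F : Polynomial (Polynomial k)} (hF : F ≠ 0)
    (hdeg : F.natDegree ≤ 2)
    (hFU : Polynomial.aeval U
      ((Polynomial.Bivariate.swap F).map (algebraMap (Polynomial k) (RatFunc k))) = 0) :
    ∃ (G : Polynomial (Polynomial k)) (c : RatFunc k), c ≠ 0 ∧ (∀ i, (G.coeff i).natDegree ≤ 2) ∧
      G.map (algebraMap (Polynomial k) (RatFunc k)) = Polynomial.C c * M := by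
  obtain ⟨G, c, hG, hc, hGM⟩ := exists_isPrimitive_map_eq hM0
  refine ⟨G, c, hc, fun i => ?_, hGM⟩
  have hdvd : G.map (algebraMap (Polynomial k) (RatFunc k)) ∣
      (Polynomial.Bivariate.swap F).map (algebraMap (Polynomial k) (RatFunc k)) := by
    rw [hGM]
    refine (associated_unit_mul_left _ _ ?_).dvd.trans (hM ▸ minpoly.dvd _ _ hFU)
    exact Polynomial.isUnit_C.2 hc.isUnit
  -- By Gauss's lemma the divisibility over k(X) descends to k[X], since G is primitive. Swapping
  -- the variables then bounds the X-degree of G by that of F.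
  obtain ⟨H, hH⟩ := hG.dvd_of_fraction_map_dvd_fraction_map hdvd
  have hF2 : F = Polynomial.Bivariate.swap G * Polynomial.Bivariate.swap H := by
    rw [← map_mul, ← hH, Polynomial.Bivariate.swap_swap_apply]
  refine (natDegree_coeff_le_natDegree_swap G i).trans (le_trans ?_ hdeg)
  exact Polynomial.natDegree_le_of_dvd ⟨_, hF2⟩ hF

lemma apply_aeval_coordX (σ : CurveAut f) (p : Polynomial k) :
    σ (aeval (coordX f) p) = aeval (σ (coordX f)) p :=
  (Polynomial.aeval_algHom_apply σ.toAlgHom _ _).symm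

lemma map_algebraMap_mul_denom (σ : CurveAut f) (c : RatFunc k) :
    σ (algebraMap (RatFunc k) (FunctionField f) c) * aeval (σ (coordX f)) c.denom =
      aeval (σ (coordX f)) c.num := by
  have h0 : algebraMap (Polynomial k) (RatFunc k) c.denom ≠ 0 := by simpa using c.denom_ne_zero
  have h : c * algebraMap (Polynomial k) (RatFunc k) c.denom = algebraMap _ _ c.num := by
    nth_rw 1 [← c.num_div_denom]
    rw [div_mul_cancel₀ _ h0]
  have h2 := congrArg (fun a => σ (algebraMap (RatFunc k) (FunctionField f) a)) h
  simp only [map_mul, ← aeval_coordX] at h2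
  rwa [apply_aeval_coordX, apply_aeval_coordX] at h2

/-- Writing σ⁻¹(X) = c + dY and applying σ gives (X - σ(c))² = σ(d)² f(σ(X)), with σ(c) and σ(d)
rational functions of σ(X). Clearing denominators yields F: its outer variable stands for X and its
coefficients are polynomials in σ(X), hence the swap. -/
lemma exists_quadratic_relation (σ : CurveAut f) : ∃ F : Polynomial (Polynomial k), F ≠ 0 ∧
    F.natDegree ≤ 2 ∧ aeval (σ (coordX f))
      ((Polynomial.Bivariate.swap F).map (algebraMap (Polynomial k) (RatFunc k))) = 0 := by
  obtain ⟨c, d, hcd⟩ := exists_eq_add_mul_coordY f (σ.symm (coordX f))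
  have hX : coordX f = σ (algebraMap (RatFunc k) (FunctionField f) c) +
      σ (algebraMap (RatFunc k) (FunctionField f) d) * σ (coordY f) := by
    rw [← map_mul, ← map_add, ← hcd, AlgEquiv.apply_symm_apply]
  have hc := map_algebraMap_mul_denom σ c
  have hd := map_algebraMap_mul_denom σ d
  have hY : σ (coordY f) ^ 2 = aeval (σ (coordX f)) f := by
    rw [← map_pow, coordY_sq, apply_aeval_coordX]
  have hq : c.denom * d.denom ≠ 0 := mul_ne_zero c.denom_ne_zero d.denom_ne_zero
  refine ⟨Polynomial.C ((c.denom * d.denom) ^ 2) * Polynomial.X ^ 2 +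
    Polynomial.C (-2 * (c.denom * d.denom) * (c.num * d.denom)) * Polynomial.X +
    Polynomial.C ((c.num * d.denom) ^ 2 - (d.num * c.denom) ^ 2 * f), ?_,
    Polynomial.natDegree_quadratic_le, ?_⟩
  · intro h
    have := Polynomial.natDegree_quadratic (pow_ne_zero 2 hq)
      (b := -2 * (c.denom * d.denom) * (c.num * d.denom))
      (c := (c.num * d.denom) ^ 2 - (d.num * c.denom) ^ 2 * f)
    rw [h] at this
    simp at this
  · simp only [map_add, map_mul, map_pow, Polynomial.map_add, Polynomial.map_mul,
      Polynomial.map_pow, aeval_map_swap_C, aeval_map_swap_X, map_sub, Polynomial.map_sub, ← hc,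
      ← hd, map_neg, map_ofNat, ← hY, Polynomial.map_neg, Polynomial.map_ofNat]
    linear_combination (aeval (σ (coordX f)) c.denom) ^ 2 * (aeval (σ (coordX f)) d.denom) ^ 2 *
      (coordX f - σ (algebraMap (RatFunc k) (FunctionField f) c) +
        σ (algebraMap (RatFunc k) (FunctionField f) d) * σ (coordY f)) * hX

/-- Suppose U = σ(X) = a + bY with b ≠ 0. Its minimal polynomial over k(X) is T² - 2aT + a² - b²f.
Since X is also quadratic over k(U), the primitive multiple of this polynomial has coefficients of
X-degree at most 2, which is too small for its discriminant. -/
lemma exists_apply_coordX_eq [CharZero k] (σ : CurveAut f) :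
    ∃ r : RatFunc k, σ (coordX f) = algebraMap (RatFunc k) (FunctionField f) r := by
  obtain ⟨a, b, hab⟩ := exists_eq_add_mul_coordY f (σ (coordX f))
  by_contra! hne
  set U := σ (coordX f) with hU
  have hb : b ≠ 0 := by
    rintro rfl
    exact hne a (by rw [hab, map_zero, zero_mul, add_zero])
  set M : Polynomial (RatFunc k) := Polynomial.X ^ 2 + (Polynomial.C (-2 * a) * Polynomial.X +
    Polynomial.C (a ^ 2 - b ^ 2 * algebraMap (Polynomial k) (RatFunc k) f)) with hM
  have hlt : (Polynomial.C (-2 * a) * Polynomial.X +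
    Polynomial.C (a ^ 2 - b ^ 2 * algebraMap (Polynomial k) (RatFunc k) f)).degree < 2 :=
    Polynomial.degree_linear_lt
  have hMm : M.Monic := Polynomial.monic_X_pow_add hlt
  have hMdeg : M.natDegree = 2 := Polynomial.natDegree_eq_of_degree_eq_some
    ((Polynomial.degree_add_eq_left_of_degree_lt (by simpa using hlt)).trans (by simp))
  have hMU : aeval U M = 0 := by
    have hY := coordY_sq f
    rw [aeval_coordX] at hY
    simp only [hM, map_add, map_mul, map_pow, Polynomial.aeval_X, Polynomial.aeval_C, map_sub,
      map_neg, map_ofNat, ← hY]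
    rw [hab]
    ring
  have hint : IsIntegral (RatFunc k) U := ⟨M, hMm, by simpa [Polynomial.aeval_def] using hMU⟩
  have hmin : M = minpoly (RatFunc k) U := by
    refine Polynomial.eq_of_monic_of_dvd_of_natDegree_le (minpoly.monic hint) hMm
      (minpoly.dvd _ _ hMU) ?_
    rw [hMdeg, minpoly.two_le_natDegree_iff hint]
    rintro ⟨r, hr⟩
    exact hne r hr.symm
  obtain ⟨F, hF0, hFdeg, hFU⟩ := exists_quadratic_relation σ
  obtain ⟨G, c, hc, hG, hGM⟩ := natDegree_coeff_le_of_relation hmin hMm.ne_zero hF0 hFdeg hFU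
  have h2 : algebraMap (Polynomial k) (RatFunc k) (G.coeff 2) = c := by
    rw [← Polynomial.coeff_map, hGM, Polynomial.coeff_C_mul, ← hMdeg, hMm.coeff_natDegree, mul_one]
  have hco : ∀ A B : RatFunc k, (Polynomial.X ^ 2 + (Polynomial.C A * Polynomial.X +
      Polynomial.C B)).coeff 1 = A ∧ (Polynomial.X ^ 2 + (Polynomial.C A * Polynomial.X +
      Polynomial.C B)).coeff 0 = B := fun A B => by simp [Polynomial.coeff_X_pow]
  have h1 : algebraMap (Polynomial k) (RatFunc k) (G.coeff 1) = c * (-2 * a) := by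
    rw [← Polynomial.coeff_map, hGM, Polynomial.coeff_C_mul]
    rw [hM, (hco _ _).1]
  have h0 : algebraMap (Polynomial k) (RatFunc k) (G.coeff 0) =
      c * (a ^ 2 - b ^ 2 * algebraMap (Polynomial k) (RatFunc k) f) := by
    rw [← Polynomial.coeff_map, hGM, Polynomial.coeff_C_mul]
    rw [hM, (hco _ _).2]
  -- The discriminant of the primitive multiple is (2cb)² f, so 2cb is a polynomial e. The degree of
  -- e² f is at most 4 by the bound on the coefficients and at least 5 by the hypothesis on f.
  obtain ⟨e, he, heq⟩ := exists_polynomial_of_sq_mul hf.out.1 (c := 2 * c * b)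
    (g := G.coeff 1 ^ 2 - 4 * G.coeff 0 * G.coeff 2) (by
      simp only [map_sub, map_mul, map_pow, h0, h1, h2, map_ofNat]
      ring)
  have he0 : e ≠ 0 := by
    rintro rfl
    have h20 : (2 : RatFunc k) ≠ 0 := by simp
    rw [map_zero] at he
    exact mul_ne_zero (mul_ne_zero h20 hc) hb he
  have hdeg : natDegree (e ^ 2 * f) ≤ 4 := by
    rw [heq]
    refine (Polynomial.natDegree_sub_le_of_le (m := 4) (n := 4) ?_ ?_).trans (by simp)
    · exact (Polynomial.natDegree_pow_le).trans (by have := hG 1; omega)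
    · refine Polynomial.natDegree_mul_le.trans ?_
      have h4 : natDegree (4 * G.coeff 0) ≤ 2 := by
        rw [show (4 : Polynomial k) = Polynomial.C 4 from (map_ofNat Polynomial.C 4).symm]
        exact (Polynomial.natDegree_C_mul_le _ _).trans (hG 0)
      have := hG 2
      omega
  rw [Polynomial.natDegree_mul (pow_ne_zero 2 he0) hf.out.1.ne_zero] at hdeg
  rcases hf.out.2 with h | h <;> omega

end Moebius

/-! ### Automorphisms as Möbius transformations acting on the sextic -/

section MoebiusAction

open Polynomial (natDegree aeval)

variable {k : Type*} [Field k]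

/-- A rational function with a rational left inverse under composition has degree at most 1. -/
lemma exists_linear_fractional {r s : RatFunc k}
    (h : RatFunc.X * Polynomial.aeval r s.denom = Polynomial.aeval r s.num) :
    ∃ N D : Polynomial k, N.natDegree ≤ 1 ∧ D.natDegree ≤ 1 ∧ D ≠ 0 ∧
      r * algebraMap (Polynomial k) (RatFunc k) D = algebraMap _ _ N := by
  -- P(T) = num(T) - X · den(T) has r as a root, and its coefficients are of degree at most 1 in X.
  -- By the rational root theorem the numerator and denominator of r divide the constant and the
  -- leading coefficient.
  set P : Polynomial (Polynomial k) := s.num.map Polynomial.C -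
    Polynomial.C Polynomial.X * s.denom.map Polynomial.C with hP
  have hmap : ∀ p : Polynomial k, aeval r (p.map Polynomial.C) = aeval r p := fun p =>
    Polynomial.aeval_map_algebraMap (Polynomial k) r p
  have hroot : aeval r P = 0 := by
    rw [hP, map_sub, map_mul, hmap, hmap, Polynomial.aeval_C, RatFunc.algebraMap_X, h, sub_self]
  have hco : ∀ i, P.coeff i = Polynomial.C (-s.denom.coeff i) * Polynomial.X +
      Polynomial.C (s.num.coeff i) := fun i => by
    rw [hP, Polynomial.coeff_sub, Polynomial.coeff_C_mul, Polynomial.coeff_map,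
      Polynomial.coeff_map, Polynomial.C_neg]
    ring
  have hdeg : ∀ i, (P.coeff i).natDegree ≤ 1 := fun i => by
    rw [hco]
    exact Polynomial.natDegree_linear_le
  have hzero : ∀ i, P.coeff i = 0 → s.denom.coeff i = 0 ∧ s.num.coeff i = 0 := fun i hi => by
    rw [hco] at hi
    have h1 := congrArg (Polynomial.coeff · 1) hi
    have h0 := congrArg (Polynomial.coeff · 0) hi
    simp only [Polynomial.coeff_add, Polynomial.coeff_C_mul, Polynomial.coeff_X_one,
      Polynomial.coeff_X_zero, Polynomial.coeff_C_zero, Polynomial.coeff_zero,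
      Polynomial.coeff_C_succ, mul_one, mul_zero, add_zero, zero_add, neg_eq_zero] at h1 h0
    exact ⟨h1, h0⟩
  have hP0 : P ≠ 0 := fun h0 => s.denom_ne_zero (Polynomial.ext fun i =>
    (hzero i (by rw [h0, Polynomial.coeff_zero])).1)
  -- If the constant term vanished, the variable would divide both the numerator and the denominator
  -- of s, which are coprime.
  have hc0 : P.coeff 0 ≠ 0 := fun h0 => by
    obtain ⟨h1, h2⟩ := hzero 0 h0
    have hu := s.isCoprime_num_denom.isUnit_of_dvd' (Polynomial.X_dvd_iff.2 h2)
      (Polynomial.X_dvd_iff.2 h1)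
    exact Polynomial.not_isUnit_X hu
  refine ⟨IsFractionRing.num (Polynomial k) r, IsFractionRing.den (Polynomial k) r,
    (Polynomial.natDegree_le_of_dvd (num_dvd_of_is_root hroot) hc0).trans (hdeg 0),
    (Polynomial.natDegree_le_of_dvd (den_dvd_of_is_root hroot)
      (Polynomial.leadingCoeff_ne_zero.2 hP0)).trans (hdeg _),
    nonZeroDivisors.ne_zero (IsFractionRing.den (Polynomial k) r).2, ?_⟩
  have hD : algebraMap (Polynomial k) (RatFunc k) (IsFractionRing.den (Polynomial k) r) ≠ 0 := by
    simp
  nth_rw 1 [← IsFractionRing.mk'_num_den (Polynomial k) r]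
  rw [IsFractionRing.mk'_eq_div, div_mul_cancel₀ _ hD]

variable {f : Polynomial k} [hf : Fact (IsGenusTwo f)]

lemma linear_eq_zero {a b : k}
    (h : algebraMap k (FunctionField f) a * coordX f + algebraMap k _ b = 0) : a = 0 ∧ b = 0 := by
  have h1 : aeval (coordX f) (Polynomial.C a * Polynomial.X + Polynomial.C b) = 0 := by
    rw [map_add, map_mul, Polynomial.aeval_C, Polynomial.aeval_C, Polynomial.aeval_X, h]
  have h2 := transcendental_iff.1 (transcendental_coordX (f := f)) _ h1
  constructor
  · simpa using congrArg (Polynomial.coeff · 1) h2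
  · simpa using congrArg (Polynomial.coeff · 0) h2

lemma exists_moebius [CharZero k] (σ : CurveAut f) : ∃ α β γ δ : k, α * δ - β * γ ≠ 0 ∧
    σ (coordX f) * (algebraMap k _ γ * coordX f + algebraMap k _ δ) =
      algebraMap k _ α * coordX f + algebraMap k _ β := by
  obtain ⟨r, hr⟩ := exists_apply_coordX_eq σ
  obtain ⟨s, hs⟩ := exists_apply_coordX_eq σ.symm
  -- Applying σ to σ⁻¹(X) = s(X) gives X = s(r): the rational function r has a left inverse under
  -- composition.
  have h := map_algebraMap_mul_denom σ s
  rw [← hs, AlgEquiv.apply_symm_apply, hr, Polynomial.aeval_algebraMap_apply,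
    Polynomial.aeval_algebraMap_apply, coordX, ← map_mul] at h
  obtain ⟨N, D, hN, hD, hD0, hND⟩ :=
    exists_linear_fractional ((algebraMap (RatFunc k) (FunctionField f)).injective h)
  obtain ⟨α, β, rfl⟩ := Polynomial.exists_eq_X_add_C_of_natDegree_le_one hN
  obtain ⟨γ, δ, rfl⟩ := Polynomial.exists_eq_X_add_C_of_natDegree_le_one hD
  have h2 := congrArg (algebraMap (RatFunc k) (FunctionField f)) hND
  rw [map_mul, ← aeval_coordX, ← aeval_coordX, ← hr] at h2
  simp only [map_add, map_mul, Polynomial.aeval_C, Polynomial.aeval_X] at h2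
  refine ⟨α, β, γ, δ, fun hdet => ?_, h2⟩
  have hlin : algebraMap k (FunctionField f) γ * coordX f + algebraMap k _ δ ≠ 0 := by
    intro h0
    obtain ⟨rfl, rfl⟩ := linear_eq_zero h0
    simp at hD0
  -- a vanishing determinant makes the image of `X` constant
  have hdet' : algebraMap k (FunctionField f) α * algebraMap k _ δ =
      algebraMap k _ β * algebraMap k _ γ := by
    rw [← map_mul, ← map_mul, sub_eq_zero.1 hdet]
  have hconst : ∀ a b : k, (a ≠ 0 ∨ b ≠ 0) →
      algebraMap k (FunctionField f) a * σ (coordX f) + algebraMap k _ b ≠ 0 := by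
    intro a b hab h0
    have h3 := congrArg σ.symm h0
    simp only [map_add, map_mul, AlgEquiv.symm_apply_apply,
      AlgEquiv.commutes, map_zero] at h3
    have := linear_eq_zero h3
    tauto
  by_cases hγ : γ = 0
  · have hδ : δ ≠ 0 := by rintro rfl; simp [hγ] at hD0
    refine hconst δ (-β) (.inl hδ) ?_
    have hα : α = 0 := by
      subst hγ
      simpa [hδ] using hdet
    subst hγ hα
    simp only [map_zero, zero_mul, zero_add] at h2
    rw [map_neg, mul_comm, h2, add_neg_cancel]
  · refine hconst γ (-α) (.inl hγ) (mul_right_cancel₀ hlin ?_)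
    rw [map_neg, zero_mul]
    linear_combination algebraMap k (FunctionField f) γ * h2 - hdet'

/-- The sextic form of `f` evaluated at a pair of polynomials. -/
def sexticForm (f p q : Polynomial k) : Polynomial k :=
  ∑ i ∈ Finset.range 7, Polynomial.C (f.coeff i) * p ^ i * q ^ (6 - i)

lemma aeval_sexticForm {A : Type*} [CommRing A] [Algebra k A] {f : Polynomial k}
    (hf : f.natDegree ≤ 6) (p q : Polynomial k) {x u : A}
    (h : u * Polynomial.aeval x q = Polynomial.aeval x p) :
    Polynomial.aeval x (sexticForm f p q) =
      Polynomial.aeval u f * Polynomial.aeval x q ^ 6 := by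
  rw [f.as_sum_range_C_mul_X_pow' (Nat.lt_succ_of_le hf)]
  rw [sexticForm, map_sum, map_sum, Finset.sum_mul]
  refine Finset.sum_congr rfl fun i hi => ?_
  have hi' : i ≤ 6 := Nat.lt_succ_iff.1 (Finset.mem_range.1 hi)
  rw [← f.as_sum_range_C_mul_X_pow' (Nat.lt_succ_of_le hf)]
  simp only [map_mul, map_pow, Polynomial.aeval_C, Polynomial.aeval_X, ← h]
  rw [mul_pow, ← pow_mul_pow_sub (Polynomial.aeval x q) hi']
  ring

lemma natDegree_sexticForm_le {f p q : Polynomial k} (hp : p.natDegree ≤ 1)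
    (hq : q.natDegree ≤ 1) : (sexticForm f p q).natDegree ≤ 6 := by
  refine Polynomial.natDegree_sum_le_of_forall_le _ _ fun i hi => ?_
  have hi' : i ≤ 6 := Nat.lt_succ_iff.1 (Finset.mem_range.1 hi)
  refine Polynomial.natDegree_mul_le.trans ?_
  have h1 : natDegree (Polynomial.C (f.coeff i) * p ^ i) ≤ i :=
    (Polynomial.natDegree_C_mul_le _ _).trans
      (Polynomial.natDegree_pow_le.trans (by nlinarith))
  have h2 : natDegree (q ^ (6 - i)) ≤ 6 - i := Polynomial.natDegree_pow_le.trans (by nlinarith)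
  omega

/-- Write σ(Y) = a + bY. Its square is f(σ(X)), which lies in k(X), so 2ab = 0. If b were zero, σ
would map everything into k(X) and could not be surjective. -/
lemma exists_apply_coordY [CharZero k] (σ : CurveAut f) : ∃ b : RatFunc k, b ≠ 0 ∧
    σ (coordY f) = algebraMap (RatFunc k) (FunctionField f) b * coordY f := by
  obtain ⟨r, hr⟩ := exists_apply_coordX_eq σ
  obtain ⟨a, b, hab⟩ := exists_eq_add_mul_coordY f (σ (coordY f))
  have h1 : σ (coordY f) ^ 2 = algebraMap (RatFunc k) (FunctionField f) (Polynomial.aeval r f) := by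
    rw [← map_pow, coordY_sq, apply_aeval_coordX, hr, Polynomial.aeval_algebraMap_apply]
  have hY := coordY_sq f
  rw [aeval_coordX] at hY
  have hab0 : algebraMap (RatFunc k) (FunctionField f) (a ^ 2 + b ^ 2 *
      algebraMap (Polynomial k) (RatFunc k) f - Polynomial.aeval r f) +
      algebraMap (RatFunc k) (FunctionField f) (2 * a * b) * coordY f = 0 := by
    simp only [map_add, map_sub, map_mul, map_pow, map_ofNat, ← hY, ← h1]
    rw [hab]
    ring
  have h20 : (2 : RatFunc k) ≠ 0 := by simp
  have hb : b ≠ 0 := by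
    rintro rfl
    rw [map_zero, zero_mul, add_zero] at hab
    obtain ⟨c, d, hcd⟩ := exists_eq_add_mul_coordY f (σ.symm (coordY f))
    have hmem : ∀ c : RatFunc k, ∃ c' : RatFunc k,
        σ (algebraMap (RatFunc k) (FunctionField f) c) = algebraMap _ _ c' := fun c => by
      have h := map_algebraMap_mul_denom σ c
      have hne : Polynomial.aeval (σ (coordX f)) c.denom ≠ 0 := fun h0 =>
        c.denom_ne_zero (transcendental_iff.1 (transcendental_apply_coordX σ) _ h0)
      refine ⟨Polynomial.aeval r c.num / Polynomial.aeval r c.denom, ?_⟩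
      rw [map_div₀, ← Polynomial.aeval_algebraMap_apply, ← Polynomial.aeval_algebraMap_apply, ← hr,
        eq_div_iff hne, h]
    obtain ⟨c', hc'⟩ := hmem c
    obtain ⟨d', hd'⟩ := hmem d
    refine coordY_ne_algebraMap (f := f) (c' + d' * a) ?_
    have h3 := congrArg σ hcd
    rw [AlgEquiv.apply_symm_apply, map_add, map_mul, hc', hd', hab, ← map_mul, ← map_add] at h3
    exact h3
  have ha : a = 0 := by
    simpa [h20, hb] using (eq_zero_of_add_mul_coordY hab0).2
  exact ⟨b, hb, by rw [hab, ha, map_zero, zero_add]⟩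

/-- The factor relating σ(Y)(γX + δ)³ to Y is a polynomial e with e² f equal to the transformed
sextic. That has degree at most 6 and f has degree at least 5, so e is constant. -/
lemma exists_moebius_coordY [CharZero k] (σ : CurveAut f) {α β γ δ : k}
    (h : σ (coordX f) * (algebraMap k _ γ * coordX f + algebraMap k _ δ) =
      algebraMap k _ α * coordX f + algebraMap k _ β) (hne : γ ≠ 0 ∨ δ ≠ 0) :
    ∃ e : k, e ≠ 0 ∧ σ (coordY f) * (algebraMap k _ γ * coordX f + algebraMap k _ δ) ^ 3 =
      algebraMap k _ e * coordY f ∧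
      sexticForm f (Polynomial.C α * Polynomial.X + Polynomial.C β)
        (Polynomial.C γ * Polynomial.X + Polynomial.C δ) = Polynomial.C (e ^ 2) * f := by
  obtain ⟨b, hb, hbY⟩ := exists_apply_coordY σ
  set N := Polynomial.C α * Polynomial.X + Polynomial.C β with hN
  set D := Polynomial.C γ * Polynomial.X + Polynomial.C δ with hD
  have hD0 : D ≠ 0 := by
    intro h0
    have h1 := congrArg (Polynomial.coeff · 1) h0
    have h2 := congrArg (Polynomial.coeff · 0) h0
    simp [hD] at h1 h2
    tauto
  have haD : algebraMap k (FunctionField f) γ * coordX f + algebraMap k _ δ =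
      Polynomial.aeval (coordX f) D := by simp [hD]
  have haN : algebraMap k (FunctionField f) α * coordX f + algebraMap k _ β =
      Polynomial.aeval (coordX f) N := by simp [hN]
  rw [haD, haN] at h
  rw [haD]
  have hdeg6 : f.natDegree ≤ 6 := by rcases hf.out.2 with h | h <;> omega
  have hform := aeval_sexticForm hdeg6 N D h
  rw [← apply_aeval_coordX, ← coordY_sq, map_pow, hbY, mul_pow, coordY_sq, aeval_coordX,
    aeval_coordX, aeval_coordX, ← map_pow, ← map_pow, ← map_mul, ← map_mul] at hform
  have hform' := (algebraMap (RatFunc k) (FunctionField f)).injective hform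
  obtain ⟨e, he, heq⟩ := exists_polynomial_of_sq_mul hf.out.1
    (c := b * algebraMap (Polynomial k) (RatFunc k) D ^ 3) (g := sexticForm f N D) (by
      rw [hform']; ring)
  have he0 : e ≠ 0 := by
    rintro rfl
    rw [map_zero] at he
    exact mul_ne_zero hb (pow_ne_zero 3 (by simpa using hD0)) he
  have hdeg := natDegree_sexticForm_le (f := f) (p := N) (q := D)
    Polynomial.natDegree_linear_le Polynomial.natDegree_linear_le
  rw [← heq, Polynomial.natDegree_mul (pow_ne_zero 2 he0) hf.out.1.ne_zero,
    Polynomial.natDegree_pow] at hdeg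
  have he1 : e.natDegree = 0 := by rcases hf.out.2 with h | h <;> omega
  rw [Polynomial.natDegree_eq_zero] at he1
  obtain ⟨e, rfl⟩ := he1
  refine ⟨e, by simpa using he0, ?_, by rw [← heq, Polynomial.C_pow]⟩
  have h3 := congrArg (algebraMap (RatFunc k) (FunctionField f)) he
  rw [map_mul, map_pow, ← aeval_coordX, ← aeval_coordX, Polynomial.aeval_C] at h3
  rw [hbY, ← h3]
  ring

end MoebiusAction

/-! ### Behaviour of J₂, J₄, J₆ under translation, scaling and reversal -/

section Invariants

/-- The hypotheses list the coefficients of f(X + b). Translations, scalings and the reversal of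
coefficients are the only substitutions under which the invariants need to be followed. -/
lemma sexticJ2_shift {R : Type*} [CommRing R] {a a' : ℕ → R} (b : R)
    (h0 : a' 0 = a 0 + a 1 * b + a 2 * b ^ 2 + a 3 * b ^ 3 + a 4 * b ^ 4 + a 5 * b ^ 5 +
      a 6 * b ^ 6)
    (h1 : a' 1 = a 1 + 2 * a 2 * b + 3 * a 3 * b ^ 2 + 4 * a 4 * b ^ 3 + 5 * a 5 * b ^ 4 +
      6 * a 6 * b ^ 5)
    (h2 : a' 2 = a 2 + 3 * a 3 * b + 6 * a 4 * b ^ 2 + 10 * a 5 * b ^ 3 + 15 * a 6 * b ^ 4)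
    (h3 : a' 3 = a 3 + 4 * a 4 * b + 10 * a 5 * b ^ 2 + 20 * a 6 * b ^ 3)
    (h4 : a' 4 = a 4 + 5 * a 5 * b + 15 * a 6 * b ^ 2)
    (h5 : a' 5 = a 5 + 6 * a 6 * b) (h6 : a' 6 = a 6) : sexticJ2 a' = sexticJ2 a := by
  simp only [sexticJ2, h0, h1, h2, h3, h4, h5, h6]
  ring

set_option maxHeartbeats 4000000 in
lemma sexticJ4_shift {R : Type*} [CommRing R] {a a' : ℕ → R} (b : R)
    (h0 : a' 0 = a 0 + a 1 * b + a 2 * b ^ 2 + a 3 * b ^ 3 + a 4 * b ^ 4 + a 5 * b ^ 5 +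
      a 6 * b ^ 6)
    (h1 : a' 1 = a 1 + 2 * a 2 * b + 3 * a 3 * b ^ 2 + 4 * a 4 * b ^ 3 + 5 * a 5 * b ^ 4 +
      6 * a 6 * b ^ 5)
    (h2 : a' 2 = a 2 + 3 * a 3 * b + 6 * a 4 * b ^ 2 + 10 * a 5 * b ^ 3 + 15 * a 6 * b ^ 4)
    (h3 : a' 3 = a 3 + 4 * a 4 * b + 10 * a 5 * b ^ 2 + 20 * a 6 * b ^ 3)
    (h4 : a' 4 = a 4 + 5 * a 5 * b + 15 * a 6 * b ^ 2)
    (h5 : a' 5 = a 5 + 6 * a 6 * b) (h6 : a' 6 = a 6) : sexticJ4 a' = sexticJ4 a := by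
  simp only [sexticJ4, h0, h1, h2, h3, h4, h5, h6]
  ring

set_option maxHeartbeats 40000000 in
lemma sexticJ6_shift {R : Type*} [CommRing R] {a a' : ℕ → R} (b : R)
    (h0 : a' 0 = a 0 + a 1 * b + a 2 * b ^ 2 + a 3 * b ^ 3 + a 4 * b ^ 4 + a 5 * b ^ 5 +
      a 6 * b ^ 6)
    (h1 : a' 1 = a 1 + 2 * a 2 * b + 3 * a 3 * b ^ 2 + 4 * a 4 * b ^ 3 + 5 * a 5 * b ^ 4 +
      6 * a 6 * b ^ 5)
    (h2 : a' 2 = a 2 + 3 * a 3 * b + 6 * a 4 * b ^ 2 + 10 * a 5 * b ^ 3 + 15 * a 6 * b ^ 4)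
    (h3 : a' 3 = a 3 + 4 * a 4 * b + 10 * a 5 * b ^ 2 + 20 * a 6 * b ^ 3)
    (h4 : a' 4 = a 4 + 5 * a 5 * b + 15 * a 6 * b ^ 2)
    (h5 : a' 5 = a 5 + 6 * a 6 * b) (h6 : a' 6 = a 6) : sexticJ6 a' = sexticJ6 a := by
  simp only [sexticJ6, h0, h1, h2, h3, h4, h5, h6]
  ring

variable {R : Type*} [CommRing R] {a a' : ℕ → R}

lemma sexticJ2_scale (c t : R) (h : ∀ i, a' i = c * (a i * t ^ i)) :
    sexticJ2 a' = c ^ 2 * t ^ 6 * sexticJ2 a := by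
  simp only [sexticJ2, h]
  ring

lemma sexticJ4_scale (c t : R) (h : ∀ i, a' i = c * (a i * t ^ i)) :
    sexticJ4 a' = c ^ 4 * t ^ 12 * sexticJ4 a := by
  simp only [sexticJ4, h]
  ring

lemma sexticJ6_scale (c t : R) (h : ∀ i, a' i = c * (a i * t ^ i)) :
    sexticJ6 a' = c ^ 6 * t ^ 18 * sexticJ6 a := by
  simp only [sexticJ6, h]
  ring

lemma sexticJ2_reverse (h : ∀ i ≤ 6, a' i = a (6 - i)) : sexticJ2 a' = sexticJ2 a := by
  simp only [sexticJ2, h 0 (by norm_num), h 1 (by norm_num), h 2 (by norm_num), h 3 (by norm_num),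
    h 4 (by norm_num), h 5 (by norm_num), h 6 (by norm_num)]
  ring

lemma sexticJ4_reverse (h : ∀ i ≤ 6, a' i = a (6 - i)) : sexticJ4 a' = sexticJ4 a := by
  simp only [sexticJ4, h 0 (by norm_num), h 1 (by norm_num), h 2 (by norm_num), h 3 (by norm_num),
    h 4 (by norm_num), h 5 (by norm_num), h 6 (by norm_num)]
  ring

lemma sexticJ6_reverse (h : ∀ i ≤ 6, a' i = a (6 - i)) : sexticJ6 a' = sexticJ6 a := by
  simp only [sexticJ6, h 0 (by norm_num), h 1 (by norm_num), h 2 (by norm_num), h 3 (by norm_num),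
    h 4 (by norm_num), h 5 (by norm_num), h 6 (by norm_num)]
  ring

end Invariants

/-! ### The discriminant in terms of linear factors -/

section LinearFactors

open Polynomial (natDegree)

variable {k : Type*} [Field k]

/-- The linear polynomial `u X + v`. -/
def linearPoly (u v : k) : Polynomial k := Polynomial.C u * Polynomial.X + Polynomial.C v

/-- The product of the `2 × 2` minors of the pairs `(uᵢ, vᵢ)`. -/
def minorProd {ι : Type*} [DecidableEq ι] (s : Finset ι) (u v : ι → k) : k :=
  ∏ i ∈ s, ∏ j ∈ s.erase i, (u i * v j - u j * v i)

lemma natDegree_linearPoly {u : k} (hu : u ≠ 0) (v : k) : (linearPoly u v).natDegree = 1 :=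
  Polynomial.natDegree_linear hu

lemma resultant_linearPoly_left {u v : k} (hu : u ≠ 0) {g : Polynomial k} {n : ℕ}
    (hg : g.natDegree ≤ n) :
    (linearPoly u v).resultant g 1 n = u ^ n * g.eval (-v / u) := by
  have h : linearPoly u v = Polynomial.C u * (Polynomial.X - Polynomial.C (-v / u)) := by
    rw [linearPoly, mul_sub, ← Polynomial.C_mul, mul_div_cancel₀ _ hu, Polynomial.C_neg,
      sub_neg_eq_add]
  rw [h, Polynomial.resultant_C_mul_left, Polynomial.resultant_X_sub_C_left _ _ _ hg]

variable {ι : Type*}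

lemma natDegree_prod_linearPoly {s : Finset ι} {u : ι → k} (v : ι → k) (hu : ∀ i ∈ s, u i ≠ 0) :
    (∏ i ∈ s, linearPoly (u i) (v i)).natDegree = s.card := by
  rw [Polynomial.natDegree_prod _ _ fun i hi h0 => by
    simpa [h0] using natDegree_linearPoly (hu i hi) (v i)]
  rw [Finset.sum_congr rfl fun i hi => natDegree_linearPoly (hu i hi) (v i)]
  simp

lemma leadingCoeff_prod_linearPoly {s : Finset ι} {u : ι → k} (v : ι → k)
    (hu : ∀ i ∈ s, u i ≠ 0) : (∏ i ∈ s, linearPoly (u i) (v i)).leadingCoeff = ∏ i ∈ s, u i := by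
  rw [Polynomial.leadingCoeff_prod]
  exact Finset.prod_congr rfl fun i hi => Polynomial.leadingCoeff_linear (hu i hi)

lemma natDegree_prod_linearPoly_le (s : Finset ι) (u v : ι → k) :
    (∏ i ∈ s, linearPoly (u i) (v i)).natDegree ≤ s.card := by
  refine (Polynomial.natDegree_prod_le _ _).trans ?_
  refine (Finset.sum_le_card_nsmul s _ 1 fun i _ => Polynomial.natDegree_linear_le).trans ?_
  simp

variable [DecidableEq ι]

lemma eval_derivative_prod_linearPoly {s : Finset ι} {u v : ι → k} {i : ι} (hi : i ∈ s)
    (hu : u i ≠ 0) :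
    u i ^ (s.card - 1) * (∏ j ∈ s, linearPoly (u j) (v j)).derivative.eval (-v i / u i) =
      u i * ∏ j ∈ s.erase i, (u i * v j - u j * v i) := by
  have h0 : (linearPoly (u i) (v i)).eval (-v i / u i) = 0 := by
    simp [linearPoly]
    field_simp
    ring
  rw [← Finset.mul_prod_erase s _ hi, Polynomial.derivative_mul, Polynomial.eval_add,
    Polynomial.eval_mul, Polynomial.eval_mul, h0, zero_mul, add_zero, Polynomial.eval_prod,
    ← Finset.card_erase_of_mem hi, ← Finset.prod_const]
  rw [mul_left_comm, ← Finset.prod_mul_distrib]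
  congr 1
  · simp [linearPoly]
  · refine Finset.prod_congr rfl fun j _ => ?_
    simp [linearPoly]
    field_simp
    ring

/-- The resultant of P and P' is multiplicative over the linear factors of P. The factor uX + v
contributes u ^ (n - 1) P'(-v / u), which is u times the product of its minors with the other
factors. -/
lemma discr_prod_linearPoly {s : Finset ι} {u v : ι → k} (hs : 0 < s.card)
    (hu : ∀ i ∈ s, u i ≠ 0) : (∏ i ∈ s, linearPoly (u i) (v i)).discr =
      (-1) ^ (s.card * (s.card - 1) / 2) * minorProd s u v := by
  set P := ∏ i ∈ s, linearPoly (u i) (v i) with hP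
  have hdeg : P.natDegree = s.card := natDegree_prod_linearPoly v hu
  have h1 := Polynomial.resultant_deriv (f := P)
    (Polynomial.natDegree_pos_iff_degree_pos.1 (by rw [hdeg]; exact hs))
  have hder : P.derivative.natDegree ≤ s.card - 1 := by
    rw [← hdeg]; exact Polynomial.natDegree_derivative_le P
  have h2 : P.resultant P.derivative P.natDegree (P.natDegree - 1) =
      (∏ i ∈ s, u i) * minorProd s u v := by
    have h3 := Polynomial.resultant_prod_left s (fun i => linearPoly (u i) (v i)) P.derivative
      (s.card - 1) (Finset.prod_ne_zero_iff.2 fun i hi => by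
        rw [linearPoly, Polynomial.leadingCoeff_linear (hu i hi)]; exact hu i hi) hder
    rw [← hP, ← hdeg] at h3
    rw [h3, minorProd, ← Finset.prod_mul_distrib]
    refine Finset.prod_congr rfl fun i hi => ?_
    rw [natDegree_linearPoly (hu i hi), hdeg, resultant_linearPoly_left (hu i hi) hder, hP,
      eval_derivative_prod_linearPoly hi (hu i hi)]
  rw [h2, hdeg, leadingCoeff_prod_linearPoly v hu] at h1
  have hprod : ∏ i ∈ s, u i ≠ 0 := Finset.prod_ne_zero_iff.2 hu
  have h5 := mul_left_cancel₀ hprod (h1.trans (by ring :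
    _ = (∏ i ∈ s, u i) * ((-1) ^ (s.card * (s.card - 1) / 2) * P.discr)))
  rw [h5, ← mul_assoc, ← mul_pow]
  simp

lemma minorProd_insert {s : Finset ι} {m : ι} (hm : m ∉ s) (u v : ι → k) :
    minorProd (insert m s) u v = minorProd s u v *
      ∏ i ∈ s, (-(u m * v i - u i * v m) ^ 2) := by
  rw [minorProd, Finset.prod_insert hm, Finset.erase_insert hm]
  have h : ∀ i ∈ s, ∏ j ∈ (insert m s).erase i, (u i * v j - u j * v i) =
      (u i * v m - u m * v i) * ∏ j ∈ s.erase i, (u i * v j - u j * v i) := fun i hi => by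
    rw [Finset.erase_insert_of_ne (by rintro rfl; exact hm hi), Finset.prod_insert]
    exact fun h => hm (Finset.mem_of_mem_erase h)
  rw [Finset.prod_congr rfl h, Finset.prod_mul_distrib, ← mul_assoc, ← Finset.prod_mul_distrib,
    mul_comm, minorProd]
  congr 1
  exact Finset.prod_congr rfl fun i _ => by ring

lemma minorProd_smul (s : Finset ι) (t : k) (u v : ι → k) :
    minorProd s (fun i => t * u i) (fun i => t * v i) =
      t ^ (2 * (s.card * (s.card - 1))) * minorProd s u v := by
  have h : ∀ i ∈ s, ∏ j ∈ s.erase i, (t * u i * (t * v j) - t * u j * (t * v i)) =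
      t ^ (2 * (s.card - 1)) * ∏ j ∈ s.erase i, (u i * v j - u j * v i) := fun i hi => by
    rw [← Finset.card_erase_of_mem hi, pow_mul, ← Finset.prod_const, ← Finset.prod_mul_distrib]
    exact Finset.prod_congr rfl fun j _ => by ring
  rw [minorProd, Finset.prod_congr rfl h, Finset.prod_mul_distrib, Finset.prod_const, ← pow_mul,
    minorProd]
  congr 2
  ring

lemma ne_zero_of_card_le_natDegree {s : Finset ι} {u v : ι → k}
    (h : s.card ≤ (∏ i ∈ s, linearPoly (u i) (v i)).natDegree) : ∀ i ∈ s, u i ≠ 0 := by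
  intro i hi h0
  rw [← Finset.mul_prod_erase s _ hi, linearPoly, h0, Polynomial.C_0, zero_mul, zero_add] at h
  have h1 := (h.trans (Polynomial.natDegree_C_mul_le _ _)).trans (natDegree_prod_linearPoly_le _ _ _)
  rw [Finset.card_erase_of_mem hi] at h1
  have := Finset.card_pos.2 ⟨i, hi⟩
  omega

/-- Allowing one factor to be constant (a root at infinity) gives degrees 5 and 6 the same formula.
The sign is (-1)¹⁵, because `minorProd` runs over ordered pairs. -/
lemma J10_prod_linearPoly [IsAlgClosed k] {u v : Fin 6 → k}
    (h : (∏ i, linearPoly (u i) (v i)).natDegree = 5 ∨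
      (∏ i, linearPoly (u i) (v i)).natDegree = 6) :
    J10 (∏ i, linearPoly (u i) (v i)) = -minorProd Finset.univ u v := by
  rcases h with h | h
  · have hex : ∃ m, u m = 0 := by
      by_contra! hne
      have := natDegree_prod_linearPoly (s := Finset.univ) v fun i _ => hne i
      rw [h] at this
      simp at this
    obtain ⟨m, hm⟩ := hex
    have huniv : (Finset.univ : Finset (Fin 6)) = insert m (Finset.univ.erase m) := by simp
    have hcard : ((Finset.univ : Finset (Fin 6)).erase m).card = 5 := by simp
    have hvm : v m ≠ 0 := by
      intro h0
      rw [← Finset.mul_prod_erase _ _ (Finset.mem_univ m), linearPoly, hm, h0] at h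
      simp at h
    -- The constant factor is distributed as a fifth root over the five others. Their minors then
    -- gain t⁴⁰ = v_m⁸, and with the squared leading coefficient this accounts for the minors
    -- involving m.
    obtain ⟨t, ht⟩ := IsAlgClosed.exists_pow_nat_eq (v m) (n := 5) (by norm_num)
    have ht0 : t ≠ 0 := by rintro rfl; exact hvm (by rw [← ht]; simp)
    have hprod : ∏ i, linearPoly (u i) (v i) =
        ∏ i ∈ Finset.univ.erase m, linearPoly (t * u i) (t * v i) := by
      rw [← Finset.mul_prod_erase _ _ (Finset.mem_univ m), linearPoly, hm, Polynomial.C_0, zero_mul,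
        zero_add, ← ht, ← hcard, Polynomial.C_pow, ← Finset.prod_const, ← Finset.prod_mul_distrib]
      refine Finset.prod_congr rfl fun i _ => ?_
      simp only [linearPoly, Polynomial.C_mul]
      ring
    have hu : ∀ i ∈ Finset.univ.erase m, t * u i ≠ 0 := by
      refine ne_zero_of_card_le_natDegree (v := fun i => t * v i) ?_
      rw [hcard, ← hprod, h]
    have hlead : (∏ i, linearPoly (u i) (v i)).coeff 5 = v m * ∏ i ∈ Finset.univ.erase m, u i := by
      have := leadingCoeff_prod_linearPoly (fun i => t * v i) hu
      rw [← hprod, Polynomial.leadingCoeff, h] at this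
      rw [this, Finset.prod_mul_distrib, Finset.prod_const, hcard, ht]
    rw [J10, if_neg (by rw [h]; norm_num), hlead, hprod,
      discr_prod_linearPoly (by rw [hcard]; norm_num) hu, minorProd_smul, hcard]
    nth_rw 3 [huniv]
    rw [minorProd_insert (Finset.notMem_erase _ _), Finset.prod_congr rfl
      (fun i _ => show -(u m * v i - u i * v m) ^ 2 = (-v m ^ 2) * (u i ^ 2) by rw [hm]; ring),
      Finset.prod_mul_distrib, Finset.prod_const, hcard, Finset.prod_pow, ← ht]
    norm_num
    ring
  · have hu := ne_zero_of_card_le_natDegree (s := Finset.univ) (u := u) (v := v) (by simp [h])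
    rw [J10, if_pos h, discr_prod_linearPoly (by simp) hu]
    norm_num

end LinearFactors

/-! ### Binary sextics as products of six linear forms -/

section Factorization

open Polynomial (natDegree)

variable {k : Type*} [Field k]

lemma minorProd_ne_zero_iff {ι : Type*} [Fintype ι] [DecidableEq ι] {u v : ι → k} :
    minorProd Finset.univ u v ≠ 0 ↔ ∀ i j, j ≠ i → u i * v j - u j * v i ≠ 0 := by
  simp [minorProd, Finset.prod_ne_zero_iff]

lemma squarefree_linearPoly {u v : k} (h : u ≠ 0 ∨ v ≠ 0) : Squarefree (linearPoly u v) := by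
  by_cases hu : u = 0
  · subst hu
    have hv : v ≠ 0 := by simpa using h
    rw [linearPoly, Polynomial.C_0, zero_mul, zero_add]
    exact (Polynomial.isUnit_C.2 hv.isUnit).squarefree
  · exact (Polynomial.irreducible_of_degree_eq_one (Polynomial.degree_linear hu)).squarefree

lemma isCoprime_linearPoly {u v u' v' : k} (h : u * v' - u' * v ≠ 0) :
    IsCoprime (linearPoly u v) (linearPoly u' v') := by
  refine ⟨Polynomial.C (-(u * v' - u' * v)⁻¹ * u'), Polynomial.C ((u * v' - u' * v)⁻¹ * u), ?_⟩
  have h1 : Polynomial.C ((u * v' - u' * v)⁻¹) * Polynomial.C (u * v' - u' * v) = 1 := by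
    rw [← Polynomial.C_mul, inv_mul_cancel₀ h, Polynomial.C_1]
  rw [← h1]
  simp only [linearPoly, Polynomial.C_mul, Polynomial.C_sub, Polynomial.C_neg]
  ring

/-- A vanishing minor means two proportional forms: either a repeated finite root, against
squarefreeness, or two roots at infinity, against the degree bound. Nonzero minors make the factors
coprime and allow at most one u to vanish. -/
lemma isGenusTwo_prod_linearPoly_iff {u v : Fin 6 → k} :
    IsGenusTwo (∏ i, linearPoly (u i) (v i)) ↔ minorProd Finset.univ u v ≠ 0 := by
  rw [minorProd_ne_zero_iff]
  constructor
  · rintro ⟨hsq, hdeg⟩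
    have hdvd : ∀ i j, j ≠ i → linearPoly (u i) (v i) * linearPoly (u j) (v j) ∣
        ∏ i, linearPoly (u i) (v i) := fun i j hij => by
      rw [← Finset.mul_prod_erase Finset.univ _ (Finset.mem_univ i)]
      exact mul_dvd_mul_left _ (Finset.dvd_prod_of_mem _ (Finset.mem_erase.2 ⟨hij, Finset.mem_univ j⟩))
    have key : ∀ i j, j ≠ i → u i ≠ 0 → u i * v j - u j * v i ≠ 0 := fun i j hij hu h0 => by
      have hL : linearPoly (u j) (v j) = Polynomial.C (u j / u i) * linearPoly (u i) (v i) := by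
        have hv : v j = u j / u i * v i := by field_simp; linear_combination h0
        rw [linearPoly, hv, linearPoly, mul_add, ← mul_assoc, ← Polynomial.C_mul,
          ← Polynomial.C_mul, div_mul_cancel₀ _ hu]
      have hunit := hsq (linearPoly (u i) (v i)) (by
        refine dvd_trans ?_ (hdvd i j hij)
        rw [hL]
        exact mul_dvd_mul_left _ (dvd_mul_left _ _))
      have := Polynomial.natDegree_eq_zero_of_isUnit hunit
      rw [natDegree_linearPoly hu] at this
      omega
    intro i j hij
    by_cases hi : u i = 0
    · by_cases hj : u j = 0
      · exfalso
        have h1 : natDegree (∏ i, linearPoly (u i) (v i)) ≤ 4 := by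
          rw [← Finset.mul_prod_erase Finset.univ _ (Finset.mem_univ i),
            ← Finset.mul_prod_erase (Finset.univ.erase i) _
              (Finset.mem_erase.2 ⟨hij, Finset.mem_univ j⟩), linearPoly, linearPoly, hi, hj,
              Polynomial.C_0, zero_mul, zero_add, zero_add]
          refine (Polynomial.natDegree_C_mul_le _ _).trans
            ((Polynomial.natDegree_C_mul_le _ _).trans
            ((natDegree_prod_linearPoly_le _ _ _).trans ?_))
          rw [Finset.card_erase_of_mem (Finset.mem_erase.2 ⟨hij, Finset.mem_univ j⟩)]
          simp
        omega
      · have := key j i hij.symm hj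
        intro h0
        exact this (by linear_combination -h0)
    · exact key i j hij hi
  · intro h
    refine ⟨?_, ?_⟩
    · refine Finset.squarefree_prod_of_pairwise_isCoprime ?_ ?_
      · intro i _ j _ hij
        exact (isCoprime_linearPoly (h i j hij.symm)).isRelPrime
      · intro i _
        refine squarefree_linearPoly ?_
        by_contra! h0
        obtain ⟨j, hj⟩ := exists_ne i
        exact h i j hj (by rw [h0.1, h0.2]; ring)
    · by_cases hu : ∀ i, u i ≠ 0
      · right
        simpa using natDegree_prod_linearPoly (s := Finset.univ) v fun i _ => hu i
      · left
        push Not at hu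
        obtain ⟨m, hm⟩ := hu
        have hvm : v m ≠ 0 := fun h0 => by
          obtain ⟨j, hj⟩ := exists_ne m
          exact h m j hj (by rw [hm, h0]; ring)
        rw [← Finset.mul_prod_erase Finset.univ _ (Finset.mem_univ m), linearPoly, hm,
          Polynomial.C_0, zero_mul, zero_add, Polynomial.natDegree_C_mul hvm,
          natDegree_prod_linearPoly v]
        · simp
        · intro i hi h0
          exact h m i (Finset.ne_of_mem_erase hi) (by rw [hm, h0]; ring)

lemma exists_prod_linearPoly_aux [IsAlgClosed k] (n : ℕ) : ∀ f : Polynomial k, f.natDegree ≤ n →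
    ∃ (c : k) (u v : Fin n → k), f = Polynomial.C c * ∏ i, linearPoly (u i) (v i) := by
  induction n with
  | zero =>
    intro f hf
    exact ⟨f.coeff 0, Fin.elim0, Fin.elim0, by
      simpa using Polynomial.eq_C_of_natDegree_le_zero hf⟩
  | succ n ih =>
    intro f hf
    by_cases hd : f.degree = 0
    · obtain ⟨c, u, v, hc⟩ := ih f (by
        rw [Polynomial.natDegree_eq_of_degree_eq_some hd]; exact Nat.zero_le _)
      -- A missing degree is padded with the factor 0 · X + 1, a root at infinity.
      refine ⟨c, Fin.cons 0 u, Fin.cons 1 v, ?_⟩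
      rw [Fin.prod_univ_succ]
      simp only [Fin.cons_zero, Fin.cons_succ]
      rw [← mul_assoc, mul_comm (Polynomial.C c), mul_assoc, ← hc]
      simp [linearPoly]
    · obtain ⟨r, hr⟩ := IsAlgClosed.exists_root f hd
      obtain ⟨g, rfl⟩ := Polynomial.dvd_iff_isRoot.2 hr
      by_cases hg : g = 0
      · exact ⟨0, 0, 0, by simp [hg]⟩
      have hdeg : g.natDegree ≤ n := by
        rw [Polynomial.natDegree_mul (Polynomial.X_sub_C_ne_zero r) hg,
          Polynomial.natDegree_X_sub_C] at hf
        omega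
      obtain ⟨c, u, v, hc⟩ := ih g hdeg
      refine ⟨c, Fin.cons 1 u, Fin.cons (-r) v, ?_⟩
      rw [Fin.prod_univ_succ]
      simp only [Fin.cons_zero, Fin.cons_succ]
      rw [hc]
      simp only [linearPoly, Polynomial.C_1, Polynomial.C_neg]
      ring

lemma exists_prod_linearPoly [IsAlgClosed k] {f : Polynomial k} (hf : f.natDegree ≤ 6) :
    ∃ u v : Fin 6 → k, f = ∏ i, linearPoly (u i) (v i) := by
  obtain ⟨c, u, v, h⟩ := exists_prod_linearPoly_aux 6 f hf
  obtain ⟨t, ht⟩ := IsAlgClosed.exists_pow_nat_eq c (n := 6) (by norm_num)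
  refine ⟨fun i => t * u i, fun i => t * v i, ?_⟩
  have h1 : ∀ i, linearPoly (t * u i) (t * v i) = Polynomial.C t * linearPoly (u i) (v i) :=
    fun i => by simp only [linearPoly, Polynomial.C_mul]; ring
  rw [h, Finset.prod_congr rfl fun i _ => h1 i, Finset.prod_mul_distrib, Finset.prod_const,
    ← Polynomial.C_pow]
  simp [ht]

end Factorization

/-! ### Substitutions preserve genus 2 and the absolute invariants -/

section Moves

open Polynomial (natDegree)

variable {k : Type*} [Field k]

lemma isGenusTwo_natDegree_le {f : Polynomial k} (hf : IsGenusTwo f) : f.natDegree ≤ 6 := by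
  rcases hf.2 with h | h <;> omega

lemma absInv_eq_of_weights {f g : Polynomial k} (hJ : J2 f ≠ 0) {w : k} (hw : w ≠ 0)
    (h2 : J2 g = w * J2 f) (h4 : J4 g = w ^ 2 * J4 f) (h6 : J6 g = w ^ 3 * J6 f)
    (h10 : J10 g = w ^ 5 * J10 f) : J2 g ≠ 0 ∧ absInv g = absInv f := by
  refine ⟨by rw [h2]; exact mul_ne_zero hw hJ, ?_⟩
  rw [absInv, absInv, h2, h4, h6, h10]
  congr 1
  · field_simp
  congr 1
  · field_simp
  congr 1
  field_simp

lemma linearPoly_comp (u v a b : k) :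
    (linearPoly u v).comp (Polynomial.C a * Polynomial.X + Polynomial.C b) =
      linearPoly (u * a) (u * b + v) := by
  simp [linearPoly]
  ring

variable [IsAlgClosed k]

lemma J10_eq_neg_minorProd {u v : Fin 6 → k} (h : IsGenusTwo (∏ i, linearPoly (u i) (v i))) :
    J10 (∏ i, linearPoly (u i) (v i)) = -minorProd Finset.univ u v :=
  J10_prod_linearPoly h.2

lemma J10_ne_zero {f : Polynomial k} (hf : IsGenusTwo f) : J10 f ≠ 0 := by
  obtain ⟨u, v, rfl⟩ := exists_prod_linearPoly (isGenusTwo_natDegree_le hf)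
  rw [J10_eq_neg_minorProd hf]
  exact neg_ne_zero.2 (isGenusTwo_prod_linearPoly_iff.1 hf)

/-- A substitution acting on the linear factors by a matrix of determinant `d` preserves genus 2
and multiplies `J₁₀` by `d ^ 30`. -/
lemma isGenusTwo_and_J10_of_minors {f g : Polynomial k} (hf : IsGenusTwo f) {d : k} (hd : d ≠ 0)
    (h : ∀ u v : Fin 6 → k, f = ∏ i, linearPoly (u i) (v i) → ∃ u' v' : Fin 6 → k,
      g = ∏ i, linearPoly (u' i) (v' i) ∧
        ∀ i j, u' i * v' j - u' j * v' i = d * (u i * v j - u j * v i)) :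
    IsGenusTwo g ∧ J10 g = d ^ 30 * J10 f := by
  obtain ⟨u, v, rfl⟩ := exists_prod_linearPoly (isGenusTwo_natDegree_le hf)
  obtain ⟨u', v', rfl, huv⟩ := h u v rfl
  have hm : minorProd Finset.univ u' v' = d ^ 30 * minorProd Finset.univ u v := by
    simp only [minorProd, huv, Finset.prod_mul_distrib, Finset.prod_const]
    rw [Finset.prod_congr rfl fun i _ => by
      rw [Finset.card_erase_of_mem (Finset.mem_univ i)]]
    simp only [Finset.prod_const, Finset.card_univ, Fintype.card_fin, ← pow_mul]
  have hg : IsGenusTwo (∏ i, linearPoly (u' i) (v' i)) := by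
    rw [isGenusTwo_prod_linearPoly_iff, hm]
    exact mul_ne_zero (pow_ne_zero _ hd) (isGenusTwo_prod_linearPoly_iff.1 hf)
  refine ⟨hg, ?_⟩
  rw [J10_eq_neg_minorProd hg, J10_eq_neg_minorProd hf, hm]
  ring

/-- J₂, J₄ and J₆ are followed through the coefficients, J₁₀ through the linear factors, whose
minors do not change under a translation. -/
lemma shift_invariants {f : Polynomial k} (hf : IsGenusTwo f) (hJ : J2 f ≠ 0) (b : k) :
    IsGenusTwo (f.comp (Polynomial.X + Polynomial.C b)) ∧
      J2 (f.comp (Polynomial.X + Polynomial.C b)) ≠ 0 ∧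
      absInv (f.comp (Polynomial.X + Polynomial.C b)) = absInv f := by
  have h10 := isGenusTwo_and_J10_of_minors (g := f.comp (Polynomial.X + Polynomial.C b)) hf
    one_ne_zero (by
      rintro u v rfl
      refine ⟨u, fun i => u i * b + v i, ?_, fun i j => by ring⟩
      rw [Polynomial.prod_comp]
      refine Finset.prod_congr rfl fun i _ => ?_
      simpa using linearPoly_comp (u i) (v i) 1 b)
  refine ⟨h10.1, ?_⟩
  have hc : ∀ i, (f.comp (Polynomial.X + Polynomial.C b)).coeff i =
      ∑ j ∈ Finset.range 7, f.coeff j * (b ^ (j - i) * (j.choose i : k)) := fun i => by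
    nth_rw 1 [f.as_sum_range_C_mul_X_pow' (Nat.lt_succ_of_le (isGenusTwo_natDegree_le hf))]
    rw [Polynomial.sum_comp, Polynomial.finsetSum_coeff]
    refine Finset.sum_congr rfl fun j _ => ?_
    rw [Polynomial.mul_comp, Polynomial.C_comp, Polynomial.pow_comp, Polynomial.X_comp,
      Polynomial.coeff_C_mul, Polynomial.coeff_X_add_C_pow]
  have e0 : _ = _ := hc 0
  have e1 : _ = _ := hc 1
  have e2 : _ = _ := hc 2
  have e3 : _ = _ := hc 3
  have e4 : _ = _ := hc 4
  have e5 : _ = _ := hc 5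
  have e6 : _ = _ := hc 6
  simp only [Finset.sum_range_succ, Finset.sum_range_zero, Nat.choose, Nat.cast_zero, Nat.cast_one,
    mul_zero, add_zero, zero_add] at e0 e1 e2 e3 e4 e5 e6
  norm_num at e0 e1 e2 e3 e4 e5 e6
  refine absInv_eq_of_weights hJ one_ne_zero ?_ ?_ ?_ (by rw [h10.2]; ring)
  · rw [one_mul]
    apply sexticJ2_shift b <;> first | rw [e0] | rw [e1] | rw [e2] | rw [e3] | rw [e4] | rw [e5] | rw [e6]
    all_goals ring
  · rw [one_pow, one_mul]
    apply sexticJ4_shift b <;> first | rw [e0] | rw [e1] | rw [e2] | rw [e3] | rw [e4] | rw [e5] | rw [e6]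
    all_goals ring
  · rw [one_pow, one_mul]
    apply sexticJ6_shift b <;> first | rw [e0] | rw [e1] | rw [e2] | rw [e3] | rw [e4] | rw [e5] | rw [e6]
    all_goals ring

lemma scale_invariants {f : Polynomial k} (hf : IsGenusTwo f) (hJ : J2 f ≠ 0) {c a : k}
    (hc : c ≠ 0) (ha : a ≠ 0) :
    IsGenusTwo (Polynomial.C c * f.comp (Polynomial.C a * Polynomial.X)) ∧
      J2 (Polynomial.C c * f.comp (Polynomial.C a * Polynomial.X)) ≠ 0 ∧
      absInv (Polynomial.C c * f.comp (Polynomial.C a * Polynomial.X)) = absInv f := by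
  -- Spreading c over the six factors multiplies each minor by t²a, so J₁₀ is multiplied by (t²a)³⁰
  -- = (c²a⁶)⁵, the fifth power of the weight of J₂.
  obtain ⟨t, ht⟩ := IsAlgClosed.exists_pow_nat_eq c (n := 6) (by norm_num)
  have ht0 : t ≠ 0 := by rintro rfl; exact hc (by rw [← ht]; simp)
  have h10 := isGenusTwo_and_J10_of_minors
    (g := Polynomial.C c * f.comp (Polynomial.C a * Polynomial.X)) hf
    (d := t ^ 2 * a) (mul_ne_zero (pow_ne_zero _ ht0) ha) (by
      rintro u v rfl
      refine ⟨fun i => t * (u i * a), fun i => t * v i, ?_, fun i j => by ring⟩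
      rw [Polynomial.prod_comp, ← ht, Polynomial.C_pow]
      have h6 : (Polynomial.C t) ^ 6 = ∏ _i : Fin 6, Polynomial.C t := by simp
      rw [h6, ← Finset.prod_mul_distrib]
      refine Finset.prod_congr rfl fun i _ => ?_
      have := linearPoly_comp (u i) (v i) a 0
      rw [Polynomial.C_0, add_zero] at this
      rw [this]
      simp only [linearPoly, Polynomial.C_mul, mul_zero, zero_add]
      ring)
  refine ⟨h10.1, ?_⟩
  have hcoeff : ∀ i, (Polynomial.C c * f.comp (Polynomial.C a * Polynomial.X)).coeff i =
      c * (f.coeff i * a ^ i) := fun i => by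
    rw [Polynomial.coeff_C_mul, Polynomial.comp_C_mul_X_coeff]
  refine absInv_eq_of_weights (w := c ^ 2 * a ^ 6) hJ
    (mul_ne_zero (pow_ne_zero _ hc) (pow_ne_zero _ ha)) ?_ ?_ ?_ ?_
  · exact sexticJ2_scale c a hcoeff
  · rw [J4, sexticJ4_scale c a hcoeff, J4]
    ring
  · rw [J6, sexticJ6_scale c a hcoeff, J6]
    ring
  · rw [h10.2, ← ht]
    ring

lemma reflect_invariants {f : Polynomial k} (hf : IsGenusTwo f) (hJ : J2 f ≠ 0) :
    IsGenusTwo (f.reflect 6) ∧ J2 (f.reflect 6) ≠ 0 ∧ absInv (f.reflect 6) = absInv f := by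
  have hprod : ∀ (s : Finset (Fin 6)) (u v : Fin 6 → k),
      (∏ i ∈ s, linearPoly (u i) (v i)).reflect s.card = ∏ i ∈ s, linearPoly (v i) (u i) := by
    intro s u v
    induction s using Finset.induction_on with
    | empty => simp
    | insert m s hm ih =>
      rw [Finset.prod_insert hm, Finset.prod_insert hm, Finset.card_insert_of_notMem hm, add_comm,
        Polynomial.reflect_mul _ _ (show (linearPoly (u m) (v m)).natDegree ≤ 1 from
          Polynomial.natDegree_linear_le)
          (natDegree_prod_linearPoly_le s u v), ih]
      congr 1
      simp only [linearPoly, Polynomial.reflect_add, Polynomial.reflect_C_mul,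
        Polynomial.reflect_C, pow_one]
      rw [show (Polynomial.X : Polynomial k).reflect 1 = 1 by
        simp]
      rw [mul_one, add_comm]
  have h10 := isGenusTwo_and_J10_of_minors (g := f.reflect 6) hf
    (d := -1) (neg_ne_zero.2 one_ne_zero) (by
      rintro u v rfl
      refine ⟨v, u, ?_, fun i j => by ring⟩
      simpa using hprod Finset.univ u v)
  refine ⟨h10.1, ?_⟩
  have hcoeff : ∀ i ≤ 6, (f.reflect 6).coeff i = f.coeff (6 - i) := fun i hi => by
    rw [Polynomial.coeff_reflect, Polynomial.revAt_le hi]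
  refine absInv_eq_of_weights (w := 1) hJ one_ne_zero ?_ ?_ ?_ ?_
  · rw [J2, sexticJ2_reverse hcoeff, J2, one_mul]
  · rw [J4, sexticJ4_reverse hcoeff, J4]
    ring
  · rw [J6, sexticJ6_reverse hcoeff, J6]
    ring
  · rw [h10.2]
    ring

end Moves

/-! ### Isomorphisms of function fields from equivalences of sextics -/

section Isomorphisms

open Polynomial (natDegree)

variable {k : Type*} [Field k]

section

variable {f : Polynomial k} [hf : Fact (IsGenusTwo f)]

/-- Over an algebraically closed field an algebraic U is a constant, and then the transcendence of X
makes the determinant vanish. -/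
lemma transcendental_of_moebius [IsAlgClosed k] {U : FunctionField f} {α β γ δ : k}
    (hdet : α * δ - β * γ ≠ 0)
    (hU : U * (algebraMap k _ γ * coordX f + algebraMap k _ δ) =
      algebraMap k _ α * coordX f + algebraMap k _ β) : Transcendental k U := by
  intro h
  obtain ⟨u, rfl⟩ := minpoly.mem_range_of_degree_eq_one k U
    (IsAlgClosed.degree_eq_one_of_irreducible k (minpoly.irreducible h.isIntegral))
  obtain ⟨h1, h2⟩ := linear_eq_zero (f := f) (a := u * γ - α) (b := u * δ - β) (by
    simp only [map_sub, map_mul]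
    linear_combination hU)
  exact hdet (by linear_combination γ * h2 - δ * h1)

lemma intermediateField_eq_top {S : IntermediateField k (FunctionField f)} (hX : coordX f ∈ S)
    (hY : coordY f ∈ S) : S = ⊤ := by
  have hp : ∀ p : Polynomial k, Polynomial.aeval (coordX f) p ∈ S := fun p => by
    have := (Polynomial.aeval (⟨coordX f, hX⟩ : S) p).2
    rwa [← IntermediateField.algebraMap_apply, ← Polynomial.aeval_algebraMap_apply] at this
  have hr : ∀ r : RatFunc k, algebraMap (RatFunc k) (FunctionField f) r ∈ S := fun r => by
    rw [← r.num_div_denom, map_div₀, ← aeval_coordX, ← aeval_coordX]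
    exact S.div_mem (hp _) (hp _)
  refine eq_top_iff.2 fun z _ => ?_
  obtain ⟨a, b, rfl⟩ := exists_eq_add_mul_coordY f z
  exact S.add_mem (hr a) (S.mul_mem (hr b) hY)

lemma linear_ne_zero {γ δ : k} (h : γ ≠ 0 ∨ δ ≠ 0) :
    algebraMap k (FunctionField f) γ * coordX f + algebraMap k _ δ ≠ 0 := fun h0 => by
  have := linear_eq_zero h0
  tauto

end

/-- An equivalence of binary sextics up to a square factor induces an isomorphism of function
fields. -/
lemma exists_functionField_algEquiv [IsAlgClosed k] {f g : Polynomial k} (hf : IsGenusTwo f)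
    [hg : Fact (IsGenusTwo g)] {α β γ δ e : k} (hdet : α * δ - β * γ ≠ 0) (he : e ≠ 0)
    (h : sexticForm f (Polynomial.C α * Polynomial.X + Polynomial.C β)
      (Polynomial.C γ * Polynomial.X + Polynomial.C δ) = Polynomial.C (e ^ 2) * g) :
    ∃ φ : FunctionField f ≃ₐ[k] FunctionField g,
      φ (coordX f) * (algebraMap k _ γ * coordX g + algebraMap k _ δ) =
        algebraMap k _ α * coordX g + algebraMap k _ β ∧
      φ (coordY f) * (algebraMap k _ γ * coordX g + algebraMap k _ δ) ^ 3 =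
        algebraMap k _ e * coordY g := by
  have : Fact (IsGenusTwo f) := ⟨hf⟩
  set D := algebraMap k (FunctionField g) γ * coordX g + algebraMap k _ δ with hD
  set N := algebraMap k (FunctionField g) α * coordX g + algebraMap k _ β with hN
  have hD0 : D ≠ 0 := linear_ne_zero (by
    by_contra! h0
    exact hdet (by rw [h0.1, h0.2]; ring))
  have he0 : algebraMap k (FunctionField g) e ≠ 0 := (map_ne_zero _).2 he
  have hU : N / D * D = N := div_mul_cancel₀ _ hD0
  have hV : algebraMap k _ e * coordY g / D ^ 3 * D ^ 3 = algebraMap k _ e * coordY g :=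
    div_mul_cancel₀ _ (pow_ne_zero 3 hD0)
  have haD : Polynomial.aeval (coordX g) (Polynomial.C γ * Polynomial.X + Polynomial.C δ) = D := by
    simp [hD]
  have haN : Polynomial.aeval (coordX g) (Polynomial.C α * Polynomial.X + Polynomial.C β) = N := by
    simp [hN]
  have hpt : (algebraMap k _ e * coordY g / D ^ 3) ^ 2 = Polynomial.aeval (N / D) f := by
    have h1 := aeval_sexticForm (isGenusTwo_natDegree_le hf)
      (Polynomial.C α * Polynomial.X + Polynomial.C β)
      (Polynomial.C γ * Polynomial.X + Polynomial.C δ) (x := coordX g) (u := N / D)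
      (by rw [haD, haN, hU])
    rw [h, haD, map_mul, Polynomial.aeval_C, map_pow, ← coordY_sq] at h1
    field_simp
    linear_combination h1
  have htr := transcendental_of_moebius hdet hU
  set φ := liftPoint (N / D) _ htr hpt with hφ
  have hφX : φ (coordX f) = N / D := liftPoint_coordX _ _ _ _
  have hφY : φ (coordY f) = algebraMap k _ e * coordY g / D ^ 3 := liftPoint_coordY _ _ _ _
  -- The image is a subfield. Inverting the Möbius transformation puts X in it, and then the formula
  -- for the image of Y puts Y in it.
  have hsurj : Function.Surjective φ := by
    have hmU : N / D ∈ φ.fieldRange := ⟨coordX f, hφX⟩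
    have hmV : algebraMap k _ e * coordY g / D ^ 3 ∈ φ.fieldRange := ⟨coordY f, hφY⟩
    have hne : algebraMap k (FunctionField g) α - algebraMap k _ γ * (N / D) ≠ 0 := by
      intro h0
      have h1 : algebraMap k (FunctionField g) (α * δ - β * γ) = 0 := by
        simp only [map_sub, map_mul]
        linear_combination D * h0 - algebraMap k _ γ * hN + algebraMap k _ α * hD
          + algebraMap k _ γ * hU
      exact hdet ((map_eq_zero _).1 h1)
    have hmX : coordX g ∈ φ.fieldRange := by
      have h1 : coordX g = (algebraMap k _ δ * (N / D) - algebraMap k _ β) /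
          (algebraMap k _ α - algebraMap k _ γ * (N / D)) := by
        rw [eq_div_iff hne]
        linear_combination -hU + (N / D) * hD - hN
      rw [h1]
      exact div_mem (sub_mem (mul_mem (φ.fieldRange.algebraMap_mem _) hmU)
        (φ.fieldRange.algebraMap_mem _)) (sub_mem (φ.fieldRange.algebraMap_mem _)
        (mul_mem (φ.fieldRange.algebraMap_mem _) hmU))
    have hmY : coordY g ∈ φ.fieldRange := by
      have h1 : coordY g = algebraMap k _ e * coordY g / D ^ 3 * D ^ 3 / algebraMap k _ e := by
        rw [hV, mul_div_cancel_left₀ _ he0]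
      rw [h1]
      exact div_mem (mul_mem hmV (pow_mem (add_mem (mul_mem (φ.fieldRange.algebraMap_mem _) hmX)
        (φ.fieldRange.algebraMap_mem _)) 3)) (φ.fieldRange.algebraMap_mem _)
    intro z
    have hz : z ∈ φ.fieldRange := by
      rw [intermediateField_eq_top hmX hmY]
      trivial
    exact hz
  refine ⟨AlgEquiv.ofBijective φ ⟨φ.injective, hsurj⟩, ?_, ?_⟩
  · change φ (coordX f) * D = N
    rw [hφX, hU]
  · change φ (coordY f) * D ^ 3 = _
    rw [hφY, hV]

variable {f : Polynomial k} [hf : Fact (IsGenusTwo f)]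

lemma curveAut_ext {σ τ : CurveAut f} (hX : σ (coordX f) = τ (coordX f))
    (hY : σ (coordY f) = τ (coordY f)) : σ = τ :=
  AlgEquiv.ext fun z => DFunLike.congr_fun
    (functionField_algHom_ext (φ := σ.toAlgHom) (ψ := τ.toAlgHom) hX hY) z

lemma apply_algebraMap_of_apply_coordX {σ : CurveAut f} (h : σ (coordX f) = coordX f)
    (r : RatFunc k) : σ (algebraMap _ _ r) = algebraMap _ _ r := by
  rw [← r.num_div_denom, map_div₀, map_div₀, ← aeval_coordX, ← aeval_coordX, apply_aeval_coordX,
    apply_aeval_coordX, h]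

lemma coordY_eq_or_eq_neg {σ : CurveAut f} (h : σ (coordX f) = coordX f) :
    σ (coordY f) = coordY f ∨ σ (coordY f) = -coordY f := by
  rw [← sq_eq_sq_iff_eq_or_eq_neg, ← map_pow, coordY_sq, apply_aeval_coordX, h]

lemma sexticForm_X_one {f : Polynomial k} (h : f.natDegree ≤ 6) :
    sexticForm f Polynomial.X 1 = f := by
  conv_rhs => rw [f.as_sum_range_C_mul_X_pow' (Nat.lt_succ_of_le h)]
  simp [sexticForm]

/-- The hyperelliptic involution. -/
lemma exists_hyperelliptic [IsAlgClosed k] [CharZero k] : ∃ ι : CurveAut f,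
    ι (coordX f) = coordX f ∧ ι (coordY f) = -coordY f ∧ ι ≠ 1 ∧ ι * ι = 1 ∧
      (∀ σ, ι * σ = σ * ι) ∧ ∀ σ : CurveAut f, σ (coordX f) = coordX f → σ = 1 ∨ σ = ι := by
  obtain ⟨ι, hX, hY⟩ := exists_functionField_algEquiv (f := f) (g := f) hf.out
    (α := 1) (β := 0) (γ := 0) (δ := 1) (e := -1) (by simp) (by simp) (by
      simp [sexticForm_X_one (isGenusTwo_natDegree_le hf.out)])
  simp only [map_one, map_zero, zero_mul, zero_add, mul_one, one_mul, add_zero, one_pow,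
    map_neg, neg_mul] at hX hY
  refine ⟨ι, hX, hY, ?_, ?_, fun σ => ?_, fun σ hσ => ?_⟩
  · rintro rfl
    have h2 : (2 : FunctionField f) * coordY f = 0 := by
      rw [AlgEquiv.one_apply] at hY
      linear_combination hY
    have : CharZero (FunctionField f) := charZero_of_injective_algebraMap
      (algebraMap k (FunctionField f)).injective
    exact coordY_ne_zero (by simpa using h2)
  · refine curveAut_ext ?_ ?_
    · rw [AlgEquiv.mul_apply, hX, hX, AlgEquiv.one_apply]
    · rw [AlgEquiv.mul_apply, hY, map_neg, hY, neg_neg, AlgEquiv.one_apply]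
  · obtain ⟨r, hr⟩ := exists_apply_coordX_eq σ
    obtain ⟨b, -, hb⟩ := exists_apply_coordY σ
    refine curveAut_ext ?_ ?_
    · rw [AlgEquiv.mul_apply, AlgEquiv.mul_apply, hX, hr, apply_algebraMap_of_apply_coordX hX]
    · rw [AlgEquiv.mul_apply, AlgEquiv.mul_apply, hY, map_neg, hb, map_mul, hY,
        apply_algebraMap_of_apply_coordX hX, mul_neg]
  · rcases coordY_eq_or_eq_neg hσ with h | h
    · exact .inl (curveAut_ext hσ h)
    · exact .inr (curveAut_ext (hσ.trans hX.symm) (h.trans hY.symm))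

end Isomorphisms

/-! ### Diagonalizing automorphisms of finite order -/

section Diagonalization

open Polynomial (natDegree)

variable {k : Type*} [Field k]

/-- The curve `Y ^ 2 = f(X)` has genus 2, nonvanishing `J₂` and absolute invariants `p`. -/
def HasPoint (p : Fin 3 → k) (f : Polynomial k) : Prop :=
  IsGenusTwo f ∧ J2 f ≠ 0 ∧ absInv f = p

lemma sexticForm_one {f : Polynomial k} (h : f.natDegree ≤ 6) (p : Polynomial k) :
    sexticForm f p 1 = f.comp p := by
  conv_rhs => rw [f.as_sum_range_C_mul_X_pow' (Nat.lt_succ_of_le h)]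
  simp [sexticForm]

lemma sexticForm_one_X {f : Polynomial k} (h : f.natDegree ≤ 6) :
    sexticForm f 1 Polynomial.X = f.reflect 6 := by
  ext i
  rw [sexticForm, Polynomial.finsetSum_coeff, Polynomial.coeff_reflect]
  simp only [one_pow, mul_one, Polynomial.coeff_C_mul, Polynomial.coeff_X_pow]
  by_cases hi : i ≤ 6
  · rw [Polynomial.revAt_le hi, Finset.sum_eq_single_of_mem (6 - i) (by simp; omega)]
    · rw [if_pos (by omega), mul_one]
    · intro j hj hne
      rw [Finset.mem_range] at hj
      rw [if_neg (by omega), mul_zero]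
  · rw [Polynomial.revAt_eq_self_of_lt (by omega), Polynomial.coeff_eq_zero_of_natDegree_lt
      (by omega)]
    refine Finset.sum_eq_zero fun j hj => ?_
    rw [if_neg (by omega), mul_zero]

lemma autCongr_apply_apply {A B : Type*} [Ring A] [Ring B] [Algebra k A] [Algebra k B]
    (φ : A ≃ₐ[k] B) (σ : A ≃ₐ[k] A) (z : B) : φ.autCongr σ z = φ (σ (φ.symm z)) := rfl

lemma autCongr_trans_apply {A B C : Type*} [Ring A] [Ring B] [Ring C] [Algebra k A] [Algebra k B]
    [Algebra k C] (φ : A ≃ₐ[k] B) (ψ : B ≃ₐ[k] C) (σ : A ≃ₐ[k] A) :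
    (φ.trans ψ).autCongr σ = ψ.autCongr (φ.autCongr σ) := rfl

/-- A Möbius transformation fixing q becomes affine in the coordinate 1 / (X - q), which sends q to
infinity. -/
lemma apply_inv_sub_fixed_point {f : Polynomial k} {σ : CurveAut f} [hf : Fact (IsGenusTwo f)] {α β γ δ q : k}
    (hγ : γ ≠ 0) (hroot : γ * q ^ 2 + (δ - α) * q - β = 0)
    (hX : σ (coordX f) * (algebraMap k _ γ * coordX f + algebraMap k _ δ) =
      algebraMap k _ α * coordX f + algebraMap k _ β) :
    σ (coordX f - algebraMap k _ q)⁻¹ = algebraMap k _ ((γ * q + δ) / (α - γ * q)) *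
        (coordX f - algebraMap k _ q)⁻¹ + algebraMap k _ (γ / (α - γ * q)) := by
  have hroot' := congrArg (algebraMap k (FunctionField f)) hroot
  simp only [map_add, map_sub, map_mul, map_pow, map_zero] at hroot'
  have hW : coordX f - algebraMap k _ q ≠ 0 := fun h0 =>
    one_ne_zero (linear_eq_zero (f := f) (a := 1) (b := -q) (by
      rw [map_one, one_mul, map_neg, ← sub_eq_add_neg, h0])).1
  have hσW : σ (coordX f - algebraMap k _ q) ≠ 0 := (map_ne_zero_iff _ σ.injective).2 hW
  have h3 : σ (coordX f - algebraMap k _ q) * (algebraMap k _ γ * (coordX f - algebraMap k _ q)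
      + algebraMap k _ (γ * q + δ)) = algebraMap k _ (α - γ * q) *
        (coordX f - algebraMap k _ q) := by
    simp only [map_sub, map_add, map_mul, AlgEquiv.commutes]
    linear_combination hX - hroot'
  have hne : algebraMap k (FunctionField f) (α - γ * q) ≠ 0 := by
    intro h0
    rw [h0, zero_mul] at h3
    have h4 := (mul_eq_zero.1 h3).resolve_left hσW
    refine hγ (linear_eq_zero (f := f) (a := γ) (b := δ) ?_).1
    simp only [map_add, map_mul] at h4
    linear_combination h4
  rw [map_inv₀, map_div₀, map_div₀]
  generalize σ (coordX f - algebraMap k _ q) = S at *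
  generalize coordX f - algebraMap k _ q = W at *
  generalize algebraMap k (FunctionField f) (α - γ * q) = E at *
  generalize algebraMap k (FunctionField f) (γ * q + δ) = F at *
  field_simp
  linear_combination -h3

variable [IsAlgClosed k] {f : Polynomial k} {p : Fin 3 → k}

lemma HasPoint.exists_shift (h : HasPoint p f) (b : k) : ∃ g, HasPoint p g ∧
    ∃ φ : FunctionField f ≃ₐ[k] FunctionField g,
      φ (coordX f) = coordX g + algebraMap k _ b := by
  obtain ⟨hf, hJ, rfl⟩ := h
  obtain ⟨hg, h2, hi⟩ := shift_invariants hf hJ b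
  have : Fact (IsGenusTwo (f.comp (Polynomial.X + Polynomial.C b))) := ⟨hg⟩
  obtain ⟨φ, hφ, -⟩ := exists_functionField_algEquiv hf
    (g := f.comp (Polynomial.X + Polynomial.C b)) (α := 1) (β := b) (γ := 0) (δ := 1) (e := 1)
    (by simp) one_ne_zero (by simp [sexticForm_one (isGenusTwo_natDegree_le hf)])
  exact ⟨_, ⟨hg, h2, hi⟩, φ, by simpa using hφ⟩

lemma HasPoint.exists_reflect (h : HasPoint p f) : ∃ g, HasPoint p g ∧
    ∃ φ : FunctionField f ≃ₐ[k] FunctionField g, φ (coordX f) * coordX g = 1 := by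
  obtain ⟨hf, hJ, rfl⟩ := h
  obtain ⟨hg, h2, hi⟩ := reflect_invariants hf hJ
  have : Fact (IsGenusTwo (f.reflect 6)) := ⟨hg⟩
  obtain ⟨φ, hφ, -⟩ := exists_functionField_algEquiv hf
    (g := f.reflect 6) (α := 0) (β := 1) (γ := 1) (δ := 0) (e := 1)
    (by simp) one_ne_zero (by simp [sexticForm_one_X (isGenusTwo_natDegree_le hf)])
  exact ⟨_, ⟨hg, h2, hi⟩, φ, by simpa using hφ⟩

lemma HasPoint.scale (h : HasPoint p f) {c a : k} (hc : c ≠ 0) (ha : a ≠ 0) :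
    HasPoint p (Polynomial.C c * f.comp (Polynomial.C a * Polynomial.X)) ∧
      Nonempty (CurveAut f ≃* CurveAut (Polynomial.C c * f.comp (Polynomial.C a * Polynomial.X))) := by
  obtain ⟨hf, hJ, rfl⟩ := h
  obtain ⟨hg, h2, hi⟩ := scale_invariants hf hJ hc ha
  have := Fact.mk hg
  obtain ⟨s, rfl⟩ := IsAlgClosed.exists_pow_nat_eq c (n := 2) (by norm_num)
  have hs : s ≠ 0 := by rintro rfl; simp at hc
  obtain ⟨φ, -⟩ := exists_functionField_algEquiv hf
    (g := Polynomial.C (s ^ 2) * f.comp (Polynomial.C a * Polynomial.X))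
    (α := a) (β := 0) (γ := 0) (δ := 1) (e := s⁻¹) (by simpa) (inv_ne_zero hs) (by
      rw [← mul_assoc, ← Polynomial.C_mul, ← mul_pow, inv_mul_cancel₀ hs]
      simp [sexticForm_one (isGenusTwo_natDegree_le hf)])
  exact ⟨⟨hg, h2, hi⟩, ⟨φ.autCongr⟩⟩

variable [CharZero k]

/-- A translation of finite order is trivial in characteristic 0. Any other affine map has a finite
fixed point, and moving it to the origin leaves a scaling. -/
lemma exists_diagonal_of_affine (h : HasPoint p f) {σ : CurveAut f} {n : ℕ} (hn : n ≠ 0)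
    (hσ : σ ^ n = 1) {u w : k} (hX : σ (coordX f) = algebraMap k _ u * coordX f + algebraMap k _ w) :
    ∃ g, HasPoint p g ∧ ∃ φ : FunctionField f ≃ₐ[k] FunctionField g, ∃ a : k,
      φ.autCongr σ (coordX g) = algebraMap k _ a * coordX g := by
  by_cases hu : u = 1
  · subst hu
    have := Fact.mk h.1
    have hm : ∀ m : ℕ, (σ ^ m) (coordX f) = coordX f + algebraMap k _ (m * w) := by
      intro m
      induction m with
      | zero => simp
      | succ m ih =>
        rw [pow_succ σ m, AlgEquiv.mul_apply, hX, map_add, map_mul, AlgEquiv.commutes,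
          AlgEquiv.commutes, ih]
        simp only [map_one, map_mul, map_natCast, Nat.cast_succ, map_add]
        ring
    have hw : w = 0 := by
      have h1 := hm n
      rw [hσ, AlgEquiv.one_apply, left_eq_add, map_eq_zero] at h1
      simpa [hn] using h1
    exact ⟨f, h, AlgEquiv.refl, 1, by simpa [hw, AlgEquiv.autCongr] using hX⟩
  · have hu' : 1 - u ≠ 0 := sub_ne_zero.2 (Ne.symm hu)
    -- w / (1 - u) is the fixed point of X ↦ uX + w.
    obtain ⟨g, hg, φ, hφ⟩ := h.exists_shift (w / (1 - u))
    refine ⟨g, hg, φ, u, ?_⟩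
    have h1 : φ.symm (coordX g) = coordX f - algebraMap k _ (w / (1 - u)) := by
      rw [AlgEquiv.symm_apply_eq, map_sub, hφ, AlgEquiv.commutes, add_sub_cancel_right]
    have h2 : algebraMap k (FunctionField g) w = algebraMap k _ (w / (1 - u)) -
        algebraMap k _ u * algebraMap k _ (w / (1 - u)) := by
      rw [← map_mul, ← map_sub]
      congr 1
      field_simp
    rw [autCongr_apply_apply, h1]
    simp only [map_sub, hX, map_add, map_mul, AlgEquiv.commutes, hφ]
    linear_combination h2

lemma exists_fixed_point {α β γ δ : k} (hγ : γ ≠ 0) :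
    ∃ q : k, γ * q ^ 2 + (δ - α) * q - β = 0 := by
  obtain ⟨d, hd⟩ := IsAlgClosed.exists_pow_nat_eq ((δ - α) ^ 2 + 4 * γ * β) (n := 2) (by norm_num)
  refine ⟨(α - δ + d) / (2 * γ), ?_⟩
  field_simp
  linear_combination hd

/-- After a coordinate change, an automorphism of finite order scales `X`. -/
lemma exists_diagonal (h : HasPoint p f) {σ : CurveAut f} {n : ℕ} (hn : n ≠ 0)
    (hσ : σ ^ n = 1) :
    ∃ g, HasPoint p g ∧ ∃ φ : FunctionField f ≃ₐ[k] FunctionField g, ∃ a : k,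
      φ.autCongr σ (coordX g) = algebraMap k _ a * coordX g := by
  have := Fact.mk h.1
  obtain ⟨α, β, γ, δ, hdet, hX⟩ := exists_moebius σ
  by_cases hγ : γ = 0
  · have hδ : δ ≠ 0 := by rintro rfl; simp [hγ] at hdet
    have hδ' : algebraMap k (FunctionField f) δ ≠ 0 := (map_ne_zero _).2 hδ
    refine exists_diagonal_of_affine h hn hσ (u := α / δ) (w := β / δ) ?_
    rw [hγ, map_zero, zero_mul, zero_add] at hX
    rw [map_div₀, map_div₀, div_mul_eq_mul_div, ← add_div, eq_div_iff hδ', hX]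
  -- When γ ≠ 0, a fixed point q is sent to infinity by a translation followed by the reversal; in
  -- the new coordinate the automorphism is affine.
  · obtain ⟨q, hroot⟩ := exists_fixed_point (α := α) (β := β) (δ := δ) hγ
    obtain ⟨g₁, hg₁, φ₁, hφ₁⟩ := h.exists_shift q
    obtain ⟨g, hg, φ₂, hφ₂⟩ := hg₁.exists_reflect
    have := Fact.mk hg₁.1
    have := Fact.mk hg.1
    have h1 : φ₁.trans φ₂ (coordX f - algebraMap k _ q)⁻¹ = coordX g := by
      rw [AlgEquiv.trans_apply, map_inv₀, map_inv₀, map_sub, AlgEquiv.commutes, hφ₁,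
        add_sub_cancel_right, eq_inv_of_mul_eq_one_left hφ₂, inv_inv]
    obtain ⟨g', hg', ψ, a, ha⟩ := exists_diagonal_of_affine hg (σ := (φ₁.trans φ₂).autCongr σ) hn
      (by rw [← map_pow, hσ, map_one]) (u := (γ * q + δ) / (α - γ * q)) (w := γ / (α - γ * q)) (by
        rw [autCongr_apply_apply, ← h1, AlgEquiv.symm_apply_apply, apply_inv_sub_fixed_point hγ hroot hX, map_add, map_mul,
          AlgEquiv.commutes, AlgEquiv.commutes])
    refine ⟨g', hg', (φ₁.trans φ₂).trans ψ, a, ?_⟩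
    rw [autCongr_trans_apply, ha]

end Diagonalization

/-! ### Normal forms for curves with D₄ or D₆ symmetry -/

section NormalForms

open Polynomial (natDegree)

variable {k : Type*} [Field k]

lemma coeff_zero_or_coeff_one_ne_zero {f : Polynomial k} (hf : IsGenusTwo f) :
    f.coeff 0 ≠ 0 ∨ f.coeff 1 ≠ 0 := by
  by_contra! h
  have h2 : Polynomial.X * Polynomial.X ∣ f := by
    rw [← sq, Polynomial.X_pow_dvd_iff]
    intro d hd
    interval_cases d
    exacts [h.1, h.2]
  exact Polynomial.not_isUnit_X (hf.1 _ h2)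

lemma coeff_five_or_coeff_six_ne_zero {f : Polynomial k} (hf : IsGenusTwo f) :
    f.coeff 5 ≠ 0 ∨ f.coeff 6 ≠ 0 := by
  have h := Polynomial.leadingCoeff_ne_zero.2 hf.1.ne_zero
  rw [Polynomial.leadingCoeff] at h
  rcases hf.2 with h' | h' <;> rw [h'] at h
  exacts [.inl h, .inr h]

lemma apply_coordY_of_scaling [CharZero k] {f : Polynomial k} [hf : Fact (IsGenusTwo f)]
    {σ : CurveAut f} {a : k} (h : σ (coordX f) = algebraMap k _ a * coordX f) :
    ∃ e : k, e ≠ 0 ∧ σ (coordY f) = algebraMap k _ e * coordY f ∧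
      ∀ i, f.coeff i * a ^ i = e ^ 2 * f.coeff i := by
  obtain ⟨e, he, hY, hform⟩ := exists_moebius_coordY σ (α := a) (β := 0) (γ := 0) (δ := 1)
    (by simpa using h) (.inr one_ne_zero)
  refine ⟨e, he, by simpa using hY, fun i => ?_⟩
  simp only [Polynomial.C_0, Polynomial.C_1, zero_mul, zero_add, add_zero,
    sexticForm_one (isGenusTwo_natDegree_le hf.out)] at hform
  have := congrArg (Polynomial.coeff · i) hform
  simpa only [Polynomial.comp_C_mul_X_coeff, Polynomial.coeff_C_mul] using this

lemma pow_apply_of_scaling {f : Polynomial k} {σ : CurveAut f} {a : k} {t : FunctionField f}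
    (h : σ t = algebraMap k _ a * t) (n : ℕ) : (σ ^ n) t = algebraMap k _ (a ^ n) * t := by
  induction n with
  | zero => simp
  | succ n ih =>
    rw [pow_succ σ n, AlgEquiv.mul_apply, h, map_mul, AlgEquiv.commutes, ih, pow_succ a n, map_mul]
    ring

lemma pow_eq_one_of_scaling {f : Polynomial k} [Fact (IsGenusTwo f)] {σ : CurveAut f} {a : k}
    {t : FunctionField f} (ht : t ≠ 0) (h : σ t = algebraMap k _ a * t) {n : ℕ} (hn : σ ^ n = 1) :
    a ^ n = 1 := by
  have h1 := pow_apply_of_scaling h n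
  rw [hn, AlgEquiv.one_apply, eq_comm, mul_eq_right₀ ht] at h1
  exact (algebraMap k (FunctionField f)).injective (h1.trans (map_one _).symm)

lemma coordX_ne_zero {f : Polynomial k} [Fact (IsGenusTwo f)] : coordX f ≠ 0 := fun h =>
  one_ne_zero (linear_eq_zero (f := f) (a := 1) (b := 0) (by simp [h])).1

lemma dihedralGroup_four_center : ∀ z : DihedralGroup 4, z ≠ 1 → (∀ g, z * g = g * z) →
    z = .r 1 ^ 2 := by decide

/-- The central element z is the image of the hyperelliptic involution. The trichotomy serves to
exclude the extra automorphism of X⁶ + 1. -/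
lemma dihedralGroup_six_center : ∀ z : DihedralGroup 6, z ≠ 1 → (∀ g, z * g = g * z) →
    ∀ g : DihedralGroup 6, g ^ 2 = 1 ∨ g ^ 3 = 1 ∨ g ^ 3 = z := by decide

variable [IsAlgClosed k] [CharZero k] {f : Polynomial k} {p : Fin 3 → k}

/-- The sextic form with dihedral symmetry of order 8. -/
abbrev quinticD4 (s : k) : Polynomial k :=
  Polynomial.X ^ 5 + Polynomial.C s * Polynomial.X ^ 3 + Polynomial.X

/-- The sextic form with dihedral symmetry of order 12. -/
abbrev sexticD6 (b : k) : Polynomial k :=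
  Polynomial.X ^ 6 + Polynomial.C b * Polynomial.X ^ 3 + 1

/-- The rotation σ of order 4 squares to the nontrivial central element, so σ² is the hyperelliptic
involution. After diagonalization σ is X ↦ -X, Y ↦ cY with c² = -1, which kills the even
coefficients; those of X and X⁵ are nonzero and can be scaled to 1. -/
lemma exists_quinticD4 (h : HasPoint p f) (e : CurveAut f ≃* DihedralGroup 4) :
    ∃ s : k, HasPoint p (quinticD4 s) ∧ Nonempty (CurveAut (quinticD4 s) ≃* DihedralGroup 4) := by
  obtain ⟨g, hg, φ, a, ha⟩ := exists_diagonal h (σ := e.symm (.r 1)) (n := 4) (by norm_num)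
    (by rw [← map_pow, ← map_one e.symm]; congr 1)
  have := Fact.mk hg.1
  set e' : CurveAut g ≃* DihedralGroup 4 := φ.autCongr.symm.trans e with he'
  set σ := φ.autCongr (e.symm (.r 1)) with hσ
  have heσ : e' σ = .r 1 := by
    rw [he', hσ, MulEquiv.trans_apply, MulEquiv.symm_apply_apply, MulEquiv.apply_symm_apply]
  obtain ⟨ι, hιX, hιY, hι1, hι2, hιc, hι⟩ := exists_hyperelliptic (f := g)
  have hσι : σ ^ 2 = ι := by
    apply e'.injective
    rw [map_pow, heσ]
    refine (dihedralGroup_four_center (e' ι) (by simpa using hι1) fun x => ?_).symm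
    obtain ⟨y, rfl⟩ := e'.surjective x
    rw [← map_mul, ← map_mul, hιc]
  have ha2 : a ^ 2 = 1 := by
    have h1 := pow_apply_of_scaling ha 2
    rw [hσι, hιX, eq_comm, mul_eq_right₀ coordX_ne_zero] at h1
    exact (algebraMap k (FunctionField g)).injective (h1.trans (map_one _).symm)
  have ha1 : a = -1 := by
    refine (sq_eq_sq_iff_eq_or_eq_neg.1 (ha2.trans (one_pow 2).symm)).resolve_left ?_
    rintro rfl
    rw [map_one, one_mul] at ha
    rcases hι σ ha with h1 | h1
    · exact hι1 (by rw [← hσι, h1, one_pow])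
    · rw [h1, sq ι, hι2] at hσι
      exact hι1 hσι.symm
  obtain ⟨c, hc, hcY, hcoeff⟩ := apply_coordY_of_scaling ha
  have hc2 : c ^ 2 = -1 := by
    have h1 := pow_apply_of_scaling hcY 2
    rw [hσι, hιY, eq_comm, ← neg_one_mul, mul_left_inj' coordY_ne_zero] at h1
    exact (algebraMap k (FunctionField g)).injective (h1.trans (by simp))
  have heven : ∀ i, Even i → g.coeff i = 0 := fun i hi => by
    have h1 := hcoeff i
    rw [ha1, hi.neg_one_pow, hc2, mul_one, neg_one_mul, eq_neg_iff_add_eq_zero, ← two_mul] at h1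
    simpa using h1
  have h5 : g.coeff 5 ≠ 0 := (coeff_five_or_coeff_six_ne_zero hg.1).resolve_right
    (not_not.2 (heven 6 (by decide)))
  have h1 : g.coeff 1 ≠ 0 := (coeff_zero_or_coeff_one_ne_zero hg.1).resolve_left
    (not_not.2 (heven 0 (by decide)))
  obtain ⟨t, ht⟩ := IsAlgClosed.exists_pow_nat_eq (g.coeff 1 / g.coeff 5) (n := 4) (by norm_num)
  have ht0 : t ≠ 0 := by
    rintro rfl
    rw [zero_pow (by norm_num), eq_comm, div_eq_zero_iff] at ht
    tauto
  have hc0 : (t * g.coeff 1)⁻¹ ≠ 0 := inv_ne_zero (mul_ne_zero ht0 h1)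
  obtain ⟨hp, ⟨ψ⟩⟩ := hg.scale hc0 ht0
  have hform : Polynomial.C (t * g.coeff 1)⁻¹ * g.comp (Polynomial.C t * Polynomial.X) =
      quinticD4 ((t * g.coeff 1)⁻¹ * (g.coeff 3 * t ^ 3)) := by
    have h15 : (t * g.coeff 1)⁻¹ * (g.coeff 5 * t ^ 5) = 1 := by
      field_simp at ht ⊢
      linear_combination ht
    have h11 : (t * g.coeff 1)⁻¹ * (g.coeff 1 * t) = 1 := by field_simp
    have hdeg := isGenusTwo_natDegree_le hg.1
    ext i
    rw [Polynomial.coeff_C_mul, Polynomial.comp_C_mul_X_coeff]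
    simp only [Polynomial.coeff_add, Polynomial.coeff_X_pow, Polynomial.coeff_C_mul,
      Polynomial.coeff_X]
    by_cases hi : i ≤ 6
    · interval_cases i <;> simp [heven _ (by decide : Even 0), heven _ (by decide : Even 2),
        heven _ (by decide : Even 4), heven _ (by decide : Even 6)]
      · field_simp
      · simpa using h15
    · rw [Polynomial.coeff_eq_zero_of_natDegree_lt (hdeg.trans_lt (not_le.1 hi)),
        if_neg (by omega), if_neg (by omega),
        if_neg (by omega)]
      simp
  rw [hform] at hp ψ
  exact ⟨_, hp, ⟨ψ.symm.trans e'⟩⟩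

/-- A rotation of order 3 becomes X ↦ aX, Y ↦ cY with a a primitive cube root of unity, and only
exponents i with aⁱ = c² survive. Genus 2 forces these to be 0, 3 and 6. -/
lemma exists_sexticD6 (h : HasPoint p f) (e : CurveAut f ≃* DihedralGroup 6) :
    ∃ b : k, HasPoint p (sexticD6 b) ∧ Nonempty (CurveAut (sexticD6 b) ≃* DihedralGroup 6) := by
  have hr : (DihedralGroup.r 2 : DihedralGroup 6) ^ 3 = 1 := by decide
  obtain ⟨g, hg, φ, a, ha⟩ := exists_diagonal h (σ := e.symm (.r 2)) (n := 3) (by norm_num)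
    (by rw [← map_pow, hr, map_one])
  have := Fact.mk hg.1
  set e' : CurveAut g ≃* DihedralGroup 6 := φ.autCongr.symm.trans e with he'
  set σ := φ.autCongr (e.symm (.r 2)) with hσ
  have heσ : e' σ = .r 2 := by
    rw [he', hσ, MulEquiv.trans_apply, MulEquiv.symm_apply_apply, MulEquiv.apply_symm_apply]
  have hσ3 : σ ^ 3 = 1 := e'.injective (by rw [map_pow, heσ, hr, map_one])
  have hσ1 : σ ≠ 1 := by
    intro h1
    rw [h1, map_one] at heσ
    exact absurd heσ (by decide)
  obtain ⟨ι, hιX, hιY, hι1, hι2, hιc, hι⟩ := exists_hyperelliptic (f := g)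
  have ha3 : a ^ 3 = 1 := pow_eq_one_of_scaling coordX_ne_zero ha hσ3
  have ha1 : a ≠ 1 := by
    rintro rfl
    rw [map_one, one_mul] at ha
    rcases hι σ ha with h1 | h1
    · exact hσ1 h1
    · rw [h1, pow_succ ι 2, sq ι, hι2, one_mul] at hσ3
      exact hι1 hσ3
  have ha2 : a ^ 2 ≠ 1 := fun h2 => ha1 (by rw [pow_succ, h2, one_mul] at ha3; exact ha3)
  have ha0 : a ≠ 0 := by rintro rfl; simp at ha3
  obtain ⟨c, hc, hcY, hcoeff⟩ := apply_coordY_of_scaling ha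
  have hcoeff' : ∀ i, a ^ i ≠ c ^ 2 → g.coeff i = 0 := fun i hi => by
    by_contra h0
    have h1 := hcoeff i
    rw [mul_comm, mul_left_inj' h0] at h1
    exact hi h1
  have ha4 : a ^ 4 = a := by rw [pow_succ, ha3, one_mul]
  have ha5 : a ^ 5 = a ^ 2 := by rw [pow_add a 3 2, ha3, one_mul]
  have ha6 : a ^ 6 = 1 := by rw [pow_add a 3 3, ha3, one_mul]
  have hsq : a ≠ a ^ 2 := fun h2 => ha1 (by
    rw [sq, eq_comm, mul_eq_left₀ ha0] at h2
    exact h2)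
  -- Otherwise the coefficients of 1 and X⁶ vanish, so those of X and X⁵ do not; then a = c² = a⁵ =
  -- a², which is impossible.
  have hc1 : c ^ 2 = 1 := by
    by_contra hc1
    have h6 := hcoeff' 6 (by rw [ha6]; exact Ne.symm hc1)
    have h0 := hcoeff' 0 (by rw [pow_zero]; exact Ne.symm hc1)
    have h5 := (coeff_five_or_coeff_six_ne_zero hg.1).resolve_right (not_not.2 h6)
    have h1 := (coeff_zero_or_coeff_one_ne_zero hg.1).resolve_left (not_not.2 h0)
    have h5' := not_imp_comm.1 (hcoeff' 5) h5
    have h1' := not_imp_comm.1 (hcoeff' 1) h1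
    rw [ha5] at h5'
    rw [pow_one] at h1'
    exact hsq (h1'.trans h5'.symm)
  have z1 := hcoeff' 1 (by rw [hc1, pow_one]; exact ha1)
  have z2 := hcoeff' 2 (by rw [hc1]; exact ha2)
  have z4 := hcoeff' 4 (by rw [hc1, ha4]; exact ha1)
  have z5 := hcoeff' 5 (by rw [hc1, ha5]; exact ha2)
  have h6 := (coeff_five_or_coeff_six_ne_zero hg.1).resolve_left (not_not.2 z5)
  have h0 := (coeff_zero_or_coeff_one_ne_zero hg.1).resolve_right (not_not.2 z1)
  obtain ⟨t, ht⟩ := IsAlgClosed.exists_pow_nat_eq (g.coeff 0 / g.coeff 6) (n := 6) (by norm_num)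
  have ht0 : t ≠ 0 := by
    rintro rfl
    rw [zero_pow (by norm_num), eq_comm, div_eq_zero_iff] at ht
    tauto
  obtain ⟨hp, ⟨ψ⟩⟩ := hg.scale (inv_ne_zero h0) ht0
  have hform : Polynomial.C (g.coeff 0)⁻¹ * g.comp (Polynomial.C t * Polynomial.X) =
      sexticD6 ((g.coeff 0)⁻¹ * (g.coeff 3 * t ^ 3)) := by
    have h16 : (g.coeff 0)⁻¹ * (g.coeff 6 * t ^ 6) = 1 := by
      field_simp at ht ⊢
      linear_combination ht
    have hdeg := isGenusTwo_natDegree_le hg.1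
    ext i
    rw [Polynomial.coeff_C_mul, Polynomial.comp_C_mul_X_coeff]
    simp only [Polynomial.coeff_add, Polynomial.coeff_X_pow, Polynomial.coeff_C_mul,
      Polynomial.coeff_one]
    by_cases hi : i ≤ 6
    · interval_cases i <;> simp [z1, z2, z4, z5, h0, h16]
    · rw [Polynomial.coeff_eq_zero_of_natDegree_lt (hdeg.trans_lt (not_le.1 hi)),
        if_neg (by omega), if_neg (by omega),
        if_neg (by omega)]
      simp
  rw [hform] at hp ψ
  exact ⟨_, hp, ⟨ψ.symm.trans e'⟩⟩

end NormalForms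

/-! ### Discriminants and invariants of the normal forms -/

section NormalFormInvariants

open Polynomial (natDegree)

variable {k : Type*} [Field k]

lemma resultant_X_right {f : Polynomial k} {m : ℕ} (h : f.natDegree ≤ m) :
    f.resultant Polynomial.X m 1 = (-1) ^ m * f.coeff 0 := by
  have h1 := Polynomial.resultant_X_add_C_right f m 0 h
  rwa [Polynomial.C_0, add_zero, neg_zero, ← Polynomial.coeff_zero_eq_eval_zero] at h1

lemma J2_quinticD4 (s : k) : J2 (quinticD4 s) = 6 * s ^ 2 + 40 := by
  simp [J2, sexticJ2, Polynomial.coeff_X]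

lemma J2_sexticD6 (b : k) : J2 (sexticD6 b) = 6 * b ^ 2 - 240 := by
  simp [J2, sexticJ2, Polynomial.coeff_one, Polynomial.coeff_X_pow]

variable [CharZero k]

lemma natDegree_quinticD4 (s : k) : (quinticD4 s).natDegree = 5 := by
  unfold quinticD4
  compute_degree!

lemma natDegree_sexticD6 (b : k) : (sexticD6 b).natDegree = 6 := by
  unfold sexticD6
  compute_degree!

/-- With g = 2X³ + b one has f' = 3X²g and 4f = g² + (4 - b²). Modulo g the polynomial 4f is
therefore constant, and the factors X are read off at 0. -/
lemma resultant_deriv_sexticD6 (b : k) :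
    (sexticD6 b).resultant (sexticD6 b).derivative 6 5 = 729 * (4 - b ^ 2) ^ 3 := by
  set g : Polynomial k := Polynomial.C 2 * Polynomial.X ^ 3 + Polynomial.C b with hg
  have hgd : g.natDegree = 3 := by rw [hg]; compute_degree!
  have hfd := (natDegree_sexticD6 b).le
  have hd : (sexticD6 b).derivative = Polynomial.C 3 * (Polynomial.X * (Polynomial.X * g)) := by
    rw [hg]
    simp only [map_add, Polynomial.derivative_X_pow, Polynomial.derivative_C_mul,
      Polynomial.derivative_one, Polynomial.C_ofNat]
    simp only [Nat.cast_ofNat, map_ofNat, add_zero, Nat.add_one_sub_one]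
    ring
  have hXg : (Polynomial.X * g).natDegree = 4 := by
    rw [Polynomial.natDegree_X_mul (by rintro h; simp [h] at hgd), hgd]
  have h0 : (sexticD6 b).coeff 0 = 1 := by simp
  have h1 := Polynomial.resultant_mul_right (sexticD6 b) Polynomial.X (Polynomial.X * g) 6 hfd
  have h2 := Polynomial.resultant_mul_right (sexticD6 b) Polynomial.X g 6 hfd
  rw [Polynomial.natDegree_X, hXg, resultant_X_right hfd, h0] at h1
  rw [Polynomial.natDegree_X, hgd, resultant_X_right hfd, h0] at h2
  have h3 : Polynomial.C 4 * sexticD6 b = Polynomial.C (4 - b ^ 2) + g * g := by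
    rw [hg]
    simp only [Polynomial.C_sub, Polynomial.C_pow, Polynomial.C_ofNat]
    ring
  have h4 := Polynomial.resultant_C_mul_left (sexticD6 b) g 6 3 4
  rw [h3, Polynomial.resultant_add_mul_left _ _ _ _ _ (by rw [hgd]) hgd.le,
    Polynomial.resultant_C_left, show g.coeff 3 = 2 by simp [hg]] at h4
  rw [hd, Polynomial.resultant_C_mul_right, h1, h2]
  linear_combination -(729 / 64) * h4

/-- Here f = Xh with h = X⁴ + sX² + 1. With g = 2X² + s one has f' = 2X²g + h and 4h = g² + (4 -
s²), so each resultant reduces to one with a constant. -/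
lemma resultant_deriv_quinticD4 (s : k) :
    (quinticD4 s).resultant (quinticD4 s).derivative 5 4 = 16 * (s ^ 2 - 4) ^ 2 := by
  set g : Polynomial k := Polynomial.C 2 * Polynomial.X ^ 2 + Polynomial.C s with hg
  set h : Polynomial k := Polynomial.X ^ 4 + Polynomial.C s * Polynomial.X ^ 2 + 1 with hh
  have hgd : g.natDegree = 2 := by rw [hg]; compute_degree!
  have hhd : h.natDegree = 4 := by rw [hh]; compute_degree!
  have hf : quinticD4 s = Polynomial.X * h := by rw [hh]; ring
  have hd : (quinticD4 s).derivative =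
      Polynomial.C 2 * (Polynomial.X * (Polynomial.X * g)) + h * 1 := by
    rw [hg, hh]
    simp only [map_add, Polynomial.derivative_X_pow, Polynomial.derivative_C_mul,
      Polynomial.derivative_X, Polynomial.C_ofNat]
    simp only [Nat.cast_ofNat, map_ofNat, Nat.add_one_sub_one]
    ring
  have hXg : (Polynomial.X * g).natDegree = 3 := by
    rw [Polynomial.natDegree_X_mul (by rintro h; simp [h] at hgd), hgd]
  have h0 : h.coeff 0 = 1 := by simp [hh]
  have hdd : (quinticD4 s).derivative.natDegree ≤ 4 :=
    (Polynomial.natDegree_derivative_le _).trans (by rw [natDegree_quinticD4])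
  have hd0 : (quinticD4 s).derivative.eval 0 = 1 := by simp
  have hm := Polynomial.resultant_mul_left Polynomial.X h (quinticD4 s).derivative 4 hdd
  have hX := Polynomial.resultant_X_add_C_left (quinticD4 s).derivative 4 0 hdd
  rw [Polynomial.C_0, add_zero, neg_zero, hd0] at hX
  rw [Polynomial.natDegree_X, hhd, hX, one_mul, ← hf] at hm
  have h1 := Polynomial.resultant_mul_right h Polynomial.X (Polynomial.X * g) 4 hhd.le
  have h2 := Polynomial.resultant_mul_right h Polynomial.X g 4 hhd.le
  rw [Polynomial.natDegree_X, hXg, resultant_X_right hhd.le, h0] at h1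
  rw [Polynomial.natDegree_X, hgd, resultant_X_right hhd.le, h0] at h2
  have h3 : Polynomial.C 4 * h = Polynomial.C (4 - s ^ 2) + g * g := by
    rw [hg, hh]
    simp only [Polynomial.C_sub, Polynomial.C_pow, Polynomial.C_ofNat]
    ring
  have h4 := Polynomial.resultant_C_mul_left h g 4 2 4
  rw [h3, Polynomial.resultant_add_mul_left _ _ _ _ _ (by rw [hgd]) hgd.le,
    Polynomial.resultant_C_left, show g.coeff 2 = 2 by simp [hg]] at h4
  rw [show (5 : ℕ) = 1 + 4 from rfl, hm, hd, Polynomial.resultant_add_mul_right _ _ _ _ _ (by simp)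
    hhd.le, Polynomial.resultant_C_mul_right, h1, h2]
  linear_combination -h4

lemma isGenusTwo_of_resultant_deriv_ne_zero {f : Polynomial k} {n : ℕ} (hd : f.natDegree = n + 1)
    (hn : n + 1 = 5 ∨ n + 1 = 6) (h : f.resultant f.derivative (n + 1) n ≠ 0) : IsGenusTwo f := by
  refine ⟨Polynomial.Separable.squarefree ?_, hd ▸ hn⟩
  by_contra hc
  apply h
  have hd' : f.derivative.natDegree = n := by
    rw [Polynomial.natDegree_derivative, hd, Nat.add_sub_cancel]
  have := (Polynomial.resultant_eq_zero_iff (f := f) (g := f.derivative)).2 ?_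
  · rwa [hd, hd'] at this
  · exact ⟨.inl (by rintro rfl; simp at hd), hc⟩

lemma isGenusTwo_quinticD4 {s : k} (h : s ^ 2 ≠ 4) : IsGenusTwo (quinticD4 s) :=
  isGenusTwo_of_resultant_deriv_ne_zero (natDegree_quinticD4 s) (.inl rfl) (by
    rw [resultant_deriv_quinticD4]
    exact mul_ne_zero (by norm_num) (pow_ne_zero _ (sub_ne_zero.2 h)))

lemma isGenusTwo_sexticD6 {b : k} (h : b ^ 2 ≠ 4) : IsGenusTwo (sexticD6 b) :=
  isGenusTwo_of_resultant_deriv_ne_zero (natDegree_sexticD6 b) (.inr rfl) (by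
    rw [resultant_deriv_sexticD6]
    exact mul_ne_zero (by norm_num) (pow_ne_zero _ (sub_ne_zero.2 h.symm)))

lemma J10_quinticD4 (s : k) : J10 (quinticD4 s) = 16 * (s ^ 2 - 4) ^ 2 := by
  have hd := natDegree_quinticD4 s
  have h := Polynomial.resultant_deriv (f := quinticD4 s)
    (Polynomial.natDegree_pos_iff_degree_pos.1 (by rw [hd]; norm_num))
  rw [Polynomial.leadingCoeff, hd, resultant_deriv_quinticD4] at h
  have h5 : (quinticD4 s).coeff 5 = 1 := by simp [Polynomial.coeff_X]
  rw [J10, hd, if_neg (by norm_num), h, h5]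
  norm_num

lemma J10_sexticD6 (b : k) : J10 (sexticD6 b) = 729 * (b ^ 2 - 4) ^ 3 := by
  have hd := natDegree_sexticD6 b
  have h := Polynomial.resultant_deriv (f := sexticD6 b)
    (Polynomial.natDegree_pos_iff_degree_pos.1 (by rw [hd]; norm_num))
  rw [Polynomial.leadingCoeff, hd, resultant_deriv_sexticD6] at h
  have h6 : (sexticD6 b).coeff 6 = 1 := by simp [Polynomial.coeff_one]
  rw [h6] at h
  rw [J10, hd, if_pos rfl]
  norm_num at h
  linear_combination h

/-- The invariants depend on s only through s² = (J₂ - 40) / 6, and after division by powers of J₂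
they are polynomials in 1 / J₂. This is the origin of `paramC1`. -/
lemma absInv_quinticD4 {s : k} (h : J2 (quinticD4 s) ≠ 0) :
    absInv (quinticD4 s) = paramC1 (J2 (quinticD4 s))⁻¹ := by
  have h4 : J4 (quinticD4 s) = 36 * s ^ 2 - 80 := by
    simp [J4, sexticJ4, Polynomial.coeff_X]
  have h6 : J6 (quinticD4 s) = 72 * s ^ 4 + 176 * s ^ 2 - 320 := by
    simp [J6, sexticJ6, Polynomial.coeff_X]
  rw [absInv, paramC1, h4, h6, J10_quinticD4]
  have h2 := J2_quinticD4 s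
  congr 1
  · field_simp
    rw [h2]
    ring
  congr 1
  · field_simp
    rw [h2]
    ring
  congr 1
  field_simp
  rw [h2]
  ring

lemma absInv_sexticD6 {b : k} (h : J2 (sexticD6 b) ≠ 0) :
    absInv (sexticD6 b) = paramC2 (J2 (sexticD6 b))⁻¹ := by
  have h4 : J4 (sexticD6 b) = 324 * b ^ 2 + 1620 := by
    simp [J4, sexticJ4, Polynomial.coeff_one, Polynomial.coeff_X_pow]
  have h6 : J6 (sexticD6 b) = 162 * b ^ 4 - 10044 * b ^ 2 - 119880 := by
    simp [J6, sexticJ6, Polynomial.coeff_one, Polynomial.coeff_X_pow]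
  rw [absInv, paramC2, h4, h6, J10_sexticD6]
  have h2 := J2_sexticD6 b
  congr 1
  · field_simp
    rw [h2]
    ring
  congr 1
  · field_simp
    rw [h2]
    ring
  congr 1
  field_simp
  rw [h2]
  ring

end NormalFormInvariants

/-! ### Extra automorphisms at the exceptional parameters -/

section ExtraAutomorphisms

variable {k : Type*} [Field k]

lemma sexticForm_quinticD4 (s : k) (P Q : Polynomial k) : sexticForm (quinticD4 s) P Q =
    P ^ 5 * Q + Polynomial.C s * (P ^ 3 * Q ^ 3) + P * Q ^ 5 := by
  simp [sexticForm, Finset.sum_range_succ, Polynomial.coeff_X]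
  ring

lemma sexticForm_sexticD6 (b : k) (P Q : Polynomial k) : sexticForm (sexticD6 b) P Q =
    P ^ 6 + Polynomial.C b * (P ^ 3 * Q ^ 3) + Q ^ 6 := by
  simp [sexticForm, Finset.sum_range_succ, Polynomial.coeff_one, Polynomial.coeff_X_pow]
  ring

/-- The ratio of the eigenvalues of a Möbius transformation is a root of unity of the order of the
automorphism inducing it. -/
lemma ratio_pow_eq_one {f : Polynomial k} [Fact (IsGenusTwo f)] {σ : CurveAut f} {n : ℕ}
    (hσ : σ ^ n = 1) {α β γ δ u₁ v₁ u₂ v₂ l m : k} (hdet : α * δ - β * γ ≠ 0)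
    (hX : σ (coordX f) * (algebraMap k _ γ * coordX f + algebraMap k _ δ) =
      algebraMap k _ α * coordX f + algebraMap k _ β)
    (h₁ : u₁ ≠ 0 ∨ v₁ ≠ 0) (h₂ : u₂ ≠ 0 ∨ v₂ ≠ 0) (hm : m ≠ 0)
    (hu₁ : u₁ * α + v₁ * γ = l * u₁) (hv₁ : u₁ * β + v₁ * δ = l * v₁)
    (hu₂ : u₂ * α + v₂ * γ = m * u₂) (hv₂ : u₂ * β + v₂ * δ = m * v₂) : (l / m) ^ n = 1 := by
  have hD : algebraMap k (FunctionField f) γ * coordX f + algebraMap k _ δ ≠ 0 :=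
    linear_ne_zero (by
      by_contra! h0
      exact hdet (by rw [h0.1, h0.2]; ring))
  have hL₁ := linear_ne_zero (f := f) h₁
  have hL₂ := linear_ne_zero (f := f) h₂
  have hm' : algebraMap k (FunctionField f) m ≠ 0 := (map_ne_zero _).2 hm
  have key : ∀ {u v c : k}, u * α + v * γ = c * u → u * β + v * δ = c * v →
      σ (algebraMap k _ u * coordX f + algebraMap k _ v) *
        (algebraMap k _ γ * coordX f + algebraMap k _ δ) =
      algebraMap k _ c * (algebraMap k _ u * coordX f + algebraMap k _ v) := by
    intro u v c hu hv
    have hu' := congrArg (algebraMap k (FunctionField f)) hu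
    have hv' := congrArg (algebraMap k (FunctionField f)) hv
    simp only [map_add, map_mul, AlgEquiv.commutes] at hu' hv' ⊢
    linear_combination algebraMap k (FunctionField f) u * hX + coordX f * hu' + hv'
  have k₁ := key hu₁ hv₁
  have k₂ := key hu₂ hv₂
  have hσ₂ : σ (algebraMap k _ u₂ * coordX f + algebraMap k _ v₂) ≠ 0 :=
    (map_ne_zero_iff _ σ.injective).2 hL₂
  refine pow_eq_one_of_scaling (div_ne_zero hL₁ hL₂) ?_ hσ
  rw [map_div₀, map_div₀, div_mul_div_comm, div_eq_div_iff hσ₂ (mul_ne_zero hm' hL₂)]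
  apply mul_right_cancel₀ hD
  linear_combination (algebraMap k _ m * (algebraMap k _ u₂ * coordX f + algebraMap k _ v₂)) * k₁ -
    (algebraMap k _ l * (algebraMap k _ u₁ * coordX f + algebraMap k _ v₁)) * k₂

variable [IsAlgClosed k] [CharZero k]

lemma exists_sq_add_mul_add_eq_zero (b c : k) : ∃ x : k, x ^ 2 + b * x + c = 0 := by
  obtain ⟨d, hd⟩ := IsAlgClosed.exists_pow_nat_eq (b ^ 2 - 4 * c) (n := 2) (by norm_num)
  refine ⟨(d - b) / 2, ?_⟩
  field_simp
  linear_combination hd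

lemma dihedralGroup_four_pow : ∀ g : DihedralGroup 4, g ^ 4 = 1 := by decide

lemma dihedralGroup_six_pow : ∀ g : DihedralGroup 6, g ^ 6 = 1 := by decide

/-- For X⁵ + X and η⁴ = -1 there is the automorphism X ↦ η²X, Y ↦ ηY. Its fourth power sends Y to
-Y, but the exponent of D₄ is 4. -/
lemma ne_zero_of_quinticD4 {s : k} (hs : IsGenusTwo (quinticD4 s))
    (e : CurveAut (quinticD4 s) ≃* DihedralGroup 4) : s ≠ 0 := by
  rintro rfl
  have := Fact.mk hs
  obtain ⟨η, hη⟩ := IsAlgClosed.exists_pow_nat_eq (-1 : k) (n := 4) (by norm_num)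
  have hη0 : η ≠ 0 := by
    rintro rfl
    norm_num at hη
  obtain ⟨σ, -, hY⟩ := exists_functionField_algEquiv hs (g := quinticD4 0) (α := η ^ 2) (β := 0)
    (γ := 0) (δ := 1) (e := η) (by simpa) hη0 (by
      have hη' := congrArg Polynomial.C hη
      simp only [Polynomial.C_pow, Polynomial.C_neg, Polynomial.C_1] at hη'
      rw [sexticForm_quinticD4]
      simp only [quinticD4, Polynomial.C_pow, Polynomial.C_0, Polynomial.C_1]
      linear_combination (Polynomial.C η ^ 2 * (Polynomial.C η ^ 4 - 1) * Polynomial.X ^ 5) * hη')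
  have h4 := pow_eq_one_of_scaling coordY_ne_zero (by simpa using hY) (σ := σ) (n := 4)
    (e.injective (by rw [map_pow, dihedralGroup_four_pow, map_one]))
  rw [hη] at h4
  norm_num at h4

/-- If 9s² = 100, then for j² = 3s/10 one has j⁴ = 1, and 12j f is (1 + jX)⁶ - (1 - jX)⁶.
Multiplying the ratio of the two linear forms by a primitive cube root of unity w gives an
automorphism whose fourth power is not the identity. -/
lemma sq_ne_of_quinticD4 {s : k} (hs : IsGenusTwo (quinticD4 s))
    (e : CurveAut (quinticD4 s) ≃* DihedralGroup 4) : 9 * s ^ 2 ≠ 100 := by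
  intro h
  have := Fact.mk hs
  obtain ⟨j, hj⟩ := IsAlgClosed.exists_pow_nat_eq (3 * s / 10) (n := 2) (by norm_num)
  have hj4 : j ^ 4 = 1 := by
    rw [show 4 = 2 * 2 from rfl, pow_mul, hj]
    field_simp
    linear_combination h
  have hj0 : j ≠ 0 := by rintro rfl; norm_num at hj4
  obtain ⟨w, hw⟩ := exists_sq_add_mul_add_eq_zero (1 : k) 1
  have hw0 : w ≠ 0 := by rintro rfl; norm_num at hw
  have hw3 : w ^ 3 = 1 := by linear_combination (w - 1) * hw
  have hdet : (w + 1) * (w + 1) - j ^ 3 * (w - 1) * (j * (w - 1)) ≠ 0 := by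
    rw [show (w + 1) * (w + 1) - j ^ 3 * (w - 1) * (j * (w - 1)) = 4 * w by
      linear_combination (-(w - 1) ^ 2) * hj4]
    simpa using hw0
  -- The matrix sends 1 + jX to 2w(1 + jX) and 1 - jX to 2(1 - jX). Both sixth powers are multiplied
  -- by 64, so e = 8.
  obtain ⟨σ, hX, -⟩ := exists_functionField_algEquiv hs (g := quinticD4 s) (α := w + 1)
    (β := j ^ 3 * (w - 1)) (γ := j * (w - 1)) (δ := w + 1) (e := 8) hdet (by norm_num) (by
      have hJ := congrArg Polynomial.C hj4
      have hW := congrArg Polynomial.C hw3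
      have hS : 3 * Polynomial.C s = 10 * Polynomial.C j ^ 2 := by
        have h1 : 3 * s = 10 * j ^ 2 := by
          rw [hj]
          field_simp
        have h2 := congrArg Polynomial.C h1
        simpa only [Polynomial.C_mul, Polynomial.C_pow, map_ofNat] using h2
      have hJ0 : 12 * Polynomial.C j ≠ 0 := by simpa using hj0
      simp only [Polynomial.C_pow, Polynomial.C_1] at hJ hW
      have key : ∀ P Q : Polynomial k, 12 * Polynomial.C j *
          (P ^ 5 * Q + Polynomial.C s * (P ^ 3 * Q ^ 3) + P * Q ^ 5) =
          (Q + Polynomial.C j * P) ^ 6 - (Q - Polynomial.C j * P) ^ 6 := fun P Q => by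
        linear_combination (-12 * Polynomial.C j * P ^ 5 * Q) * hJ +
          (4 * Polynomial.C j * (P ^ 3 * Q ^ 3)) * hS
      have h1 := key Polynomial.X 1
      rw [sexticForm_quinticD4]
      apply mul_left_cancel₀ hJ0
      rw [key]
      simp only [Polynomial.C_add, Polynomial.C_sub, Polynomial.C_mul, Polynomial.C_pow,
        Polynomial.C_1, map_ofNat]
      generalize Polynomial.C j = J at *
      generalize Polynomial.C w = W at *
      rw [show J * (W - 1) * Polynomial.X + (W + 1) + J * ((W + 1) * Polynomial.X + J ^ 3 * (W - 1))
          = 2 * W * (1 + J * Polynomial.X) by linear_combination (W - 1) * hJ,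
        show J * (W - 1) * Polynomial.X + (W + 1) - J * ((W + 1) * Polynomial.X + J ^ 3 * (W - 1))
          = 2 * (1 - J * Polynomial.X) by linear_combination (-(W - 1)) * hJ]
      linear_combination -64 * h1 + 64 * (W ^ 3 + 1) * (1 + J * Polynomial.X) ^ 6 * hW)
  have h4 := ratio_pow_eq_one (σ := σ) (n := 4)
    (e.injective (by rw [map_pow, dihedralGroup_four_pow, map_one])) hdet hX
    (u₁ := j) (v₁ := 1) (u₂ := -j) (v₂ := 1) (l := 2 * w) (m := 2) (.inl hj0) (.inr one_ne_zero)
    two_ne_zero (by ring) (by linear_combination (w - 1) * hj4) (by ring)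
    (by linear_combination (-(w - 1)) * hj4)
  rw [mul_div_cancel_left₀ _ two_ne_zero] at h4
  have hw1 : w = 1 := by linear_combination h4 - w * hw3
  rw [hw1] at hw
  norm_num at hw

/-- For X⁶ + 1 take σ : X ↦ zX, Y ↦ Y with z a primitive sixth root of unity. Then σ² ≠ 1, and σ³
sends X to -X, so it is neither 1 nor the hyperelliptic involution; this contradicts the trichotomy
in D₆. -/
lemma ne_zero_of_sexticD6 {b : k} (hb : IsGenusTwo (sexticD6 b))
    (e : CurveAut (sexticD6 b) ≃* DihedralGroup 6) : b ≠ 0 := by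
  rintro rfl
  have := Fact.mk hb
  obtain ⟨z, hz⟩ := exists_sq_add_mul_add_eq_zero (-1 : k) 1
  have hz3 : z ^ 3 = -1 := by linear_combination (z + 1) * hz
  have hz0 : z ≠ 0 := by rintro rfl; norm_num at hz
  obtain ⟨σ, hX, hY⟩ := exists_functionField_algEquiv hb (g := sexticD6 0) (α := z) (β := 0)
    (γ := 0) (δ := 1) (e := 1) (by simpa) one_ne_zero (by
      have hz' := congrArg Polynomial.C hz3
      simp only [Polynomial.C_pow, Polynomial.C_neg, Polynomial.C_1] at hz'
      rw [sexticForm_sexticD6]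
      simp only [sexticD6, Polynomial.C_pow, Polynomial.C_0, Polynomial.C_1]
      linear_combination ((Polynomial.C z ^ 3 - 1) * Polynomial.X ^ 6) * hz')
  replace hX : σ (coordX _) = algebraMap k _ z * coordX _ := by simpa using hX
  replace hY : σ (coordY _) = algebraMap k _ 1 * coordY _ := by simpa using hY
  obtain ⟨ι, hιX, hιY, hι1, hι2, hιc, hι⟩ := exists_hyperelliptic (f := sexticD6 (0 : k))
  rcases dihedralGroup_six_center (e ι) (by simpa using hι1) (fun x => by
    obtain ⟨y, rfl⟩ := e.surjective x
    rw [← map_mul, ← map_mul, hιc]) (e σ) with h | h | h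
  · have h2 := pow_eq_one_of_scaling coordX_ne_zero hX (n := 2)
      (e.injective (by rw [map_pow, h, map_one]))
    have hz2 : z = 2 := by linear_combination h2 - hz
    rw [hz2] at hz
    norm_num at hz
  · have h3 := pow_eq_one_of_scaling coordX_ne_zero hX (n := 3)
      (e.injective (by rw [map_pow, h, map_one]))
    rw [hz3] at h3
    norm_num at h3
  · rw [← map_pow] at h
    have h3 := pow_apply_of_scaling hX 3
    have h4 := pow_apply_of_scaling hY 3
    rw [e.injective h, hιX, hz3, map_neg, map_one, neg_one_mul, eq_comm] at h3
    have := linear_eq_zero (f := sexticD6 (0 : k)) (a := 2) (b := 0) (by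
      rw [map_zero, map_ofNat]
      linear_combination -h3)
    exact two_ne_zero this.1

/-- For b² = -50 there is an automorphism acting on the line by a quarter turn: its eigenvalue ratio
squares to -1. The sixth power of the ratio is then -1, while D₆ has exponent 6. -/
lemma sq_ne_of_sexticD6 {b : k} (hb : IsGenusTwo (sexticD6 b))
    (e : CurveAut (sexticD6 b) ≃* DihedralGroup 6) : b ^ 2 ≠ -50 := by
  intro h
  have := Fact.mk hb
  obtain ⟨c, rfl⟩ : ∃ c, b = 5 * c := ⟨b / 5, by field_simp⟩
  have hc : c ^ 2 = -2 := by linear_combination (1 / 25) * h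
  obtain ⟨p, hp⟩ := exists_sq_add_mul_add_eq_zero (-c) (-2)
  obtain ⟨r, hr⟩ := exists_sq_add_mul_add_eq_zero (-c) 1
  obtain ⟨d, hd⟩ := IsAlgClosed.exists_pow_nat_eq (-27 : k) (n := 2) (by norm_num)
  have hdet : p * (p - c) - (-1) * 1 ≠ 0 := by
    rw [show p * (p - c) - (-1) * 1 = 3 by linear_combination hp]
    norm_num
  -- The fixed points of this transformation are the two roots r and c - r of x² - cx + 1, which are
  -- also roots of the sextic. The determinant is 3 and the sextic is multiplied by d² = -27.
  obtain ⟨σ, hX, -⟩ := exists_functionField_algEquiv hb (g := sexticD6 (5 * c)) (α := p)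
    (β := -1) (γ := 1) (δ := p - c) (e := d) hdet (by rintro rfl; norm_num at hd) (by
      rw [sexticForm_sexticD6, hd]
      have hC := congrArg Polynomial.C hc
      have hP := congrArg Polynomial.C hp
      simp only [sexticD6, Polynomial.C_pow, Polynomial.C_1, Polynomial.C_neg, Polynomial.C_add,
        Polynomial.C_mul, Polynomial.C_sub, map_ofNat, Polynomial.C_0] at hC hP ⊢
      generalize Polynomial.C c = C at *
      generalize Polynomial.C p = P at *
      grind)
  have hprod : (p - r) * (p - c + r) = 3 := by linear_combination hp - hr
  have hm : p - c + r ≠ 0 := by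
    intro h0
    rw [h0, mul_zero] at hprod
    norm_num at hprod
  have h6 := ratio_pow_eq_one (σ := σ) (n := 6)
    (e.injective (by rw [map_pow, dihedralGroup_six_pow, map_one])) hdet hX
    (u₁ := 1) (v₁ := -r) (u₂ := 1) (v₂ := r - c) (l := p - r) (m := p - c + r)
    (.inl one_ne_zero) (.inl one_ne_zero) hm (by ring) (by linear_combination -hr) (by ring)
    (by linear_combination -hr)
  have hsq : ((p - r) / (p - c + r)) ^ 2 = -1 := by
    field_simp
    linear_combination 2 * hp + 2 * hr + hc
  rw [show 6 = 2 * 3 from rfl, pow_mul, hsq] at h6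
  norm_num at h6

end ExtraAutomorphisms

/-! ### A quadratic covariant forces automorphisms to preserve {0, ∞} -/

section AutomorphismsOfNormalForms

/-- The leading coefficient of a quadratic covariant of degree 3 of binary sextics. -/
def quadraticCovariant {R : Type*} [CommRing R] (a : ℕ → R) : R :=
  3 * a 3 ^ 2 * a 4 - 8 * a 2 * a 4 ^ 2 - 5 * a 2 * a 3 * a 5 + 80 * a 2 ^ 2 * a 6
    + 50 * a 1 * a 4 * a 5 - 225 * a 1 * a 3 * a 6 - 250 * a 0 * a 5 ^ 2 + 600 * a 0 * a 4 * a 6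

variable {k : Type*} [Field k]

lemma coeff_of_eq_sum {F : Polynomial k} {a : Fin 7 → k}
    (h : F = ∑ i : Fin 7, Polynomial.C (a i) * Polynomial.X ^ (i : ℕ)) (i : Fin 7) :
    F.coeff i = a i := by
  rw [h, Polynomial.finsetSum_coeff]
  simp only [Polynomial.coeff_C_mul_X_pow, Fin.val_inj]
  simp

/-- The covariant of X⁵ + sX³ + X is s(9s² - 100) times XZ. Substituting a matrix multiplies it by
the eighth power of the determinant, and αγ is the leading coefficient of the transformed XZ. -/
lemma quadraticCovariant_quinticD4 {R : Type*} [CommRing R] {α β γ δ s : R} {a : ℕ → R}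
    (h0 : a 0 = β ^ 5 * δ + β * δ ^ 5 + s * (β ^ 3 * δ ^ 3))
    (h1 : a 1 = β ^ 5 * γ + 5 * α * β ^ 4 * δ + 5 * β * γ * δ ^ 4 + α * δ ^ 5 + s * (3 * β ^ 3 * γ
      * δ ^ 2 + 3 * α * β ^ 2 * δ ^ 3))
    (h2 : a 2 = 5 * α * β ^ 4 * γ + 10 * α ^ 2 * β ^ 3 * δ + 10 * β * γ ^ 2 * δ ^ 3 + 5 * α * γ *
      δ ^ 4 + s * (3 * β ^ 3 * γ ^ 2 * δ + 9 * α * β ^ 2 * γ * δ ^ 2 + 3 * α ^ 2 * β * δ ^ 3))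
    (h3 : a 3 = 10 * α ^ 2 * β ^ 3 * γ + 10 * α ^ 3 * β ^ 2 * δ + 10 * β * γ ^ 3 * δ ^ 2 + 10 * α
      * γ ^ 2 * δ ^ 3 + s * (β ^ 3 * γ ^ 3 + 9 * α * β ^ 2 * γ ^ 2 * δ + 9 * α ^ 2 * β * γ * δ ^ 2
      + α ^ 3 * δ ^ 3))
    (h4 : a 4 = 10 * α ^ 3 * β ^ 2 * γ + 5 * α ^ 4 * β * δ + 5 * β * γ ^ 4 * δ + 10 * α * γ ^ 3 *
      δ ^ 2 + s * (3 * α * β ^ 2 * γ ^ 3 + 9 * α ^ 2 * β * γ ^ 2 * δ + 3 * α ^ 3 * γ * δ ^ 2))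
    (h5 : a 5 = 5 * α ^ 4 * β * γ + α ^ 5 * δ + β * γ ^ 5 + 5 * α * γ ^ 4 * δ + s * (3 * α ^ 2 * β
      * γ ^ 3 + 3 * α ^ 3 * γ ^ 2 * δ))
    (h6 : a 6 = α ^ 5 * γ + α * γ ^ 5 + s * (α ^ 3 * γ ^ 3)) :
    quadraticCovariant a = s * (9 * s ^ 2 - 100) * (α * γ) * (α * δ - β * γ) ^ 8 := by
  rw [quadraticCovariant, h0, h1, h2, h3, h4, h5, h6]
  ring

lemma sexticForm_quinticD4_linear (α β γ δ s : k) :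
    sexticForm (quinticD4 s) (Polynomial.C α * Polynomial.X + Polynomial.C β)
        (Polynomial.C γ * Polynomial.X + Polynomial.C δ) =
      ∑ i : Fin 7, Polynomial.C (![
        β ^ 5 * δ + β * δ ^ 5 + s * (β ^ 3 * δ ^ 3),
        β ^ 5 * γ + 5 * α * β ^ 4 * δ + 5 * β * γ * δ ^ 4 + α * δ ^ 5 + s * (3 * β ^ 3 * γ * δ ^ 2
          + 3 * α * β ^ 2 * δ ^ 3),
        5 * α * β ^ 4 * γ + 10 * α ^ 2 * β ^ 3 * δ + 10 * β * γ ^ 2 * δ ^ 3 + 5 * α * γ * δ ^ 4 +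
          s * (3 * β ^ 3 * γ ^ 2 * δ + 9 * α * β ^ 2 * γ * δ ^ 2 + 3 * α ^ 2 * β * δ ^ 3),
        10 * α ^ 2 * β ^ 3 * γ + 10 * α ^ 3 * β ^ 2 * δ + 10 * β * γ ^ 3 * δ ^ 2 + 10 * α * γ ^ 2
          * δ ^ 3 + s * (β ^ 3 * γ ^ 3 + 9 * α * β ^ 2 * γ ^ 2 * δ + 9 * α ^ 2 * β * γ * δ ^ 2 + α
          ^ 3 * δ ^ 3),
        10 * α ^ 3 * β ^ 2 * γ + 5 * α ^ 4 * β * δ + 5 * β * γ ^ 4 * δ + 10 * α * γ ^ 3 * δ ^ 2 +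
          s * (3 * α * β ^ 2 * γ ^ 3 + 9 * α ^ 2 * β * γ ^ 2 * δ + 3 * α ^ 3 * γ * δ ^ 2),
        5 * α ^ 4 * β * γ + α ^ 5 * δ + β * γ ^ 5 + 5 * α * γ ^ 4 * δ + s * (3 * α ^ 2 * β * γ ^ 3
          + 3 * α ^ 3 * γ ^ 2 * δ),
        α ^ 5 * γ + α * γ ^ 5 + s * (α ^ 3 * γ ^ 3)] i) * Polynomial.X ^ (i : ℕ) := by
  rw [sexticForm_quinticD4]
  simp only [Fin.sum_univ_succ, Matrix.cons_val_zero, Matrix.cons_val_succ, Fin.val_zero,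
    Fin.val_succ, Finset.univ_eq_empty, Finset.sum_empty, Polynomial.C_add, Polynomial.C_mul,
    Polynomial.C_pow, map_ofNat]
  simp
  ring

lemma quadraticCovariant_sexticD6 {R : Type*} [CommRing R] {α β γ δ b : R} {a : ℕ → R}
    (h0 : a 0 = β ^ 6 + δ ^ 6 + b * (β ^ 3 * δ ^ 3))
    (h1 : a 1 = 6 * α * β ^ 5 + 6 * γ * δ ^ 5 + b * (3 * β ^ 3 * γ * δ ^ 2 + 3 * α * β ^ 2 * δ ^
      3))
    (h2 : a 2 = 15 * α ^ 2 * β ^ 4 + 15 * γ ^ 2 * δ ^ 4 + b * (3 * β ^ 3 * γ ^ 2 * δ + 9 * α * β ^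
      2 * γ * δ ^ 2 + 3 * α ^ 2 * β * δ ^ 3))
    (h3 : a 3 = 20 * α ^ 3 * β ^ 3 + 20 * γ ^ 3 * δ ^ 3 + b * (β ^ 3 * γ ^ 3 + 9 * α * β ^ 2 * γ ^
      2 * δ + 9 * α ^ 2 * β * γ * δ ^ 2 + α ^ 3 * δ ^ 3))
    (h4 : a 4 = 15 * α ^ 4 * β ^ 2 + 15 * γ ^ 4 * δ ^ 2 + b * (3 * α * β ^ 2 * γ ^ 3 + 9 * α ^ 2 *
      β * γ ^ 2 * δ + 3 * α ^ 3 * γ * δ ^ 2))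
    (h5 : a 5 = 6 * α ^ 5 * β + 6 * γ ^ 5 * δ + b * (3 * α ^ 2 * β * γ ^ 3 + 3 * α ^ 3 * γ ^ 2 *
      δ))
    (h6 : a 6 = α ^ 6 + γ ^ 6 + b * (α ^ 3 * γ ^ 3)) :
    quadraticCovariant a = 9 * (b * (b ^ 2 + 50)) * (α * γ) * (α * δ - β * γ) ^ 8 := by
  rw [quadraticCovariant, h0, h1, h2, h3, h4, h5, h6]
  ring

lemma sexticForm_sexticD6_linear (α β γ δ b : k) :
    sexticForm (sexticD6 b) (Polynomial.C α * Polynomial.X + Polynomial.C β)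
        (Polynomial.C γ * Polynomial.X + Polynomial.C δ) =
      ∑ i : Fin 7, Polynomial.C (![
        β ^ 6 + δ ^ 6 + b * (β ^ 3 * δ ^ 3),
        6 * α * β ^ 5 + 6 * γ * δ ^ 5 + b * (3 * β ^ 3 * γ * δ ^ 2 + 3 * α * β ^ 2 * δ ^ 3),
        15 * α ^ 2 * β ^ 4 + 15 * γ ^ 2 * δ ^ 4 + b * (3 * β ^ 3 * γ ^ 2 * δ + 9 * α * β ^ 2 * γ *
          δ ^ 2 + 3 * α ^ 2 * β * δ ^ 3),
        20 * α ^ 3 * β ^ 3 + 20 * γ ^ 3 * δ ^ 3 + b * (β ^ 3 * γ ^ 3 + 9 * α * β ^ 2 * γ ^ 2 * δ +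
          9 * α ^ 2 * β * γ * δ ^ 2 + α ^ 3 * δ ^ 3),
        15 * α ^ 4 * β ^ 2 + 15 * γ ^ 4 * δ ^ 2 + b * (3 * α * β ^ 2 * γ ^ 3 + 9 * α ^ 2 * β * γ ^
          2 * δ + 3 * α ^ 3 * γ * δ ^ 2),
        6 * α ^ 5 * β + 6 * γ ^ 5 * δ + b * (3 * α ^ 2 * β * γ ^ 3 + 3 * α ^ 3 * γ ^ 2 * δ),
        α ^ 6 + γ ^ 6 + b * (α ^ 3 * γ ^ 3)] i) * Polynomial.X ^ (i : ℕ) := by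
  rw [sexticForm_sexticD6]
  simp only [Fin.sum_univ_succ, Matrix.cons_val_zero, Matrix.cons_val_succ, Fin.val_zero,
    Fin.val_succ, Finset.univ_eq_empty, Finset.sum_empty, Polynomial.C_add, Polynomial.C_mul,
    Polynomial.C_pow, map_ofNat]
  simp
  ring


lemma diagonal_or_antidiagonal {α β γ δ : k} (hdet : α * δ - β * γ ≠ 0) (h₁ : α * γ = 0)
    (h₂ : β * δ = 0) : (β = 0 ∧ γ = 0) ∨ (α = 0 ∧ δ = 0) := by
  rcases mul_eq_zero.1 h₁ with rfl | rfl <;> rcases mul_eq_zero.1 h₂ with rfl | rfl <;>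
    simp_all

/-- A self-equivalence must preserve the covariant XZ up to a scalar. Vanishing of its X²
coefficient gives αγ = 0, and of its Z² coefficient βδ = 0. -/
lemma diagonal_or_antidiagonal_quinticD4 {α β γ δ s c : k} (hs : s ≠ 0) (hs' : 9 * s ^ 2 ≠ 100)
    (hdet : α * δ - β * γ ≠ 0)
    (h : sexticForm (quinticD4 s) (Polynomial.C α * Polynomial.X + Polynomial.C β)
      (Polynomial.C γ * Polynomial.X + Polynomial.C δ) = Polynomial.C c * quinticD4 s) :
    (β = 0 ∧ γ = 0) ∨ (α = 0 ∧ δ = 0) := by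
  have e := coeff_of_eq_sum (h.symm.trans (sexticForm_quinticD4_linear α β γ δ s))
  have h₁ := quadraticCovariant_quinticD4 (a := (Polynomial.C c * quinticD4 s).coeff)
    (e 0) (e 1) (e 2) (e 3) (e 4) (e 5) (e 6)
  -- Reversing the coefficients and exchanging the columns of the matrix turns the trailing
  -- coefficient into a leading one; the determinant changes sign.
  have h₂ := quadraticCovariant_quinticD4 (α := β) (β := α) (γ := δ) (δ := γ) (s := s)
    (a := fun i => (Polynomial.C c * quinticD4 s).coeff (6 - i))
    ((e 6).trans (by simp)) ((e 5).trans (by simp; ring)) ((e 4).trans (by simp; ring))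
    ((e 3).trans (by simp; ring)) ((e 2).trans (by simp; ring)) ((e 1).trans (by simp; ring))
    ((e 0).trans (by simp))
  have z₁ : quadraticCovariant (Polynomial.C c * quinticD4 s).coeff = 0 := by
    simp [quadraticCovariant, Polynomial.coeff_X]
  have z₂ : quadraticCovariant (fun i => (Polynomial.C c * quinticD4 s).coeff (6 - i)) = 0 := by
    simp [quadraticCovariant, Polynomial.coeff_X]
  have hc : s * (9 * s ^ 2 - 100) ≠ 0 := mul_ne_zero hs (sub_ne_zero.2 hs')
  rw [z₁, eq_comm, mul_eq_zero_iff_right (pow_ne_zero 8 hdet), mul_eq_zero_iff_left hc] at h₁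
  rw [z₂, eq_comm, mul_eq_zero_iff_right (pow_ne_zero 8 fun h0 => hdet (by linear_combination -h0)),
    mul_eq_zero_iff_left hc] at h₂
  exact diagonal_or_antidiagonal hdet h₁ h₂

lemma diagonal_or_antidiagonal_sexticD6 [CharZero k] {α β γ δ b c : k} (hb : b ≠ 0) (hb' : b ^ 2 ≠ -50)
    (hdet : α * δ - β * γ ≠ 0)
    (h : sexticForm (sexticD6 b) (Polynomial.C α * Polynomial.X + Polynomial.C β)
      (Polynomial.C γ * Polynomial.X + Polynomial.C δ) = Polynomial.C c * sexticD6 b) :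
    (β = 0 ∧ γ = 0) ∨ (α = 0 ∧ δ = 0) := by
  have e := coeff_of_eq_sum (h.symm.trans (sexticForm_sexticD6_linear α β γ δ b))
  have h₁ := quadraticCovariant_sexticD6 (a := (Polynomial.C c * sexticD6 b).coeff)
    (e 0) (e 1) (e 2) (e 3) (e 4) (e 5) (e 6)
  have h₂ := quadraticCovariant_sexticD6 (α := β) (β := α) (γ := δ) (δ := γ) (b := b)
    (a := fun i => (Polynomial.C c * sexticD6 b).coeff (6 - i))
    ((e 6).trans (by simp)) ((e 5).trans (by simp; ring)) ((e 4).trans (by simp; ring))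
    ((e 3).trans (by simp; ring)) ((e 2).trans (by simp; ring)) ((e 1).trans (by simp; ring))
    ((e 0).trans (by simp))
  have z₁ : quadraticCovariant (Polynomial.C c * sexticD6 b).coeff = 0 := by
    simp [quadraticCovariant, Polynomial.coeff_one]
  have z₂ : quadraticCovariant (fun i => (Polynomial.C c * sexticD6 b).coeff (6 - i)) = 0 := by
    simp [quadraticCovariant, Polynomial.coeff_one]
  have hc : 9 * (b * (b ^ 2 + 50)) ≠ 0 := mul_ne_zero (by norm_num) (mul_ne_zero hb fun h0 => hb' (by linear_combination h0))
  rw [z₁, eq_comm, mul_eq_zero_iff_right (pow_ne_zero 8 hdet), mul_eq_zero_iff_left hc] at h₁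
  rw [z₂, eq_comm, mul_eq_zero_iff_right (pow_ne_zero 8 fun h0 => hdet (by linear_combination -h0)),
    mul_eq_zero_iff_left hc] at h₂
  exact diagonal_or_antidiagonal hdet h₁ h₂


end AutomorphismsOfNormalForms

/-! ### Recognizing dihedral automorphism groups -/

section Dihedral

lemma nonempty_mulEquiv_dihedralGroup {G : Type*} [Group G] {n : ℕ} [NeZero n] {a b : G}
    (ha : orderOf a = n) (hb : b * b = 1) (hab : b * a * b = a⁻¹) (hne : ∀ m : ℕ, b ≠ a ^ m)
    (h : ∀ g, (∃ m : ℕ, g = a ^ m) ∨ ∃ m : ℕ, g = b * a ^ m) :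
    Nonempty (G ≃* DihedralGroup n) := by
  have hadd : ∀ i j : ZMod n, a ^ (i + j).val = a ^ i.val * a ^ j.val := fun i j => by
    rw [ZMod.val_add, ← pow_add]
    conv_rhs => rw [← pow_mod_orderOf, ha]
  have hsub : ∀ i j : ZMod n, a ^ (j - i).val = (a ^ i.val)⁻¹ * a ^ j.val := fun i j => by
    rw [eq_inv_mul_iff_mul_eq, ← hadd, add_sub_cancel]
  have hb' : b⁻¹ = b := inv_eq_of_mul_eq_one_left hb
  have hconj : ∀ m : ℕ, b * a ^ m * b = (a ^ m)⁻¹ := fun m => by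
    have h1 := conj_pow (a := b) (b := a) (i := m)
    rw [hb', hab, inv_pow] at h1
    exact h1.symm
  -- Moving b to the left across a power of a inverts it; this matches the multiplication r i * sr j
  -- = sr (j - i).
  have hcomm : ∀ m : ℕ, a ^ m * b = b * (a ^ m)⁻¹ := fun m => by
    rw [← hconj, ← mul_assoc, ← mul_assoc, hb, one_mul]
  let φ : DihedralGroup n →* G :=
    { toFun := fun x => match x with
        | .r i => a ^ i.val
        | .sr i => b * a ^ i.val
      map_one' := by
        change a ^ (0 : ZMod n).val = 1
        rw [ZMod.val_zero, pow_zero]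
      map_mul' := by
        rintro (i | i) (j | j)
        · exact hadd i j
        · change b * a ^ (j - i).val = a ^ i.val * (b * a ^ j.val)
          rw [hsub, ← mul_assoc, ← mul_assoc, hcomm]
        · change b * a ^ (i + j).val = b * a ^ i.val * a ^ j.val
          rw [hadd, mul_assoc]
        · change a ^ (j - i).val = b * a ^ i.val * (b * a ^ j.val)
          rw [hsub, ← mul_assoc, hconj] }
  refine ⟨(MulEquiv.ofBijective φ ⟨?_, fun g => ?_⟩).symm⟩
  · rw [injective_iff_map_eq_one]
    rintro (i | i) hi
    · have h1 : a ^ i.val = 1 := hi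
      have h2 := Nat.eq_zero_of_dvd_of_lt ((dvd_of_eq ha.symm).trans (orderOf_dvd_of_pow_eq_one h1))
        (ZMod.val_lt i)
      rw [ZMod.val_eq_zero] at h2
      rw [h2]
      rfl
    · have h1 : b * a ^ i.val = 1 := hi
      rw [mul_eq_one_iff_inv_eq, hb'] at h1
      exact absurd h1 (hne _)
  · have hval : ∀ m : ℕ, a ^ ((m : ZMod n)).val = a ^ m := fun m => by
      rw [ZMod.val_natCast]
      conv_rhs => rw [← pow_mod_orderOf, ha]
    rcases h g with ⟨m, rfl⟩ | ⟨m, rfl⟩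
    · exact ⟨.r m, hval m⟩
    · exact ⟨.sr m, congrArg (b * ·) (hval m)⟩

variable {k : Type*} [Field k] {f : Polynomial k} [hf : Fact (IsGenusTwo f)]

lemma algebraMap_mul_coordX_ne_inv (c : k) :
    (coordX f)⁻¹ ≠ algebraMap k (FunctionField f) c * coordX f := fun h => by
  have h1 : Polynomial.aeval (coordX f) (Polynomial.C c * Polynomial.X ^ 2 - 1) = 0 := by
    simp only [map_sub, map_mul, map_pow, Polynomial.aeval_C, Polynomial.aeval_X, map_one]
    rw [sq (coordX f), ← mul_assoc, ← h, inv_mul_cancel₀ coordX_ne_zero, sub_self]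
  have h2 := congrArg (Polynomial.coeff · 0)
    (transcendental_iff.1 (transcendental_coordX (f := f)) _ h1)
  simp at h2

lemma eq_pow_of_scaling {σ ρ : CurveAut f} {a e u v : k}
    (hX : ρ (coordX f) = algebraMap k _ a * coordX f)
    (hY : ρ (coordY f) = algebraMap k _ e * coordY f)
    (hσX : σ (coordX f) = algebraMap k _ u * coordX f)
    (hσY : σ (coordY f) = algebraMap k _ v * coordY f) {m : ℕ} (hu : u = a ^ m) (hv : v = e ^ m) :
    σ = ρ ^ m :=
  curveAut_ext (by rw [pow_apply_of_scaling hX, hσX, hu])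
    (by rw [pow_apply_of_scaling hY, hσY, hv])

lemma scaling_or_reversed_scaling [CharZero k]
    (h : ∀ {α β γ δ c : k}, α * δ - β * γ ≠ 0 → sexticForm f (Polynomial.C α * Polynomial.X +
      Polynomial.C β) (Polynomial.C γ * Polynomial.X + Polynomial.C δ) = Polynomial.C c * f →
      (β = 0 ∧ γ = 0) ∨ (α = 0 ∧ δ = 0)) (σ : CurveAut f) :
    (∃ u : k, σ (coordX f) = algebraMap k _ u * coordX f) ∨
      ∃ u : k, σ (coordX f) = algebraMap k _ u * (coordX f)⁻¹ := by
  obtain ⟨α, β, γ, δ, hdet, hX⟩ := exists_moebius σ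
  obtain ⟨e, -, -, hform⟩ := exists_moebius_coordY σ hX (by
    by_contra! h0
    exact hdet (by rw [h0.1, h0.2]; ring))
  rcases h hdet hform with ⟨rfl, rfl⟩ | ⟨rfl, rfl⟩
  · have hδ : algebraMap k (FunctionField f) δ ≠ 0 :=
      (map_ne_zero _).2 (by rintro rfl; simp at hdet)
    refine .inl ⟨α / δ, ?_⟩
    rw [map_zero, zero_mul, zero_add, add_zero] at hX
    rw [map_div₀, div_mul_eq_mul_div, eq_div_iff hδ, hX]
  · have hγ : algebraMap k (FunctionField f) γ ≠ 0 :=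
      (map_ne_zero _).2 (by rintro rfl; simp at hdet)
    refine .inr ⟨β / γ, ?_⟩
    rw [map_zero, zero_mul, zero_add, add_zero] at hX
    rw [map_div₀, ← div_eq_mul_inv, div_div, eq_div_iff (mul_ne_zero hγ coordX_ne_zero), hX]

variable [IsAlgClosed k]

lemma exists_reversal (h : f.reflect 6 = f) : ∃ τ : CurveAut f, τ (coordX f) = (coordX f)⁻¹ ∧
    τ (coordY f) = coordY f * ((coordX f)⁻¹) ^ 3 := by
  obtain ⟨τ, hX, hY⟩ := exists_functionField_algEquiv hf.out
    (g := f) (α := 0) (β := 1) (γ := 1) (δ := 0) (e := 1)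
    (by simp) one_ne_zero (by simp [sexticForm_one_X (isGenusTwo_natDegree_le hf.out), h])
  simp only [map_one, map_zero, one_mul, zero_mul, add_zero, zero_add] at hX hY
  refine ⟨τ, eq_inv_of_mul_eq_one_left hX, ?_⟩
  rw [inv_pow, eq_mul_inv_iff_mul_eq₀ (pow_ne_zero 3 coordX_ne_zero), hY]

/-- If the automorphisms of a curve act on `X` by scalings and reversed scalings, and those
acting by scalings form a cyclic group, then the automorphism group is dihedral. -/
lemma nonempty_curveAut_mulEquiv_dihedralGroup {n : ℕ} [NeZero n] (hrev : f.reflect 6 = f)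
    {ρ : CurveAut f} {a e : k} (hX : ρ (coordX f) = algebraMap k _ a * coordX f)
    (hY : ρ (coordY f) = algebraMap k _ e * coordY f) (hae : e ^ 2 = a ^ 3) (ha : a ≠ 0)
    (hn : orderOf ρ = n)
    (hdiag : ∀ (σ : CurveAut f) (u : k), σ (coordX f) = algebraMap k _ u * coordX f →
      ∃ m : ℕ, σ = ρ ^ m)
    (hcase : ∀ σ : CurveAut f, (∃ u : k, σ (coordX f) = algebraMap k _ u * coordX f) ∨
      ∃ u : k, σ (coordX f) = algebraMap k _ u * (coordX f)⁻¹) :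
    Nonempty (CurveAut f ≃* DihedralGroup n) := by
  obtain ⟨τ, hτX, hτY⟩ := exists_reversal hrev
  have ha' : algebraMap k (FunctionField f) a ≠ 0 := (map_ne_zero _).2 ha
  have hX0 := coordX_ne_zero (f := f)
  have hτ : τ * τ = 1 := by
    refine curveAut_ext ?_ ?_
    · rw [AlgEquiv.mul_apply, hτX, map_inv₀, hτX, inv_inv, AlgEquiv.one_apply]
    · rw [AlgEquiv.mul_apply, hτY, map_mul, map_pow, map_inv₀, hτX, hτY, inv_inv,
        AlgEquiv.one_apply, mul_assoc, ← mul_pow, inv_mul_cancel₀ hX0, one_pow, mul_one]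
  refine nonempty_mulEquiv_dihedralGroup hn hτ ?_ (fun m hm => ?_) fun σ => ?_
  · refine eq_inv_of_mul_eq_one_left (curveAut_ext ?_ ?_)
    · simp only [AlgEquiv.mul_apply, hX, hτX, map_mul, AlgEquiv.commutes, map_inv₀,
        AlgEquiv.one_apply]
      field_simp
    · simp only [AlgEquiv.mul_apply, hX, hτX, hY, hτY, map_mul, AlgEquiv.commutes, map_inv₀,
        AlgEquiv.one_apply, map_pow]
      have h1 := congrArg (algebraMap k (FunctionField f)) hae
      simp only [map_pow] at h1
      field_simp
      linear_combination coordY f * h1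
  · have h1 := DFunLike.congr_fun hm (coordX f)
    rw [hτX, pow_apply_of_scaling hX] at h1
    exact algebraMap_mul_coordX_ne_inv _ h1
  · rcases hcase σ with ⟨u, hu⟩ | ⟨u, hu⟩
    · exact .inl (hdiag σ u hu)
    · obtain ⟨m, hm⟩ := hdiag (τ * σ) u (by
        rw [AlgEquiv.mul_apply, hu, map_mul, AlgEquiv.commutes, map_inv₀, hτX, inv_inv])
      exact .inr ⟨m, by rw [← hm, ← mul_assoc, hτ, one_mul]⟩

end Dihedral

/-! ### The automorphism groups of the general normal forms -/

section DihedralNormalForms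

variable {k : Type*} [Field k] [CharZero k]

lemma reflect_quinticD4 (s : k) : (quinticD4 s).reflect 6 = quinticD4 s := by
  rw [← sexticForm_one_X (natDegree_quinticD4 s ▸ by norm_num), sexticForm_quinticD4]
  ring

lemma reflect_sexticD6 (b : k) : (sexticD6 b).reflect 6 = sexticD6 b := by
  rw [← sexticForm_one_X (natDegree_sexticD6 b).le, sexticForm_sexticD6]
  ring

variable [IsAlgClosed k]

/-- The scalings are the powers of ρ : X ↦ -X, Y ↦ iY. For a scaling X ↦ uX, Y ↦ eY, the
coefficients of X and X³ give u = e² and, as s ≠ 0, u² = 1, so e is a fourth root of unity. -/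
theorem curveAut_quinticD4 {s : k} (h4 : s ^ 2 ≠ 4) (hs : s ≠ 0) (hs' : 9 * s ^ 2 ≠ 100) :
    Nonempty (CurveAut (quinticD4 s) ≃* DihedralGroup 4) := by
  have hg := isGenusTwo_quinticD4 h4
  have := Fact.mk hg
  obtain ⟨i, hi⟩ := IsAlgClosed.exists_pow_nat_eq (-1 : k) (n := 2) (by norm_num)
  have hi0 : i ≠ 0 := by rintro rfl; norm_num at hi
  obtain ⟨ρ, hX, hY⟩ := exists_functionField_algEquiv hg (g := quinticD4 s) (α := -1) (β := 0)
    (γ := 0) (δ := 1) (e := i) (by simp) hi0 (by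
      rw [sexticForm_quinticD4, hi]
      simp only [Polynomial.C_neg, Polynomial.C_0, Polynomial.C_1]
      ring)
  replace hX : ρ (coordX (quinticD4 s)) = algebraMap k _ (-1) * coordX _ := by simpa using hX
  replace hY : ρ (coordY (quinticD4 s)) = algebraMap k _ i * coordY _ := by simpa using hY
  refine nonempty_curveAut_mulEquiv_dihedralGroup (reflect_quinticD4 s) hX hY
    (by rw [hi]; norm_num) (by norm_num) ?_ (fun σ u hu => ?_)
    (scaling_or_reversed_scaling (diagonal_or_antidiagonal_quinticD4 hs hs'))
  · refine orderOf_eq_prime_pow (p := 2) (n := 1) (fun h => ?_) ?_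
    · have h1 := pow_eq_one_of_scaling coordY_ne_zero hY h
      rw [pow_one, hi] at h1
      norm_num at h1
    · rw [← pow_zero ρ]
      refine (eq_pow_of_scaling hX hY (pow_apply_of_scaling hX _) (pow_apply_of_scaling hY _)
        (by norm_num) ?_)
      linear_combination (i ^ 2 - 1) * hi
  · obtain ⟨e, he, hσY, hc⟩ := apply_coordY_of_scaling hu
    have h1 : u = e ^ 2 := by simpa [Polynomial.coeff_X] using hc 1
    have h3 : s * u ^ 3 = e ^ 2 * s := by simpa [Polynomial.coeff_X] using hc 3
    have hu0 : u ≠ 0 := by rw [h1]; exact pow_ne_zero 2 he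
    have hu2 : u ^ 2 = 1 := by
      apply mul_left_cancel₀ (mul_ne_zero hs hu0)
      linear_combination h3 - s * h1
    rcases sq_eq_one_iff.1 hu2 with rfl | rfl
    · rcases sq_eq_one_iff.1 h1.symm with rfl | rfl
      · exact ⟨0, eq_pow_of_scaling hX hY hu hσY (by norm_num) (by norm_num)⟩
      · exact ⟨2, eq_pow_of_scaling hX hY hu hσY (by norm_num) hi.symm⟩
    · rcases sq_eq_sq_iff_eq_or_eq_neg.1 (h1.symm.trans hi.symm) with rfl | rfl
      · exact ⟨1, eq_pow_of_scaling hX hY hu hσY (by norm_num) (by norm_num)⟩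
      · exact ⟨3, eq_pow_of_scaling hX hY hu hσY (by norm_num) (by linear_combination -i * hi)⟩

/-- The scalings are the powers of ρ : X ↦ wX, Y ↦ -Y with w a primitive cube root of unity. The
constant coefficient gives e² = 1 and, as b ≠ 0, that of X³ gives u³ = 1, leaving six pairs (u, e).
-/
theorem curveAut_sexticD6 {b : k} (h4 : b ^ 2 ≠ 4) (hb : b ≠ 0) (hb' : b ^ 2 ≠ -50) :
    Nonempty (CurveAut (sexticD6 b) ≃* DihedralGroup 6) := by
  have hg := isGenusTwo_sexticD6 h4
  have := Fact.mk hg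
  obtain ⟨w, hw⟩ := exists_sq_add_mul_add_eq_zero (1 : k) 1
  have hw0 : w ≠ 0 := by rintro rfl; norm_num at hw
  have hw1 : w ≠ 1 := by rintro rfl; norm_num at hw
  have hw3 : w ^ 3 = 1 := by linear_combination (w - 1) * hw
  obtain ⟨ρ, hX, hY⟩ := exists_functionField_algEquiv hg (g := sexticD6 b) (α := w) (β := 0)
    (γ := 0) (δ := 1) (e := -1) (by simpa) (by norm_num) (by
      have hW := congrArg Polynomial.C hw3
      simp only [Polynomial.C_pow, Polynomial.C_1] at hW
      rw [sexticForm_sexticD6]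
      simp only [sexticD6, Polynomial.C_pow, Polynomial.C_neg, Polynomial.C_0, Polynomial.C_1]
      linear_combination ((Polynomial.C w ^ 3 + 1) * Polynomial.X ^ 6 +
        Polynomial.C b * Polynomial.X ^ 3) * hW)
  replace hX : ρ (coordX (sexticD6 b)) = algebraMap k _ w * coordX _ := by simpa using hX
  replace hY : ρ (coordY (sexticD6 b)) = algebraMap k _ (-1) * coordY _ := by simpa using hY
  refine nonempty_curveAut_mulEquiv_dihedralGroup (reflect_sexticD6 b) hX hY
    (by rw [hw3]; norm_num) hw0 ?_ (fun σ u hu => ?_)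
    (scaling_or_reversed_scaling (diagonal_or_antidiagonal_sexticD6 hb hb'))
  · rw [orderOf_eq_iff (by norm_num)]
    refine ⟨?_, fun m hm hm0 h => ?_⟩
    · rw [← pow_zero ρ]
      refine (eq_pow_of_scaling hX hY (pow_apply_of_scaling hX _) (pow_apply_of_scaling hY _)
        ?_ (by norm_num))
      linear_combination (w ^ 3 + 1) * hw3
    · have h1 := pow_eq_one_of_scaling coordX_ne_zero hX h
      have h2 := pow_eq_one_of_scaling coordY_ne_zero hY h
      interval_cases m
      · exact hw1 (by simpa using h1)
      · exact hw1 (by linear_combination hw3 - w * h1)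
      · norm_num at h2
      · exact hw1 (by linear_combination h1 - w * hw3)
      · norm_num at h2
  · obtain ⟨e, -, hσY, hc⟩ := apply_coordY_of_scaling hu
    have h0 : e ^ 2 = 1 := by simpa [Polynomial.coeff_one, eq_comm] using hc 0
    have h3 : b * u ^ 3 = e ^ 2 * b := by simpa [Polynomial.coeff_one] using hc 3
    have hu3 : u ^ 3 = 1 := by
      apply mul_left_cancel₀ hb
      linear_combination h3 + b * h0
    have hfac : (u - 1) * ((u - w) * (u - w ^ 2)) = 0 := by
      linear_combination hu3 - hw3 + (-u ^ 2 + u * w) * hw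
    have he := sq_eq_one_iff.1 h0
    have pow : ∀ {m : ℕ}, u = w ^ m → e = (-1) ^ m → σ = ρ ^ m :=
      eq_pow_of_scaling hX hY hu hσY
    rcases mul_eq_zero.1 hfac with h | h
    · rcases he with rfl | rfl
      · exact ⟨0, pow (by linear_combination h) (by norm_num)⟩
      · exact ⟨3, pow (by linear_combination h - hw3) (by norm_num)⟩
    rcases mul_eq_zero.1 h with h | h
    · rcases he with rfl | rfl
      · exact ⟨4, pow (by linear_combination h - w * hw3) (by norm_num)⟩
      · exact ⟨1, pow (by linear_combination h) (by norm_num)⟩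
    · rcases he with rfl | rfl
      · exact ⟨2, pow (by linear_combination h) (by norm_num)⟩
      · exact ⟨5, pow (by linear_combination h - w ^ 2 * hw3) (by norm_num)⟩

end DihedralNormalForms

/-! ### The automorphism loci inside the two curves -/

section Loci

variable {k : Type*} [Field k] [CharZero k]

/-- The first coordinate suffices: 3/320 is the fixed point of v ↦ 3/160 - v, so it is a double
root. -/
lemma eq_of_paramC1_eq_pointP {v : k} (h : paramC1 v = pointP k) : v = 3 / 320 := by
  have h0 := congrFun h 0
  simp only [paramC1, pointP, Matrix.cons_val_zero] at h0
  have h1 : (v - 3 / 320) ^ 2 = 0 := by linear_combination -(1 / 46080) * h0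
  exact sub_eq_zero.1 (pow_eq_zero_iff two_ne_zero |>.1 h1)

/-- The first coordinate takes the same value at v = -1/160, so the second one is needed to separate
the two parameters. -/
lemma eq_of_paramC1_eq_pointQ {v : k} (h : paramC1 v = pointQ k) : v = 1 / 40 := by
  have h0 := congrFun h 0
  have h1 := congrFun h 1
  simp only [paramC1, pointQ, Matrix.cons_val_zero, Matrix.cons_val_one] at h0 h1
  grind

lemma eq_of_paramC2_eq_pointP {v : k} (h : paramC2 v = pointP k) : v = -1 / 240 := by
  have h0 := congrFun h 0
  have h1 := congrFun h 1
  simp only [paramC2, pointP, Matrix.cons_val_zero, Matrix.cons_val_one] at h0 h1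
  grind

lemma eq_of_paramC2_eq_pointQ {v : k} (h : paramC2 v = pointQ k) : v = -1 / 540 := by
  have h0 := congrFun h 0
  simp only [paramC2, pointQ, Matrix.cons_val_zero] at h0
  have h1 : (v + 1 / 540) ^ 2 = 0 := by linear_combination (1 / 2099520) * h0
  linear_combination pow_eq_zero_iff two_ne_zero |>.1 h1

/-- The parameters of the curves with automorphism group `D₄`. -/
def parametersD4 (k : Type*) [Field k] : Set k := {0, 1 / 64, 3 / 320, 1 / 40}ᶜ

/-- The parameters of the curves with automorphism group `D₆`. -/
def parametersD6 (k : Type*) [Field k] : Set k := {0, -1 / 216, -1 / 240, -1 / 540}ᶜ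

lemma paramC1_three_div : paramC1 (3 / 160 : k) = ![0, 729 / 50, 729 / 12800000] := by
  funext i
  fin_cases i <;> simp [paramC1] <;> norm_num

lemma three_div_mem_parametersD4 : (3 / 160 : k) ∈ parametersD4 k := by
  simp only [parametersD4, Set.mem_compl_iff, Set.mem_insert_iff, Set.mem_singleton_iff, not_or]
  norm_num

variable [IsAlgClosed k]

/-- The parameter is v = 1 / (6s² + 40). The excluded values are 0, which is no inverse of J₂, then
1/64 for s² = 4 (not squarefree), and 3/320 and 1/40 for 9s² = 100 and s = 0 (larger automorphism
group). -/
lemma autLocus_D4_eq_image : autLocus k (DihedralGroup 4) = paramC1 '' parametersD4 k := by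
  ext p
  constructor
  · rintro ⟨f, hf, hJ, ⟨e⟩, hp⟩
    obtain ⟨s, ⟨hg, hJ2, rfl⟩, ⟨e'⟩⟩ := exists_quinticD4 ⟨hf, hJ, hp⟩ e
    refine ⟨_, ?_, (absInv_quinticD4 hJ2).symm⟩
    have h0 := ne_zero_of_quinticD4 hg e'
    have h100 := sq_ne_of_quinticD4 hg e'
    have h4 := J10_ne_zero hg
    rw [J10_quinticD4] at h4
    have h2 := J2_quinticD4 s
    rintro (h | h | h | h)
    · exact inv_ne_zero hJ2 h
    · rw [inv_eq_iff_eq_inv, h2] at h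
      refine h4 ?_
      rw [show s ^ 2 = 4 by norm_num at h; linear_combination (1 / 6) * h]
      norm_num
    · rw [inv_eq_iff_eq_inv, h2] at h
      norm_num at h
      exact h100 (by linear_combination (9 / 6) * h)
    · rw [Set.mem_singleton_iff, inv_eq_iff_eq_inv, h2] at h
      norm_num at h
      exact h0 h
  · rintro ⟨v, hv, rfl⟩
    simp only [parametersD4, Set.mem_compl_iff, Set.mem_insert_iff, Set.mem_singleton_iff,
      not_or] at hv
    obtain ⟨hv0, hv1, hv2, hv3⟩ := hv
    obtain ⟨s, hs⟩ := IsAlgClosed.exists_pow_nat_eq ((v⁻¹ - 40) / 6) (n := 2) (by norm_num)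
    have hJ : J2 (quinticD4 s) = v⁻¹ := by
      rw [J2_quinticD4, hs]
      ring
    have hvs : v = (6 * s ^ 2 + 40)⁻¹ := by rw [← J2_quinticD4, hJ, inv_inv]
    have h4 : s ^ 2 ≠ 4 := fun h => hv1 (by rw [hvs, h]; norm_num)
    have h0 : s ≠ 0 := fun h => hv3 (by rw [hvs, h]; norm_num)
    have h100 : 9 * s ^ 2 ≠ 100 := fun h => hv2 (by
      rw [hvs, show s ^ 2 = 100 / 9 by linear_combination (1 / 9) * h]
      norm_num)
    have hJ0 : J2 (quinticD4 s) ≠ 0 := hJ ▸ inv_ne_zero hv0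
    refine ⟨quinticD4 s, isGenusTwo_quinticD4 h4, hJ0, curveAut_quinticD4 h4 h0 h100, ?_⟩
    rw [absInv_quinticD4 hJ0, hJ, inv_inv]

/-- The parameter is v = 1 / (6b² - 240). The values -1/216, -1/240 and -1/540 correspond to b² = 4,
b = 0 and b² = -50. -/
lemma autLocus_D6_eq_image : autLocus k (DihedralGroup 6) = paramC2 '' parametersD6 k := by
  ext p
  constructor
  · rintro ⟨f, hf, hJ, ⟨e⟩, hp⟩
    obtain ⟨b, ⟨hg, hJ2, rfl⟩, ⟨e'⟩⟩ := exists_sexticD6 ⟨hf, hJ, hp⟩ e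
    refine ⟨_, ?_, (absInv_sexticD6 hJ2).symm⟩
    have h0 := ne_zero_of_sexticD6 hg e'
    have h50 := sq_ne_of_sexticD6 hg e'
    have h4 := J10_ne_zero hg
    rw [J10_sexticD6] at h4
    have h2 := J2_sexticD6 b
    rintro (h | h | h | h)
    · exact inv_ne_zero hJ2 h
    · rw [inv_eq_iff_eq_inv, h2] at h
      refine h4 ?_
      rw [show b ^ 2 = 4 by norm_num at h; linear_combination (1 / 6) * h]
      norm_num
    · rw [inv_eq_iff_eq_inv, h2] at h
      norm_num at h
      exact h0 (by simpa using h)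
    · rw [Set.mem_singleton_iff, inv_eq_iff_eq_inv, h2] at h
      norm_num at h
      exact h50 (by linear_combination (1 / 6) * h)
  · rintro ⟨v, hv, rfl⟩
    simp only [parametersD6, Set.mem_compl_iff, Set.mem_insert_iff, Set.mem_singleton_iff,
      not_or] at hv
    obtain ⟨hv0, hv1, hv2, hv3⟩ := hv
    obtain ⟨b, hb⟩ := IsAlgClosed.exists_pow_nat_eq ((v⁻¹ + 240) / 6) (n := 2) (by norm_num)
    have hJ : J2 (sexticD6 b) = v⁻¹ := by
      rw [J2_sexticD6, hb]
      ring
    have hvb : v = (6 * b ^ 2 - 240)⁻¹ := by rw [← J2_sexticD6, hJ, inv_inv]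
    have h4 : b ^ 2 ≠ 4 := fun h => hv1 (by rw [hvb, h]; norm_num)
    have h0 : b ≠ 0 := fun h => hv2 (by rw [hvb, h]; norm_num)
    have h50 : b ^ 2 ≠ -50 := fun h => hv3 (by rw [hvb, h]; norm_num)
    have hJ0 : J2 (sexticD6 b) ≠ 0 := hJ ▸ inv_ne_zero hv0
    refine ⟨sexticD6 b, isGenusTwo_sexticD6 h4, hJ0, curveAut_sexticD6 h4 h0 h50, ?_⟩
    rw [absInv_sexticD6 hJ0, hJ, inv_inv]

lemma image_parametersD4 : paramC1 '' parametersD4 k =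
    {p | p ∈ C1 k ∧ p 2 ≠ 0 ∧ p ≠ pointP k ∧ p ≠ pointQ k} := by
  have hz : ∀ v : k, paramC1 v 2 = 216 * v ^ 3 * (1 - 64 * v) ^ 2 := fun v => rfl
  ext p
  constructor
  · rintro ⟨v, hv, rfl⟩
    simp only [parametersD4, Set.mem_compl_iff, Set.mem_insert_iff, Set.mem_singleton_iff,
      not_or] at hv
    obtain ⟨hv0, hv1, hv2, hv3⟩ := hv
    refine ⟨paramC1_mem v, ?_, fun h => hv2 (eq_of_paramC1_eq_pointP h),
      fun h => hv3 (eq_of_paramC1_eq_pointQ h)⟩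
    rw [hz]
    refine mul_ne_zero (mul_ne_zero (by norm_num) (pow_ne_zero 3 hv0)) (pow_ne_zero 2 fun h => ?_)
    exact hv1 (by linear_combination -(1 / 64) * h)
  · rintro ⟨hp, h2, hP, hQ⟩
    obtain ⟨v, rfl⟩ := (C1_eq_range (k := k)).subset hp
    refine ⟨v, ?_, rfl⟩
    rw [hz] at h2
    rintro (rfl | rfl | rfl | rfl)
    · norm_num at h2
    · norm_num at h2
    · exact hP paramC1_eq_pointP
    · exact hQ paramC1_eq_pointQ

lemma image_parametersD6 : paramC2 '' parametersD6 k =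
    {p | p ∈ C2 k ∧ p 2 ≠ 0 ∧ p ≠ pointP k ∧ p ≠ pointQ k} := by
  have hz : ∀ v : k, paramC2 v 2 = 6561 / 4 * v ^ 2 * (1 + 216 * v) ^ 3 := fun v => rfl
  ext p
  constructor
  · rintro ⟨v, hv, rfl⟩
    simp only [parametersD6, Set.mem_compl_iff, Set.mem_insert_iff, Set.mem_singleton_iff,
      not_or] at hv
    obtain ⟨hv0, hv1, hv2, hv3⟩ := hv
    refine ⟨paramC2_mem v, ?_, fun h => hv2 (eq_of_paramC2_eq_pointP h),
      fun h => hv3 (eq_of_paramC2_eq_pointQ h)⟩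
    rw [hz]
    refine mul_ne_zero (mul_ne_zero (by norm_num) (pow_ne_zero 2 hv0)) (pow_ne_zero 3 fun h => ?_)
    exact hv1 (by linear_combination (1 / 216) * h)
  · rintro ⟨hp, h2, hP, hQ⟩
    obtain ⟨v, rfl⟩ := (C2_eq_range (k := k)).subset hp
    refine ⟨v, ?_, rfl⟩
    rw [hz] at h2
    rintro (rfl | rfl | rfl | rfl)
    · norm_num at h2
    · norm_num at h2
    · exact hP paramC2_eq_pointP
    · exact hQ paramC2_eq_pointQ

end Loci

end Genus2

end

theorem mainTheorem1 (k : Type*) [Field k] [IsAlgClosed k] [CharZero k] :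
    -- the components of the singular locus are exactly the two irreducible curves `C₁`, `C₂`
    (Genus2.singularLocus k = Genus2.C1 k ∪ Genus2.C2 k ∧
      Genus2.components (Genus2.singularLocus k) = {Genus2.C1 k, Genus2.C2 k} ∧
      Genus2.C1 k ≠ Genus2.C2 k ∧
      Genus2.algDim (Genus2.C1 k) = 1 ∧
      Genus2.algDim (Genus2.C2 k) = 1) ∧
    -- they project bijectively onto the plane curves given by the two displayed equations
    (Set.BijOn (fun p => (p 0, p 1)) (Genus2.C1 k) {q : k × k | Genus2.eqC1 q.1 q.2 = 0} ∧
      Set.BijOn (fun p => (p 0, p 1)) (Genus2.C2 k) {q : k × k | Genus2.eqC2 q.1 q.2 = 0}) ∧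
    -- `C₁` is the locus of genus 2 curves with automorphism group `D₄` (of order 8)
    (Genus2.autLocus k (DihedralGroup 4) =
        {p | p ∈ Genus2.C1 k ∧ p 2 ≠ 0 ∧ p ≠ Genus2.pointP k ∧ p ≠ Genus2.pointQ k} ∧
      Genus2.zariskiClosure (Genus2.autLocus k (DihedralGroup 4)) = Genus2.C1 k) ∧
    -- `C₂` is the locus of genus 2 curves with automorphism group `D₆` (of order 12)
    (Genus2.autLocus k (DihedralGroup 6) =
        {p | p ∈ Genus2.C2 k ∧ p 2 ≠ 0 ∧ p ≠ Genus2.pointP k ∧ p ≠ Genus2.pointQ k} ∧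
      Genus2.zariskiClosure (Genus2.autLocus k (DihedralGroup 6)) = Genus2.C2 k) ∧
    -- the third piece consists of three points, all of them on `C₁` (and on `C₂`)
    (Genus2.C3 k = {![0, 0, 0], Genus2.pointP k, Genus2.pointQ k} ∧
      Genus2.C3 k = Genus2.C1 k ∩ Genus2.C2 k) ∧
    -- the point `(0, 729/50, 729/12800000)` lies on `C₁` and has automorphism group `D₄`
    (![0, 729 / 50, 729 / 12800000] ∈ Genus2.C1 k ∧
      ![0, 729 / 50, 729 / 12800000] ∈ Genus2.autLocus k (DihedralGroup 4)) := by
  refine ⟨⟨Genus2.singularLocus_eq, Genus2.components_singularLocus,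
    fun h => Genus2.not_C1_subset_C2 h.subset, Genus2.algDim_C1, Genus2.algDim_C2⟩,
    ⟨Genus2.bijOn_C1, Genus2.bijOn_C2⟩,
    ⟨Genus2.autLocus_D4_eq_image.trans Genus2.image_parametersD4, ?_⟩,
    ⟨Genus2.autLocus_D6_eq_image.trans Genus2.image_parametersD6, ?_⟩,
    ⟨Genus2.C3_eq, Genus2.C3_eq.trans Genus2.C1_inter_C2.symm⟩, ?_, ?_⟩
  · rw [Genus2.autLocus_D4_eq_image]
    exact Genus2.zariskiClosure_image_paramC1 (Set.toFinite _).infinite_compl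
  · rw [Genus2.autLocus_D6_eq_image]
    exact Genus2.zariskiClosure_image_paramC2 (Set.toFinite _).infinite_compl
  · rw [← Genus2.paramC1_three_div]
    exact Genus2.paramC1_mem _
  · rw [Genus2.autLocus_D4_eq_image, ← Genus2.paramC1_three_div]
    exact Set.mem_image_of_mem _ Genus2.three_div_mem_parametersD4
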